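/- Let $j\ge 0$, let $I=[-1,1]$, and let $M$ be a compact connected smooth manifold with non-empty boundary $\partial M$ and interior $M^\circ$. Let $\mathrm{EC}(j,M)$ be the space of smooth embeddings $f:\mathbb R^j\times M\to\mathbb R^j\times M$ with support in $I^j\times M$. A splicing diagram with $n$ pucks is an equivalence class of tuples $(L_0,L_1,\dots,L_n,\sigma)$, where $L_0\in \mathrm{EC}(j,M)$, the pucks $L_1,\dots,L_n: I^j\times M\to I^j\times M$ are smooth embeddings, $\sigma\in\Sigma_n$ (the puck $L_i$ has height $\sigma^{-1}(i)$), and the following continuity constraint holds: $$\overline{L_0(\mathbb R^j\times M)\setminus L_k(I^j\times M)}\cap L_k((I^j)^\circ\times\partial M)=\emptyset\quad\text{for all }k\ge 1,$$ $$\overline{L_i(I^j\times M)\setminus L_k(I^j\times M)}\cap L_k((I^j)^\circ\times\partial M)=\emptyset\quad\text{whenever } i,k\ge1,\ \sigma^{-1}(i)<\sigma^{-1}(k).$$ Two such tuples $(L,\sigma)$ and $(L',\sigma')$ are equivalent if $L=L'$ and, whenever $L_i((I^j)^\circ\times M)\cap L_k((I^j)^\circ\times M)\ne\emptyset$ with $i,k\geq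 1$, $\sigma^{-1}(i)<\sigma^{-1}(k)\Leftrightarrow\sigma'^{-1}(i)<\sigma'^{-1}(k)$. Let $\mathcal{SC}_j^M(n)$ be the set of splicing diagrams with $n$ pucks, with the quotient topology coming from the $C^\infty$ topology on the embeddings and the discrete topology on $\Sigma_n$. The group $\Sigma_n$ acts on the right by $(L_0,L_1,\dots,L_n,\alpha).\sigma=(L_0,L_{\sigma(1)},\dots,L_{\sigma(n)},\sigma^{-1}\alpha)$. For $J=(J_0,\dots,J_k,\alpha)\in\mathcal{SC}_j^M(k)$ and $L_a=(L_{a,0},\dots,L_{a,n_a},\sigma_a)\in\mathcal{SC}_j^M(n_a)$, $1\le a\le k$, put $\Phi_i=J_{\alpha(i)}L_{\alpha(i),0}J_{\alpha(i)}^{-1}$, extended by the identity outside the image of $J_{\alpha(i)}$. The composite $J.L$, with $n_1+\dots+n_k$ pucks, has $0$-th entry $\Phi_k\circ\dots\circ\Phi_1\circ J_0$ and $(a,b)$-th puck $\Phi_k\circ\dots\circ\Phi_{\alpha^{-1}(a)+1}\circ J_a\circ L_{a,b}$ for $1\le b\le n_a$, where the pairs $(a,b)$ are numbered lexicographically; its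 permutation $\beta$ is given by $$\beta^{-1}\Big(\sum_{i<a}n_i+b\Big)=\sum_{i<\alpha^{-1}(a)}n_{\alpha(i)}+\sigma_a^{-1}(b).$$ Then $J.L$ is a well-defined element of $\mathcal{SC}_j^M(n_1+\dots+n_k)$: for all representatives the formulas define a tuple as above, and its class does not depend on the representatives. Moreover, let $$(\mathcal{SC}_j^M)^\circ(k)=\{(L_0,\dots,L_k,\sigma)\in\mathcal{SC}_j^M(k): L_{0|\mathbb R^j\times M^\circ},\,L_{1|I^j\times\partial M},\dots,L_{k|I^j\times\partial M}\text{ have pairwise disjoint images}\},$$ with the subspace topology. Then: 1. $(\mathcal{SC}_j^M)^\circ=\bigsqcup_k(\mathcal{SC}_j^M)^\circ(k)$ is a suboperad without identity, in the sense that it is closed under the symmetric group actions and under the structure maps $(J,L_1,\dots,L_k)\mapsto J.L$ (nothing is required about the identity); and for every $k\geq 0$ the inclusion $(\mathcal{SC}_j^M)^\circ(k)\to\mathcal{SC}_j^M(k)$ is a homotopy equivalence. 2. The same holds for the smaller subspaces defined by requiring that $L_0$ (on all of $\mathbb R^j\times M$), $L_{1|I^j\times\partial M},\dots,L_{k|I^j\times\partial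 M}$ have pairwise disjoint images, and these do not contain the identity $(\mathrm{Id},\mathrm{Id},e)\in\mathcal{SC}_j^M(1)$ of the operad. -/

import Mathlib

open Set Topology
open scoped Manifold ContDiff

noncomputable section

namespace Splicing

universe u

/-! ### The smooth compact-open topology -/

/-- The compact-open `C^k` topology for maps `N → N` regarded on a subset `s` of `N`: the coarsest
topology for which the `k`-fold iterated tangent map `f ↦ T^k f` is continuous, where maps
`T^k s → T^k N` carry the compact-open topology. -/
@[reducible] def ckTopology : ℕ → ∀ (E : Type) [NormedAddCommGroup E] [NormedSpace ℝ E]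
    (H : Type) [TopologicalSpace H] (I : ModelWithCorners ℝ E H)
    (N : Type u) [TopologicalSpace N] [ChartedSpace H N] [IsManifold I ∞ N] (_s : Set N),
    TopologicalSpace (N → N)
  | 0, _, _, _, _, _, _, N, _, _, _, s =>
      TopologicalSpace.generateFrom
        {V | ∃ K U : Set N, IsCompact K ∧ K ⊆ s ∧ IsOpen U ∧ V = {f : N → N | MapsTo f K U}}
  | k + 1, E, _, _, H, _, I, N, _, _, _, s =>
      (ckTopology k (E × E) (ModelProd H E) I.tangent (TangentBundle I N)
        ((fun v : TangentBundle I N => v.proj) ⁻¹' s)).induced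
          (fun f => tangentMapWithin I I f s)

/-- The compact-open `C^∞` topology for maps `N → N` regarded on a subset `s` of `N`: the join of
the compact-open `C^k` topologies. -/
@[reducible] def cInftyTopology {E : Type} [NormedAddCommGroup E] [NormedSpace ℝ E]
    {H : Type} [TopologicalSpace H] (I : ModelWithCorners ℝ E H)
    {N : Type u} [TopologicalSpace N] [ChartedSpace H N] [IsManifold I ∞ N] (s : Set N) :
    TopologicalSpace (N → N) :=
  ⨅ k : ℕ, ckTopology k E H I N s

/-! ### Long embeddings and pucks -/

/-- The ambient manifold `ℝ^j × M`. -/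
abbrev Amb (j : ℕ) (M : Type u) : Type u := EuclideanSpace ℝ (Fin j) × M

/-- The model with corners of `ℝ^j × M`, for `M` an `m`-manifold with boundary. -/
abbrev ambModel (j m : ℕ) [NeZero m] := (𝓡 j).prod (𝓡∂ m)

section Regions

variable (j m : ℕ) [NeZero m] (M : Type u) [TopologicalSpace M]
  [ChartedSpace (EuclideanHalfSpace m) M]

/-- `[-1,1]^j × M`. -/
def solid (j : ℕ) (M : Type u) : Set (Amb j M) := {p | ∀ i, p.1 i ∈ Icc (-1 : ℝ) 1}

/-- `([-1,1]^j)° × M`. -/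
def openSolid (j : ℕ) (M : Type u) : Set (Amb j M) := {p | ∀ i, p.1 i ∈ Ioo (-1 : ℝ) 1}

/-- `[-1,1]^j × ∂M`. -/
def side : Set (Amb j M) := {p ∈ solid j M | p.2 ∈ (𝓡∂ m).boundary M}

/-- `([-1,1]^j)° × ∂M`. -/
def openSide : Set (Amb j M) := {p ∈ openSolid j M | p.2 ∈ (𝓡∂ m).boundary M}

/-- The space of long embeddings: smooth embeddings `ℝ^j × M → ℝ^j × M` with support in
`[-1,1]^j × M`. -/
@[ext] structure LongEmb where
  toFun : Amb j M → Amb j M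
  smooth : ContMDiff (ambModel j m) (ambModel j m) ∞ toFun
  immersion : ∀ p, Function.Injective (mfderiv (ambModel j m) (ambModel j m) toFun p)
  embedding : IsEmbedding toFun
  support : ∀ p, p ∉ solid j M → toFun p = p

/-- Pucks: smooth embeddings `[-1,1]^j × M → [-1,1]^j × M` of manifolds with corners. Such a map is
recorded as a function on `ℝ^j × M`, by giving it the value `p` at every `p` outside its domain
`[-1,1]^j × M`; two pucks are thus equal if and only if they agree on `[-1,1]^j × M`. -/
@[ext] structure Puck where
  toFun : Amb j M → Amb j M
  mapsTo : MapsTo toFun (solid j M) (solid j M)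
  smooth : ContMDiffOn (ambModel j m) (ambModel j m) ∞ toFun (solid j M)
  immersion : ∀ p ∈ solid j M,
    Function.Injective (mfderivWithin (ambModel j m) (ambModel j m) toFun (solid j M) p)
  embedding : IsEmbedding ((solid j M).domRestrict toFun)
  off_domain : ∀ p, p ∉ solid j M → toFun p = p

instance : CoeFun (LongEmb j m M) (fun _ => Amb j M → Amb j M) := ⟨LongEmb.toFun⟩

instance : CoeFun (Puck j m M) (fun _ => Amb j M → Amb j M) := ⟨Puck.toFun⟩

instance [IsManifold (𝓡∂ m) ∞ M] : TopologicalSpace (LongEmb j m M) :=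
  (cInftyTopology (ambModel j m) (univ : Set (Amb j M))).induced LongEmb.toFun

instance [IsManifold (𝓡∂ m) ∞ M] : TopologicalSpace (Puck j m M) :=
  (cInftyTopology (ambModel j m) (solid j M)).induced Puck.toFun

/-! ### Splicing diagrams -/

/-- Tuples `(L_0, L_1, …, L_n, σ)` that satisfy the continuity constraint. The puck `L_i` is at
height `σ⁻¹ i`; the long embedding `L_0` is below all pucks. -/
@[ext] structure PreDiagram (n : ℕ) where
  long : LongEmb j m M
  puck : Fin n → Puck j m M
  perm : Equiv.Perm (Fin n)
  constraint_long : ∀ k,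
    closure (range long \ puck k '' solid j M) ∩ puck k '' openSide j m M = ∅
  constraint_puck : ∀ i k, perm⁻¹ i < perm⁻¹ k →
    closure (puck i '' solid j M \ puck k '' solid j M) ∩ puck k '' openSide j m M = ∅

/-- The topology of the product of the embedding spaces and the discrete group `Σ_n`. -/
instance [IsManifold (𝓡∂ m) ∞ M] (n : ℕ) : TopologicalSpace (PreDiagram j m M n) :=
  TopologicalSpace.induced PreDiagram.long inferInstance ⊓
    TopologicalSpace.induced PreDiagram.puck inferInstance ⊓
    TopologicalSpace.induced PreDiagram.perm ⊥

/-- Same embeddings, and the same relative heights for any two pucks that overlap. -/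
def diagramSetoid (n : ℕ) : Setoid (PreDiagram j m M n) where
  r P Q := P.long = Q.long ∧ P.puck = Q.puck ∧
    ∀ i k, (P.puck i '' openSolid j M ∩ P.puck k '' openSolid j M).Nonempty →
      (P.perm⁻¹ i < P.perm⁻¹ k ↔ Q.perm⁻¹ i < Q.perm⁻¹ k)
  iseqv :=
    { refl := fun _ => ⟨rfl, rfl, fun _ _ _ => Iff.rfl⟩
      symm := fun {P Q} h => ⟨h.1.symm, h.2.1.symm, fun i k hik =>
        (h.2.2 i k (by rw [h.2.1]; exact hik)).symm⟩
      trans := fun {P Q R} h h' => ⟨h.1.trans h'.1, h.2.1.trans h'.2.1, fun i k hik =>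
        (h.2.2 i k hik).trans (h'.2.2 i k (by rw [← h.2.1]; exact hik))⟩ }

/-- The space `SC_j^M(n)` of splicing diagrams with `n` pucks. -/
def SC (n : ℕ) : Type u := Quotient (diagramSetoid j m M n)

instance [IsManifold (𝓡∂ m) ∞ M] (n : ℕ) : TopologicalSpace (SC j m M n) :=
  inferInstanceAs (TopologicalSpace (Quotient (diagramSetoid j m M n)))

end Regions

variable {j m : ℕ} [NeZero m] {M : Type u} [TopologicalSpace M]
  [ChartedSpace (EuclideanHalfSpace m) M]

/-- The splicing diagram represented by a tuple. -/
def SC.mk {n : ℕ} (P : PreDiagram j m M n) : SC j m M n := Quotient.mk (diagramSetoid j m M n) P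

/-- The long embedding `L_0` of a splicing diagram. -/
def SC.long {n : ℕ} : SC j m M n → LongEmb j m M :=
  Quotient.lift PreDiagram.long (fun _ _ h => h.1)

/-- The pucks `L_1, …, L_n` of a splicing diagram. -/
def SC.puck {n : ℕ} : SC j m M n → Fin n → Puck j m M :=
  Quotient.lift PreDiagram.puck (fun _ _ h => h.2.1)

/-! ### The symmetric group action, the structure maps and the identity -/

/-- `(L_0, L_1, …, L_n, α).σ = (L_0, L_{σ 1}, …, L_{σ n}, σ⁻¹ α)`. -/
def PreDiagram.act {n : ℕ} (P : PreDiagram j m M n) (σ : Equiv.Perm (Fin n)) :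
    PreDiagram j m M n where
  long := P.long
  puck i := P.puck (σ i)
  perm := σ⁻¹ * P.perm
  constraint_long k := P.constraint_long (σ k)
  constraint_puck i k h := P.constraint_puck (σ i) (σ k) (by simpa using h)

/-- The right action of `Σ_n` on `SC_j^M(n)`. -/
def SC.act {n : ℕ} (x : SC j m M n) (σ : Equiv.Perm (Fin n)) : SC j m M n :=
  Quotient.map' (s₁ := diagramSetoid j m M n) (s₂ := diagramSetoid j m M n)
    (fun P => P.act σ)
    (fun P Q h => ⟨h.1, funext fun i => congrFun h.2.1 (σ i), fun i k hik => by
      simpa [PreDiagram.act] using h.2.2 (σ i) (σ k) hik⟩) x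

open Classical in
/-- `L f L⁻¹` on the image `L([-1,1]^j × M)` of a puck `L`, extended by the identity. -/
def graft (L : Puck j m M) (f : Amb j M → Amb j M) (p : Amb j M) : Amb j M :=
  if h : ∃ q ∈ solid j M, L q = p then L (f h.choose) else p

/-- `g (k-1) ∘ ⋯ ∘ g (c+1) ∘ g c`. -/
def composeFrom {X : Type u} {k : ℕ} (g : Fin k → X → X) (c : ℕ) : X → X :=
  ((List.finRange k).filter (fun i => c ≤ i.val)).foldl (fun acc i => g i ∘ acc) id

/-- The maps `J_{α(i)} L_{α(i),0} J_{α(i)}⁻¹`, extended by the identity, in order of height. -/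
def graftAt {k : ℕ} {n : Fin k → ℕ} (J : PreDiagram j m M k)
    (L : ∀ a, PreDiagram j m M (n a)) (i : Fin k) : Amb j M → Amb j M :=
  graft (J.puck (J.perm i)) (L (J.perm i)).long

/-- The long entry of `J.L`. -/
def compLong {k : ℕ} {n : Fin k → ℕ} (J : PreDiagram j m M k)
    (L : ∀ a, PreDiagram j m M (n a)) : Amb j M → Amb j M :=
  composeFrom (graftAt J L) 0 ∘ J.long

/-- The `(a,b)`-th puck entry of `J.L`. -/
def compPuck {k : ℕ} {n : Fin k → ℕ} (J : PreDiagram j m M k)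
    (L : ∀ a, PreDiagram j m M (n a)) (a : Fin k) (b : Fin (n a)) : Amb j M → Amb j M :=
  composeFrom (graftAt J L) ((J.perm⁻¹ a).val + 1) ∘ J.puck a ∘ (L a).puck b

/-- The inverse of the permutation of `J.L`. With pairs `(a,b)` numbered lexicographically, it sends
`∑_{i<a} n_i + b` to `∑_{i<α⁻¹(a)} n_{α(i)} + (σ_a)⁻¹(b)`. -/
def compHeight {k : ℕ} {n : Fin k → ℕ} (α : Equiv.Perm (Fin k))
    (σ : ∀ a, Equiv.Perm (Fin (n a))) : Equiv.Perm (Fin (∑ a, n a)) :=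
  finSigmaFinEquiv.symm.trans <|
    (Equiv.sigmaCongrRight fun a => (σ a)⁻¹).trans <|
    (Equiv.sigmaCongrLeft (β := fun a => Fin (n a)) α).symm.trans <|
    (finSigmaFinEquiv (n := fun i => n (α i))).trans <|
    finCongr (Equiv.sum_comp α n)

/-- `K = J.L`: for any choice of representatives of `J` and of the `L_a`, the tuple defined by the
formulas above is a tuple of smooth embeddings that satisfies the continuity constraint, and it
represents `K`. -/
def IsComposite {k : ℕ} {n : Fin k → ℕ} (J : SC j m M k) (L : ∀ a, SC j m M (n a))
    (K : SC j m M (∑ a, n a)) : Prop :=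
  ∀ (P : PreDiagram j m M k) (Q : ∀ a, PreDiagram j m M (n a)),
    SC.mk P = J → (∀ a, SC.mk (Q a) = L a) →
    ∃ R : PreDiagram j m M (∑ a, n a), SC.mk R = K ∧
      (R.long : Amb j M → Amb j M) = compLong P Q ∧
      (∀ a b, (R.puck (finSigmaFinEquiv ⟨a, b⟩) : Amb j M → Amb j M) = compPuck P Q a b) ∧
      R.perm⁻¹ = compHeight P.perm (fun a => (Q a).perm)

/-- A family of subsets of the `SC_j^M(n)` that is closed under the symmetric group actions and
under the structure maps. Nothing is required about the identity. -/
def IsSuboperadWithoutIdentity (S : ∀ n, Set (SC j m M n)) : Prop :=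
  (∀ n, ∀ x ∈ S n, ∀ σ : Equiv.Perm (Fin n), x.act σ ∈ S n) ∧
  ∀ (k : ℕ) (n : Fin k → ℕ) (J : SC j m M k) (L : ∀ a, SC j m M (n a)),
    J ∈ S k → (∀ a, L a ∈ S (n a)) → ∃ K ∈ S (∑ a, n a), IsComposite J L K

lemma uniqueMDiffOn_solid (j m : ℕ) [NeZero m] (M : Type u) [TopologicalSpace M]
    [ChartedSpace (EuclideanHalfSpace m) M] [IsManifold (𝓡∂ m) ∞ M] :
    UniqueMDiffOn (ambModel j m) (solid j M) := by
  have hset : solid j M =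
      {x : EuclideanSpace ℝ (Fin j) | ∀ i, x i ∈ Icc (-1 : ℝ) 1} ×ˢ (univ : Set M) := by
    ext p; simp [solid]
  rw [hset]
  refine UniqueMDiffOn.prod (UniqueDiffOn.uniqueMDiffOn ?_) uniqueMDiffOn_univ
  refine uniqueDiffOn_convex ?_ ?_
  · intro x hx y hy a b ha hb hab i
    exact (convex_Icc (-1 : ℝ) 1) (hx i) (hy i) ha hb hab
  · refine ⟨0, mem_interior.2 ⟨{x | ∀ i, x i ∈ Ioo (-1 : ℝ) 1},
      fun x hx i => Ioo_subset_Icc_self (hx i), ?_, fun i => by simp⟩⟩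
    simp only [ofPred_forall]
    exact isOpen_iInter_of_finite fun i => isOpen_Ioo.preimage (by fun_prop)

lemma isOpen_openSolid (j : ℕ) (M : Type u) [TopologicalSpace M] : IsOpen (openSolid j M) := by
  simp only [openSolid, ofPred_forall]
  exact isOpen_iInter_of_finite fun i => isOpen_Ioo.preimage (by fun_prop)

section Identity

variable (j m M)

/-- The identity of `ℝ^j × M`. -/
def idLong : LongEmb j m M where
  toFun := id
  smooth := contMDiff_id
  immersion p := by rw [mfderiv_id]; exact fun _ _ h => h
  embedding := IsEmbedding.id
  support _ _ := rfl

/-- The identity of `[-1,1]^j × M`. -/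
def idPuck [IsManifold (𝓡∂ m) ∞ M] : Puck j m M where
  toFun := id
  mapsTo := mapsTo_id _
  smooth := contMDiffOn_id
  immersion p hp := by
    rw [mfderivWithin_id (uniqueMDiffOn_solid j m M p hp)]; exact fun _ _ h => h
  embedding := IsEmbedding.subtypeVal
  off_domain _ _ := rfl

/-- The tuple `(Id, Id, e)`. -/
def idPre [IsManifold (𝓡∂ m) ∞ M] : PreDiagram j m M 1 where
  long := idLong j m M
  puck _ := idPuck j m M
  perm := 1
  constraint_long k := by
    rw [← disjoint_iff_inter_eq_empty]
    refine Set.disjoint_of_subset_right (u := openSolid j M) ?_ ?_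
    · rintro _ ⟨p, hp, rfl⟩
      exact hp.1
    · refine Disjoint.closure_left ?_ (isOpen_openSolid j M)
      rw [Set.disjoint_left]
      rintro p ⟨-, hp⟩ hp'
      exact hp ⟨p, fun i => Ioo_subset_Icc_self (hp' i), rfl⟩
  constraint_puck i k h := absurd h (by rw [Subsingleton.elim i k]; exact lt_irrefl _)

/-- The identity of the operad of splicing diagrams. -/
def SC.one [IsManifold (𝓡∂ m) ∞ M] : SC j m M 1 := SC.mk (idPre j m M)

/-! ### Diagrams with disjoint components -/

/-- The diagrams for which the maps `L_0` restricted to `ℝ^j × S` and `L_1, …, L_n` restricted to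
`[-1,1]^j × ∂M` have pairwise disjoint images. -/
def disjointDiagrams (S : Set M) (n : ℕ) : Set (SC j m M n) :=
  {x | (∀ i, Disjoint (x.long '' {p | p.2 ∈ S}) (x.puck i '' side j m M)) ∧
    ∀ i k, i ≠ k → Disjoint (x.puck i '' side j m M) (x.puck k '' side j m M)}

/-- `(SC_j^M)°(n)`. -/
def SCcirc (n : ℕ) : Set (SC j m M n) := disjointDiagrams j m M ((𝓡∂ m).interior M) n

/-- The variant of `(SC_j^M)°(n)` in which `L_0` is not restricted to the interior of `M`. -/
def SCstrict (n : ℕ) : Set (SC j m M n) := disjointDiagrams j m M univ n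

end Identity

/-- The inclusion of a subspace is a homotopy equivalence. -/
def InclusionIsHomotopyEquiv {X : Type u} [TopologicalSpace X] (A : Set X) : Prop :=
  ∃ e : ContinuousMap.HomotopyEquiv A X, ∀ a : A, e a = a

end Splicing

end

/-!
# Splicing diagrams with disjoint components

**The structure maps.** The entries of `J.L` are obtained from `J_0`, or from `J_a L_{a,b}`, by
applying in order of height the maps `Φ_i`, which are `J_a L_{a,0} J_a⁻¹` extended by the identity.
Such an extension is not smooth as a map on `ℝ^j × M`, because the image of `J_a` is not open. But
it is applied only to maps `f` that lie below `J_a` (`Below`). The continuity constraint and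
invariance of domain make `f⁻¹(J_a((I^j)° × M))` relatively open (`Below.preimage_mem_nhdsWithin`),
so the composite can fail to be smooth only at points that `f` sends to `J_a(∂I^j × M)`. There
`L_{a,0}` has the jet of the identity, hence in charts the difference between `J_a L_{a,0} J_a⁻¹`
and the identity is flat, and a flat function composed with `f` extends smoothly by zero
(`IsFlatOff.contDiffOn_indicator`, `GraftData.glue`). So composites consist of smooth embeddings
(`Layer.graft`). The constraint is preserved because the `Φ_i` are injective and the layers are
closed maps (`below_compPuck`, `below_compPuck_same`). The result does not depend on the
representatives: pucks in different order do not overlap, so that the corresponding `Φ_i` commute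
(`composeFrom_zero_congr`, `composeFrom_succ_congr`), and if two pucks of the composite overlap,
then a chain of overlaps between pucks of `J` fixes their order (`lt_of_overlap`).

**The suboperads.** If `Φ_i` sends a point to a side of the puck `J_a L_{a,b}`, where `J_a` has
height `i`, then, as `L_a` has disjoint components, the point is on a side of `J_a`, or does not
exist in the stricter variant (`mem_side_of_graft`). This gives `IsDisjoint.compose`. In the stricter
variant nothing is required of `J`.

**The homotopy equivalences.** By the last remark, it suffices to move the identity of the operad.
Pushing `M` off its boundary in finitely many charts, with a strength that is positive exactly for
`t > 0` and on the open cube, gives a smooth isotopy of long embeddings (`exists_isPush_univ`). With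
pucks that scale the cube by `1 - t/2`, this is a path of one-puck diagrams `Q_t`
(`IsPush.diagram`), where `Q_0` is the identity and `Q_t` has disjoint components for `t > 0`. Then
`(P, t) ↦ P.(Q_t, …, Q_t)` deforms the space of diagrams, and at all positive times takes values in
either subspace; hence both inclusions are homotopy equivalences
(`inclusionIsHomotopyEquiv_of_deformation`).

Continuity of this deformation in the `C^∞` topology is the analytic part. A map into the mapping
space is continuous if and only if the iterated tangent maps are jointly continuous in the parameter
and the tangent vector (`JointCk.continuous`, `jointCk_of_continuous`). The relations that
characterize a splicing pass to tangent bundles (`SpliceData.tangent`), with the tangent map of the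
puck still proper in families because it is fibrewise injective (`SpliceFamily.proper_tangent`). This
reduces the claim to continuity of order zero (`SpliceFamily.continuousOn`). The openness needed
there, that a map below a puck goes into the open part of the puck for all nearby parameters, is
invariance of domain in a family (`exists_nhds_subset_image`, `eventually_mem_image_openSolid`).
-/

set_option linter.unusedSectionVars false

noncomputable section

namespace Splicing

universe u

/-! ### Flat extension by zero in normed spaces -/

section Flat

variable {E F G : Type} [NormedAddCommGroup E] [NormedSpace ℝ E] [NormedAddCommGroup F]
  [NormedSpace ℝ F] [NormedAddCommGroup G] [NormedSpace ℝ G]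

/-- If `u` vanishes off a relatively open subset `U` of a convex set and its derivative on `U` tends
to zero at a point outside `U`, then `u` has zero derivative there: on a segment from that point,
apply the mean value inequality after the last exit from the complement of `U`. -/
lemma hasFDerivWithinAt_zero_of_tendsto_zero {T U : Set E} (hT : Convex ℝ T) {u : E → F}
    {u' : E → E →L[ℝ] F} {p₀ : E} (hp₀ : p₀ ∈ T) (hp₀U : p₀ ∉ U)
    (hU : ∀ p ∈ U, p ∈ T → U ∈ 𝓝[T] p) (hu : ContinuousOn u T)
    (h0 : ∀ p ∈ T, p ∉ U → u p = 0)
    (hd : ∀ p ∈ T, p ∈ U → HasFDerivWithinAt u (u' p) T p)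
    (hlim : Filter.Tendsto u' (𝓝[T ∩ U] p₀) (𝓝 0)) :
    HasFDerivWithinAt u (0 : E →L[ℝ] F) T p₀ := by
  rw [hasFDerivWithinAt_iff_isLittleO, Asymptotics.isLittleO_iff]
  intro ε hε
  have h1 : ∀ᶠ p in 𝓝[T ∩ U] p₀, ‖u' p‖ ≤ ε := by
    have := hlim.norm
    rw [norm_zero] at this
    exact this.eventually (eventually_le_nhds hε)
  rw [eventually_nhdsWithin_iff, Metric.eventually_nhds_iff_ball] at h1
  obtain ⟨δ, hδ, h1⟩ := h1
  filter_upwards [inter_mem_nhdsWithin T (Metric.ball_mem_nhds p₀ hδ)] with p hp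
  rw [h0 p₀ hp₀ hp₀U]
  simp only [sub_zero, _root_.zero_apply]
  by_cases hpU : p ∈ U
  swap
  · rw [h0 p hp.1 hpU, norm_zero]; positivity
  set γ : ℝ → E := fun t => p₀ + t • (p - p₀) with hγ
  have hγc : Continuous γ := by fun_prop
  have hγT : ∀ t ∈ Icc (0 : ℝ) 1, γ t ∈ T := fun t ht => by
    have := hT hp₀ hp.1 (sub_nonneg.2 ht.2) ht.1 (by ring)
    convert this using 1
    simp only [hγ]; module
  have hγb : ∀ t ∈ Icc (0 : ℝ) 1, γ t ∈ Metric.ball p₀ δ := fun t ht => by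
    have h2 : ‖p - p₀‖ < δ := by simpa [dist_eq_norm] using hp.2
    simp only [hγ, Metric.mem_ball, dist_eq_norm, add_sub_cancel_left, norm_smul, Real.norm_eq_abs,
      abs_of_nonneg ht.1]
    nlinarith [norm_nonneg (p - p₀), ht.2, ht.1]
  set B : Set ℝ := {t ∈ Icc (0 : ℝ) 1 | γ t ∉ U} with hB
  have hBclosed : IsClosed B := by
    rw [← closure_subset_iff_isClosed]
    intro t ht
    have htI : t ∈ Icc (0 : ℝ) 1 := closure_minimal (fun x hx => hx.1) isClosed_Icc ht
    refine ⟨htI, fun htU => ?_⟩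
    have h3 := hU _ htU (hγT t htI)
    have h4 : Filter.Tendsto γ (𝓝[Icc 0 1] t) (𝓝[T] (γ t)) :=
      tendsto_nhdsWithin_iff.2 ⟨hγc.continuousAt.mono_left nhdsWithin_le_nhds,
        eventually_mem_nhdsWithin.mono fun x hx => hγT x hx⟩
    have h5 := h4 h3
    rw [Filter.mem_map, mem_nhdsWithin] at h5
    obtain ⟨V, hVo, htV, hV⟩ := h5
    obtain ⟨x, hxV, hxB⟩ := mem_closure_iff.1 ht V hVo htV
    exact hxB.2 (hV ⟨hxV, hxB.1⟩)
  have hBne : B.Nonempty := ⟨0, ⟨le_rfl, zero_le_one⟩, by simpa [hγ] using hp₀U⟩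
  have hBbdd : BddAbove B := ⟨1, fun x hx => hx.1.2⟩
  set a := sSup B with ha
  have haB : a ∈ B := hBclosed.csSup_mem hBne hBbdd
  have ha1 : a < 1 := lt_of_le_of_ne haB.1.2 fun h => haB.2 (by rw [h]; simpa [hγ] using hpU)
  have haU : ∀ t ∈ Ioc a 1, γ t ∈ U := fun t ht => by
    by_contra h
    exact not_lt.2 (le_csSup hBbdd ⟨⟨haB.1.1.trans ht.1.le, ht.2⟩, h⟩) ht.1
  have hφc : ContinuousOn (fun t => u (γ t)) (Icc 0 1) := hu.comp hγc.continuousOn hγT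
  have key : ∀ s ∈ Ioc a 1, ‖u p - u (γ s)‖ ≤ ε * ‖p - p₀‖ := by
    intro s hs
    have hs0 : 0 ≤ s := haB.1.1.trans hs.1.le
    have hder : ∀ t ∈ Icc s 1, HasDerivWithinAt (fun t => u (γ t)) (u' (γ t) (p - p₀))
        (Icc s 1) t := by
      intro t ht
      have htI : t ∈ Icc (0 : ℝ) 1 := ⟨hs0.trans ht.1, ht.2⟩
      have h6 : HasDerivWithinAt γ (p - p₀) (Icc s 1) t := by
        have := ((hasDerivAt_id t).smul_const (p - p₀)).const_add p₀
        rw [one_smul] at this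
        exact this.hasDerivWithinAt
      exact (hd _ (hγT t htI) (haU t ⟨hs.1.trans_le ht.1, ht.2⟩)).comp_hasDerivWithinAt t h6
        (fun x hx => hγT x ⟨hs0.trans hx.1, hx.2⟩)
    have := norm_image_sub_le_of_norm_deriv_le_segment' hder (C := ε * ‖p - p₀‖) (fun t ht => by
      have htI : t ∈ Icc (0 : ℝ) 1 := ⟨hs0.trans ht.1, ht.2.le⟩
      refine (ContinuousLinearMap.le_opNorm _ _).trans ?_
      gcongr
      exact h1 _ (hγb t htI) ⟨hγT t htI, haU t ⟨hs.1.trans_le ht.1, ht.2.le⟩⟩) 1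
        ⟨hs.2, le_rfl⟩
    have hγ1 : γ 1 = p := by simp [hγ]
    rw [hγ1] at this
    refine this.trans ?_
    have : 0 ≤ ε * ‖p - p₀‖ := by positivity
    nlinarith
  have hlim2 : Filter.Tendsto (fun s => ‖u p - u (γ s)‖) (𝓝[Ioc a 1] a) (𝓝 ‖u p - u (γ a)‖) := by
    refine (tendsto_const_nhds.sub ?_).norm
    exact ((hφc a haB.1).mono fun x hx => ⟨haB.1.1.trans hx.1.le, hx.2⟩).tendsto
  rw [h0 _ (hγT a haB.1) haB.2, sub_zero] at hlim2
  have : (𝓝[Ioc a 1] a).NeBot := by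
    rw [← mem_closure_iff_nhdsWithin_neBot, closure_Ioc ha1.ne]; exact ⟨le_rfl, ha1.le⟩
  exact le_of_tendsto hlim2 (eventually_mem_nhdsWithin.mono fun s hs => key s hs)

/-- `w` is smooth on `S` and all its derivatives vanish on `S \ O`. -/
def IsFlatOff (S O : Set G) (w : G → F) : Prop :=
  ContDiffOn ℝ ∞ w S ∧ ∀ q ∈ S, q ∉ O → ∀ n : ℕ, iteratedFDerivWithin ℝ n w S q = 0

lemma IsFlatOff.fderivWithin {S O : Set G} (hS : UniqueDiffOn ℝ S) {w : G → F}
    (hw : IsFlatOff S O w) : IsFlatOff S O (fderivWithin ℝ w S) := by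
  refine ⟨hw.1.fderivWithin hS (by simp), fun q hq hqO n => ?_⟩
  rw [← norm_eq_zero, norm_iteratedFDerivWithin_fderivWithin hS hq, hw.2 q hq hqO, norm_zero]

lemma IsFlatOff.eq_zero {S O : Set G} {w : G → F} (hw : IsFlatOff S O w) {q : G} (hq : q ∈ S)
    (hqO : q ∉ O) : w q = 0 := by
  have := hw.2 q hq hqO 0
  rw [← norm_eq_zero, norm_iteratedFDerivWithin_zero, norm_eq_zero] at this
  exact this

/-- The composite of a flat function with a smooth map, extended by zero, has zero derivative
outside the open part. -/
lemma IsFlatOff.hasFDerivWithinAt_indicator {T U : Set E} (hT : Convex ℝ T)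
    {S O : Set G} (hS : UniqueDiffOn ℝ S) {f : E → G} (hf : ContDiffOn ℝ ∞ f T)
    (hTu : UniqueDiffOn ℝ T)
    (hUT : U ⊆ T) (hUo : ∀ p ∈ U, U ∈ 𝓝[T] p) (hUS : MapsTo f U S)
    (hlim : ∀ p ∈ T, p ∉ U → p ∈ closure U → f p ∈ S ∧ f p ∉ O)
    {w : G → F} (hw : IsFlatOff S O w) :
    ContinuousOn (U.indicator (w ∘ f)) T ∧ ∀ p ∈ T,
      HasFDerivWithinAt (U.indicator (w ∘ f))
        (U.indicator (fun p => (_root_.fderivWithin ℝ w S (f p)).comp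
          (_root_.fderivWithin ℝ f T p)) p) T p := by
  have hin : ∀ p ∈ U, HasFDerivWithinAt (U.indicator (w ∘ f))
      ((_root_.fderivWithin ℝ w S (f p)).comp (_root_.fderivWithin ℝ f T p)) T p := by
    intro p hp
    have h1 : HasFDerivWithinAt w (_root_.fderivWithin ℝ w S (f p)) S (f p) :=
      ((hw.1.differentiableOn (by simp)) _ (hUS hp)).hasFDerivWithinAt
    have h2 : HasFDerivWithinAt f (_root_.fderivWithin ℝ f T p) T p :=
      ((hf.differentiableOn (by simp)) _ (hUT hp)).hasFDerivWithinAt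
    have h3 := h1.comp p (h2.mono hUT) hUS
    have h4 : HasFDerivWithinAt (U.indicator (w ∘ f)) _ U p :=
      h3.congr (fun x hx => indicator_of_mem hx _) (indicator_of_mem hp _)
    exact h4.mono_of_mem_nhdsWithin (hUo p hp)
  -- composites of flat functions with `f` tend to zero at the frontier of `U`
  have htend : ∀ {F' : Type} [NormedAddCommGroup F'] [NormedSpace ℝ F'] {v : G → F'},
      IsFlatOff S O v → ∀ p ∈ T, p ∉ U → Filter.Tendsto (v ∘ f) (𝓝[U] p) (𝓝 0) := by
    intro F' _ _ v hv p hp hpU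
    by_cases hc : p ∈ closure U
    · obtain ⟨h1, h2⟩ := hlim p hp hpU hc
      have h3 : Filter.Tendsto f (𝓝[U] p) (𝓝[S] (f p)) :=
        tendsto_nhdsWithin_iff.2 ⟨(hf.continuousOn p hp).mono_left (nhdsWithin_mono _ hUT),
          eventually_mem_nhdsWithin.mono fun x hx => hUS hx⟩
      have h4 := (hv.1.continuousOn _ h1).tendsto.comp h3
      rwa [hv.eq_zero h1 h2] at h4
    · rw [mem_closure_iff_nhdsWithin_neBot, Filter.not_neBot] at hc
      rw [hc]; exact Filter.tendsto_bot
  have hcont : ContinuousOn (U.indicator (w ∘ f)) T := by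
    intro p hp
    by_cases hpU : p ∈ U
    · exact (hin p hpU).continuousWithinAt
    · rw [ContinuousWithinAt, indicator_of_notMem hpU]
      have : 𝓝[T] p = 𝓝[U] p ⊔ 𝓝[T \ U] p := by
        rw [← nhdsWithin_union, union_sdiff_cancel hUT]
      rw [this]
      refine Filter.Tendsto.sup ?_ ?_
      · refine (htend hw p hp hpU).congr' ?_
        exact eventually_mem_nhdsWithin.mono fun x hx => (indicator_of_mem hx _).symm
      · refine (tendsto_const_nhds (x := (0 : F))).congr' ?_
        exact eventually_mem_nhdsWithin.mono fun x hx => (indicator_of_notMem hx.2 _).symm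
  refine ⟨hcont, fun p hp => ?_⟩
  by_cases hpU : p ∈ U
  · rw [indicator_of_mem hpU]; exact hin p hpU
  · rw [indicator_of_notMem hpU]
    refine hasFDerivWithinAt_zero_of_tendsto_zero hT hp hpU (fun q hq _ => hUo q hq) hcont
      (fun q _ hq => indicator_of_notMem hq _) (u' := fun p =>
        (_root_.fderivWithin ℝ w S (f p)).comp (_root_.fderivWithin ℝ f T p))
      (fun q _ hq => hin q hq) ?_
    rw [inter_eq_right.2 hUT]
    have h1 := htend (hw.fderivWithin hS) p hp hpU
    have h2 : Filter.Tendsto (_root_.fderivWithin ℝ f T) (𝓝[U] p)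
        (𝓝 (_root_.fderivWithin ℝ f T p)) :=
      ((hf.continuousOn_fderivWithin hTu (by simp)) p hp).mono_left (nhdsWithin_mono _ hUT)
    have h3 : Continuous fun x : (G →L[ℝ] F) × (E →L[ℝ] G) => x.1.comp x.2 := by fun_prop
    have h4 := (h3.tendsto (0, _)).comp (h1.prodMk_nhds h2)
    simpa using! h4

/-- The composite of a flat function with a smooth map, extended by zero, is smooth. -/
lemma IsFlatOff.contDiffOn_indicator {T U : Set E} (hT : Convex ℝ T)
    {S O : Set G} (hS : UniqueDiffOn ℝ S) {f : E → G} (hf : ContDiffOn ℝ ∞ f T)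
    (hTu : UniqueDiffOn ℝ T)
    (hUT : U ⊆ T) (hUo : ∀ p ∈ U, U ∈ 𝓝[T] p) (hUS : MapsTo f U S)
    (hlim : ∀ p ∈ T, p ∉ U → p ∈ closure U → f p ∈ S ∧ f p ∉ O)
    {w : G → F} (hw : IsFlatOff S O w) : ContDiffOn ℝ ∞ (U.indicator (w ∘ f)) T := by
  rw [contDiffOn_infty]
  intro n
  induction n generalizing F with
  | zero =>
    exact contDiffOn_zero.2 (hw.hasFDerivWithinAt_indicator hT hS hf hTu hUT hUo hUS hlim).1
  | succ n ih =>
    have h1 := (hw.hasFDerivWithinAt_indicator hT hS hf hTu hUT hUo hUS hlim).2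
    push_cast
    rw [contDiffOn_succ_iff_hasFDerivWithinAt_of_uniqueDiffOn hTu]
    refine ⟨by simp, _, ?_, h1⟩
    have h2 := ih (hw.fderivWithin hS)
    have h3 : ContDiffOn ℝ n (_root_.fderivWithin ℝ f T) T :=
      (hf.fderivWithin hTu (m := ∞) (by simp)).of_le (by exact_mod_cast le_top)
    refine (h2.clm_comp h3).congr fun p _ => ?_
    by_cases hp : p ∈ U
    · simp [indicator_of_mem hp]
    · simp [indicator_of_notMem hp]

end Flat

section Jets

variable {E F G : Type} [NormedAddCommGroup E] [NormedSpace ℝ E] [NormedAddCommGroup F]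
  [NormedSpace ℝ F] [NormedAddCommGroup G] [NormedSpace ℝ G]

/-- A smooth map that is the identity on an open set has the jets of the identity on its closure. -/
lemma ftaylorSeriesWithin_eq_id {S R Z : Set E} (hSR : S ⊆ R) (hS : UniqueDiffOn ℝ S)
    (hR : UniqueDiffOn ℝ R) {s : E → E} (hs : ContDiffOn ℝ ∞ s R) (hZ : IsOpen Z)
    (hid : ∀ q ∈ Z ∩ R, s q = q) {q : E} (hq : q ∈ S) (hqZ : q ∈ closure (Z ∩ R)) :
    ftaylorSeriesWithin ℝ s S q = ftaylorSeriesWithin ℝ id S q := by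
  funext n
  simp only [ftaylorSeriesWithin]
  have hsn : ContDiffOn ℝ n s R := hs.of_le (by exact_mod_cast le_top)
  have hidn : ContDiffOn ℝ n (id : E → E) R := contDiffOn_id
  rw [iteratedFDerivWithin_subset hSR hS hR hsn hq,
    iteratedFDerivWithin_subset hSR hS hR hidn hq]
  have h1 : ContinuousWithinAt (iteratedFDerivWithin ℝ n s R) R q :=
    (hs.continuousOn_iteratedFDerivWithin (by exact_mod_cast le_top) hR) q (hSR hq)
  have h2 : ContinuousWithinAt (iteratedFDerivWithin ℝ n (id : E → E) R) R q :=
    (contDiffOn_id.continuousOn_iteratedFDerivWithin (n := ∞) (by exact_mod_cast le_top) hR)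
      q (hSR hq)
  have : (𝓝[Z ∩ R] q).NeBot := mem_closure_iff_nhdsWithin_neBot.1 hqZ
  refine tendsto_nhds_unique_of_eventuallyEq (h1.tendsto.mono_left (nhdsWithin_mono q
    (inter_subset_right : Z ∩ R ⊆ R))) (h2.tendsto.mono_left (nhdsWithin_mono q
    (inter_subset_right : Z ∩ R ⊆ R))) ?_
  filter_upwards [eventually_mem_nhdsWithin] with x hx
  have h3 : s =ᶠ[𝓝[R] x] id := by
    filter_upwards [inter_mem_nhdsWithin R (hZ.mem_nhds hx.1)] with y hy
    exact hid y ⟨hy.2, hy.1⟩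
  exact h3.iteratedFDerivWithin_eq (hid x hx) n

/-- If `s` has the jet of the identity at `k x`, then `J ∘ s ∘ k` and `J ∘ k` have the same jet at
`x`. -/
lemma iteratedFDerivWithin_comp_comp_eq {S : Set E} {S' : Set G} (hS : UniqueDiffOn ℝ S)
    (hS' : UniqueDiffOn ℝ S') {J : E → F} {s : E → E} {k : G → E} {x : G} (hx : x ∈ S')
    (hkx : k x ∈ S) (hJ : ContDiffWithinAt ℝ ∞ J S (k x)) (hs : ContDiffWithinAt ℝ ∞ s S (k x))
    (hk : ContDiffWithinAt ℝ ∞ k S' x) (hkS : ∀ᶠ y in 𝓝[S'] x, k y ∈ S)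
    (hsS : ∀ᶠ q in 𝓝[S] (k x), s q ∈ S) (hsk : s (k x) = k x)
    (hjet : ftaylorSeriesWithin ℝ s S (k x) = ftaylorSeriesWithin ℝ id S (k x)) (n : ℕ) :
    iteratedFDerivWithin ℝ n (J ∘ s ∘ k) S' x = iteratedFDerivWithin ℝ n (J ∘ k) S' x := by
  have hn : (n : WithTop ℕ∞) ≤ ∞ := by exact_mod_cast le_top
  have hJs : ContDiffWithinAt ℝ ∞ (J ∘ s) S (k x) :=
    ContDiffWithinAt.comp_of_preimage_mem_nhdsWithin_of_eq (k x) hJ hs hsS hsk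
  have h0 : ftaylorSeriesWithin ℝ (J ∘ s) S (k x) = ftaylorSeriesWithin ℝ J S (k x) := by
    funext i
    have hi : (i : WithTop ℕ∞) ≤ ∞ := by exact_mod_cast le_top
    have e1 := iteratedFDerivWithin_comp_of_eventually_mem (g := J) (i := i) (t := S) (n := ∞)
      (by rwa [hsk]) hs hS hS hkx hsS hi
    have e2 := iteratedFDerivWithin_comp_of_eventually_mem (f := id) (g := J) (i := i) (n := ∞)
      (s := S) (t := S) (x := k x) hJ contDiffWithinAt_id hS hS hkx
      (eventually_mem_nhdsWithin) hi
    simp only [Function.comp_id] at e2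
    simp only [ftaylorSeriesWithin] at *
    rw [e1, hsk, e2, hjet]; rfl
  have e1 := iteratedFDerivWithin_comp_of_eventually_mem (i := n) hJs hk hS hS' hx hkS hn
  have e2 := iteratedFDerivWithin_comp_of_eventually_mem (i := n) hJ hk hS hS' hx hkS hn
  rw [e2, ← h0, ← e1]; rfl

/-- A continuous right inverse of a smooth map with invertible derivatives is smooth. -/
lemma contDiffOn_of_rightInverse [CompleteSpace E] {S : Set E} {S' : Set G} (hS : UniqueDiffOn ℝ S)
    (hS' : UniqueDiffOn ℝ S') {J : E → G} {k : G → E} (hJ : ContDiffOn ℝ ∞ J S)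
    (hk : ContinuousOn k S') (hkS : MapsTo k S' S) (hJk : ∀ x ∈ S', J (k x) = x)
    (hinv : ∀ q ∈ S, (fderivWithin ℝ J S q).IsInvertible) : ContDiffOn ℝ ∞ k S' := by
  rw [contDiffOn_infty]
  intro n
  induction n with
  | zero => exact contDiffOn_zero.2 hk
  | succ n ih =>
    push_cast
    rw [contDiffOn_succ_iff_hasFDerivWithinAt_of_uniqueDiffOn hS']
    refine ⟨by simp, fun x => ContinuousLinearMap.inverse (fderivWithin ℝ J S (k x)), ?_, ?_⟩
    · intro x hx
      have h1 : ContDiffWithinAt ℝ n (fderivWithin ℝ J S ∘ k) S' x :=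
        (((hJ.fderivWithin hS (m := ∞) (by simp)).of_le (by exact_mod_cast le_top)).comp
          ih hkS) x hx
      exact ((hinv _ (hkS hx)).contDiffAt_map_inverse).comp_contDiffWithinAt x h1
    · intro x hx
      obtain ⟨e, he⟩ := hinv _ (hkS hx)
      beta_reduce
      rw [← he, ContinuousLinearMap.inverse_equiv]
      refine HasFDerivWithinAt.of_local_left_inverse (t := S) (f := J) ?_ ?_ hx ?_
      · exact tendsto_nhdsWithin_iff.2 ⟨hk x hx, eventually_mem_nhdsWithin.mono fun y hy => hkS hy⟩
      · rw [he]; exact ((hJ.differentiableOn (by simp)) _ (hkS hx)).hasFDerivWithinAt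
      · exact eventually_mem_nhdsWithin.mono fun y hy => hJk y hy

end Jets

/-! ### Immersions between equidimensional manifolds with boundary -/

section Immersions

variable {E : Type} [NormedAddCommGroup E] [NormedSpace ℝ E]
  {H : Type} [TopologicalSpace H] {I : ModelWithCorners ℝ E H}
  {N : Type u} [TopologicalSpace N] [ChartedSpace H N]

/-- `J` is smooth on `S` with injective derivatives. -/
structure SmoothImmOn (I : ModelWithCorners ℝ E H) (S : Set N) (J : N → N) : Prop where
  smooth : ContMDiffOn I I ∞ J S
  inj : ∀ p ∈ S, Function.Injective (mfderivWithin I I J S p)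

lemma SmoothImmOn.mdiff {S : Set N} {J : N → N} (hJ : SmoothImmOn I S J) {p : N} (hp : p ∈ S) :
    MDifferentiableWithinAt I I J S p :=
  (hJ.smooth p hp).mdifferentiableWithinAt (by simp)

lemma isInvertible_of_injective [FiniteDimensional ℝ E] {A : E →L[ℝ] E}
    (hA : Function.Injective A) : A.IsInvertible :=
  ⟨(LinearEquiv.ofInjectiveEndo A.toLinearMap hA).toContinuousLinearEquiv, by ext; rfl⟩

lemma SmoothImmOn.isInvertible [FiniteDimensional ℝ E] {S : Set N} {J : N → N}
    (hJ : SmoothImmOn I S J) {p : N} (hp : p ∈ S) :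
    (mfderivWithin I I J S p).IsInvertible :=
  isInvertible_of_injective (E := E) (hJ.inj p hp)

lemma SmoothImmOn.comp {S T : Set N} {J f : N → N} (hJ : SmoothImmOn I S J)
    (hf : SmoothImmOn I T f) (hT : UniqueMDiffOn I T) (h : MapsTo f T S) :
    SmoothImmOn I T (J ∘ f) where
  smooth := hJ.smooth.comp hf.smooth h
  inj p hp := by
    rw [mfderivWithin_comp p (hJ.mdiff (h hp)) (hf.mdiff hp) h (hT p hp)]
    exact (hJ.inj _ (h hp)).comp (hf.inj p hp)

lemma SmoothImmOn.uniqueMDiffOn_image [FiniteDimensional ℝ E] {S : Set N} {J : N → N}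
    (hS : UniqueMDiffOn I S) (hJ : SmoothImmOn I S J) : UniqueMDiffOn I (J '' S) := by
  refine hS.image_denseRange (fun p hp => hJ.mdiff hp) fun p hp => ?_
  obtain ⟨e, he⟩ := hJ.isInvertible hp
  rw [← he]; exact e.surjective.denseRange

variable [IsManifold I ∞ N]

lemma contDiffOn_chart {f : N → N} {A : Set N} (hf : ContMDiffOn I I ∞ f A) (x y : N) :
    ContDiffOn ℝ ∞ (extChartAt I y ∘ f ∘ (extChartAt I x).symm)
      ((extChartAt I x).target ∩ (extChartAt I x).symm ⁻¹' (A ∩ f ⁻¹' (extChartAt I y).source)) :=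
  (contMDiffOn_iff.1 hf).2 x y

lemma SmoothImmOn.isInvertible_fderivWithin [FiniteDimensional ℝ E] {S : Set N} {J : N → N}
    (hS : UniqueMDiffOn I S) (hJ : SmoothImmOn I S J) (x y : N) {a : E}
    (ha : a ∈ (extChartAt I y).target ∩ (extChartAt I y).symm ⁻¹'
      (S ∩ J ⁻¹' (extChartAt I x).source)) :
    (fderivWithin ℝ (extChartAt I x ∘ J ∘ (extChartAt I y).symm)
      ((extChartAt I y).target ∩ (extChartAt I y).symm ⁻¹'
        (S ∩ J ⁻¹' (extChartAt I x).source)) a).IsInvertible := by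
  set A := (extChartAt I y).target ∩ (extChartAt I y).symm ⁻¹'
        (S ∩ J ⁻¹' (extChartAt I x).source) with hA
  have hAu : UniqueDiffOn ℝ A := hS.uniqueDiffOn_inter_preimage y x hJ.smooth.continuousOn
  have h1 : HasMFDerivWithinAt 𝓘(ℝ, E) I (extChartAt I y).symm A a
      (mfderivWithin 𝓘(ℝ, E) I (extChartAt I y).symm (range I) a) :=
    (mdifferentiableWithinAt_extChartAt_symm ha.1).hasMFDerivWithinAt.mono
      (inter_subset_left.trans (extChartAt_target_subset_range y))
  have h2 := (hJ.mdiff ha.2.1).hasMFDerivWithinAt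
  have h3 := (mdifferentiableAt_extChartAt (I := I) (x := x) (y := J ((extChartAt I y).symm a))
    (by rw [← extChartAt_source I]; exact ha.2.2)).hasMFDerivAt
  have h4 := (h3.comp_hasMFDerivWithinAt a (h2.comp a h1 (fun b hb => hb.2.1)))
  have h5 : (mfderivWithin 𝓘(ℝ, E) 𝓘(ℝ, E)
      (extChartAt I x ∘ (J ∘ (extChartAt I y).symm)) A a).IsInvertible := by
    rw [h4.mfderivWithin (hAu a ha).uniqueMDiffWithinAt]
    exact (isInvertible_mfderiv_extChartAt ha.2.2).comp
      ((hJ.isInvertible ha.2.1).comp (isInvertible_mfderivWithin_extChartAt_symm ha.1))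
  rwa [mfderivWithin_eq_fderivWithin] at h5

/-- The inverse of an immersion, if continuous, is smooth on the image. -/
lemma SmoothImmOn.contMDiffOn_leftInverse [FiniteDimensional ℝ E] {S : Set N} {J K : N → N}
    (hS : UniqueMDiffOn I S) (hJ : SmoothImmOn I S J) (hK : ContinuousOn K (J '' S))
    (hKJ : ∀ q ∈ S, K (J q) = q) : ContMDiffOn I I ∞ K (J '' S) := by
  have : CompleteSpace E := FiniteDimensional.complete ℝ E
  rw [contMDiffOn_iff]
  refine ⟨hK, fun x y => ?_⟩
  refine contDiffOn_of_rightInverse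
    (hS.uniqueDiffOn_inter_preimage y x hJ.smooth.continuousOn)
    ((hJ.uniqueMDiffOn_image hS).uniqueDiffOn_inter_preimage x y hK)
    (contDiffOn_chart hJ.smooth y x) ?_ ?_ ?_
    (fun q hq => hJ.isInvertible_fderivWithin hS x y hq)
  · refine (continuousOn_extChartAt y).comp (hK.comp
      ((continuousOn_extChartAt_symm x).mono inter_subset_left) fun a ha => ha.2.1)
      fun a ha => ha.2.2
  · rintro a ⟨ha1, ⟨q, hq, hqa⟩, ha3⟩
    have hKq : K ((extChartAt I x).symm a) = q := by rw [← hqa]; exact hKJ q hq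
    simp only [mem_preimage, hKq] at ha3
    refine ⟨(extChartAt I y).map_source (by rw [Function.comp_apply, hKq]; exact ha3), ?_⟩
    simp only [Function.comp_apply, mem_preimage, hKq, (extChartAt I y).left_inv ha3, mem_inter_iff]
    exact ⟨hq, by rw [hqa]; exact (extChartAt I x).map_target ha1⟩
  · rintro a ⟨ha1, ⟨q, hq, hqa⟩, ha3⟩
    have hKq : K ((extChartAt I x).symm a) = q := by rw [← hqa]; exact hKJ q hq
    simp only [mem_preimage, hKq] at ha3
    simp only [Function.comp_apply, hKq, (extChartAt I y).left_inv ha3]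
    rw [hqa, (extChartAt I x).right_inv ha1]

/-- At interior points, an immersion is open and takes values in the interior. -/
lemma map_nhds_eq_of_isInteriorPoint [FiniteDimensional ℝ E] {f : N → N} {p : N}
    (hf : ContMDiffAt I I ∞ f p) (hinj : Function.Injective (mfderiv I I f p))
    (hp : I.IsInteriorPoint p) : I.IsInteriorPoint (f p) ∧ Filter.map f (𝓝 p) = 𝓝 (f p) := by
  have : CompleteSpace E := FiniteDimensional.complete ℝ E
  have hinv : (mfderiv I I f p).IsInvertible := isInvertible_of_injective (E := E) hinj
  have hd : MDifferentiableAt I I f p := hf.mdifferentiableAt (by simp)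
  have hint : I.IsInteriorPoint (f p) := by
    refine hd.isInteriorPoint_of_surjective_mfderiv ?_ hp
    obtain ⟨e, he⟩ := hinv
    rw [← he]; exact e.surjective
  refine ⟨hint, ?_⟩
  set g := writtenInExtChartAt I I p f with hg
  have hr : range I ∈ 𝓝 (extChartAt I p p) := range_mem_nhds_isInteriorPoint hp
  have hr' : range I ∈ 𝓝 (extChartAt I (f p) (f p)) := range_mem_nhds_isInteriorPoint hint
  have hgs : ContDiffAt ℝ ∞ g (extChartAt I p p) := by
    have := (contMDiffAt_iff.1 hf).2
    exact this.contDiffAt hr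
  have hgd : fderiv ℝ g (extChartAt I p p) = mfderiv I I f p := by
    rw [hd.mfderiv]
    exact (fderivWithin_of_mem_nhds hr).symm
  obtain ⟨e, he⟩ := isInvertible_of_injective (E := E) (A := fderiv ℝ g (extChartAt I p p))
    (by rw [hgd]; exact hinj)
  have hst : HasStrictFDerivAt g (e : E →L[ℝ] E) (extChartAt I p p) := by
    rw [he]; exact hgs.hasStrictFDerivAt (by simp)
  have hmap := hst.map_nhds_eq_of_equiv
  have hgp : g (extChartAt I p p) = extChartAt I (f p) (f p) := by simp [hg, writtenInExtChartAt]
  have h1 : Filter.map (extChartAt I p).symm (𝓝 (extChartAt I p p)) = 𝓝 p := by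
    have := map_extChartAt_symm_nhdsWithin_range (I := I) p
    rwa [nhdsWithin_eq_nhds.2 hr] at this
  have h2 : Filter.map (extChartAt I (f p)).symm (𝓝 (extChartAt I (f p) (f p))) = 𝓝 (f p) := by
    have := map_extChartAt_symm_nhdsWithin_range (I := I) (f p)
    rwa [nhdsWithin_eq_nhds.2 hr'] at this
  rw [hgp] at hmap
  rw [← hmap, Filter.map_map] at h2
  rw [← h2]
  conv_lhs => rw [← h1, Filter.map_map]
  refine Filter.map_congr ?_
  have h3 : ∀ᶠ a in 𝓝 (extChartAt I p p), f ((extChartAt I p).symm a) ∈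
      (extChartAt I (f p)).source := by
    have h4 : ∀ᶠ q in Filter.map (extChartAt I p).symm (𝓝 (extChartAt I p p)),
        f q ∈ (extChartAt I (f p)).source := by
      rw [h1]
      exact hf.continuousAt (extChartAt_source_mem_nhds (f p))
    exact h4
  filter_upwards [h3] with a ha
  simp only [hg, writtenInExtChartAt, Function.comp_apply, (extChartAt I (f p)).left_inv ha]

/-! ### Gluing along the ends of a puck -/

/-- Every point of `T` has arbitrarily small neighbourhoods in `T` that are convex in the preferred
chart. -/
def ConvexInCharts (I : ModelWithCorners ℝ E H) (T : Set N) : Prop :=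
  ∀ p ∈ T, ∀ V ∈ 𝓝 (extChartAt I p p), ∃ C ⊆ V, Convex ℝ C ∧ UniqueDiffOn ℝ C ∧
    extChartAt I p p ∈ C ∧
    C ⊆ (extChartAt I p).target ∩ (extChartAt I p).symm ⁻¹' T ∧
    C ∈ 𝓝[(extChartAt I p).symm ⁻¹' T ∩ range I] (extChartAt I p p)

/-- A smooth embedding `J` of `S` with inverse `K`, together with a smooth map `s` that preserves
`S` and is the identity on an open set `Z` whose closure contains `S \ O`. -/
structure GraftData (I : ModelWithCorners ℝ E H) (S O Z : Set N) (J K s : N → N) : Prop where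
  uniqueS : UniqueMDiffOn I S
  imm : SmoothImmOn I S J
  leftInv : ∀ q ∈ S, K (J q) = q
  smoothK : ContMDiffOn I I ∞ K (J '' S)
  smooth_s : ContMDiff I I ∞ s
  mapsTo_s : MapsTo s S S
  openZ : IsOpen Z
  idZ : ∀ q ∈ Z, s q = q
  dense : S \ O ⊆ closure Z

variable {S O Z T U : Set N} {J K s f h : N → N}

lemma GraftData.s_eq [T2Space N] (D : GraftData I S O Z J K s) {q : N} (hq : q ∈ S) (hqO : q ∉ O) :
    s q = q :=
  closure_minimal (s := Z) (t := {q | s q = q}) D.idZ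
    (isClosed_eq D.smooth_s.continuous continuous_id) (D.dense ⟨hq, hqO⟩)

lemma GraftData.smoothGraft (D : GraftData I S O Z J K s) :
    ContMDiffOn I I ∞ (J ∘ s ∘ K) (J '' S) := by
  have h1 : MapsTo K (J '' S) S := by rintro _ ⟨q, hq, rfl⟩; rwa [D.leftInv q hq]
  exact D.imm.smooth.comp (D.smooth_s.comp_contMDiffOn D.smoothK)
    (fun y hy => D.mapsTo_s (h1 hy))

/-- In a chart, the difference between `J s J⁻¹` and the identity is flat along `J (S \ O)`: there
`s` has the jets of the identity. -/
lemma GraftData.isFlatOff [FiniteDimensional ℝ E] [T2Space N] (D : GraftData I S O Z J K s)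
    (x : N) :
    IsFlatOff ((extChartAt I x).target ∩ (extChartAt I x).symm ⁻¹'
        (J '' S ∩ (J ∘ s ∘ K) ⁻¹' (extChartAt I x).source))
      ((extChartAt I x).symm ⁻¹' (J '' O))
      (fun a => (extChartAt I x ∘ (J ∘ s ∘ K) ∘ (extChartAt I x).symm) a - a) := by
  have hΨ := contDiffOn_chart (I := I) D.smoothGraft x x
  have hS' : UniqueDiffOn ℝ ((extChartAt I x).target ∩ (extChartAt I x).symm ⁻¹'
        (J '' S ∩ (J ∘ s ∘ K) ⁻¹' (extChartAt I x).source)) :=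
    (D.imm.uniqueMDiffOn_image D.uniqueS).uniqueDiffOn_inter_preimage x x
    D.smoothGraft.continuousOn
  set φ := extChartAt I x with hφ
  refine ⟨hΨ.sub contDiffOn_id, fun a ha haO n => ?_⟩
  obtain ⟨ha1, ⟨q, hq, hqa⟩, ha3⟩ := ha
  have hqO : q ∉ O := fun h => haO ⟨q, h, hqa⟩
  have hsq : s q = q := D.s_eq hq hqO
  have hKa : K ((φ).symm a) = q := by rw [← hqa]; exact D.leftInv q hq
  have ha : a ∈ ((φ).target ∩ (φ).symm ⁻¹'
        (J '' S ∩ (J ∘ s ∘ K) ⁻¹' (φ).source)) := ⟨ha1, ⟨q, hq, hqa⟩, ha3⟩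
  set A := ((φ).target ∩ (φ).symm ⁻¹'
        (J '' S ∩ (J ∘ s ∘ K) ⁻¹' (φ).source)) with hA
  set ψ := extChartAt I q with hψ
  set S₁ := S ∩ s ⁻¹' ψ.source with hS₁
  have hopen : IsOpen (s ⁻¹' ψ.source) :=
    (isOpen_extChartAt_source q).preimage D.smooth_s.continuous
  have hS₁u : UniqueMDiffOn I S₁ := D.uniqueS.inter hopen
  set B := ψ.target ∩ ψ.symm ⁻¹' (S₁ ∩ J ⁻¹' (φ).source) with hB
  have hJ₁ : ContMDiffOn I I ∞ J S₁ := D.imm.smooth.mono inter_subset_left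
  have hBu : UniqueDiffOn ℝ B := hS₁u.uniqueDiffOn_inter_preimage q x hJ₁.continuousOn
  set R := ψ.target ∩ ψ.symm ⁻¹' (univ ∩ s ⁻¹' ψ.source) with hR
  have hRu : UniqueDiffOn ℝ R :=
    uniqueMDiffOn_univ.uniqueDiffOn_inter_preimage q q D.smooth_s.continuous.continuousOn
  have hBR : B ⊆ R := fun b hb => ⟨hb.1, mem_univ _, hb.2.1.2⟩
  have hŝ : ContDiffOn ℝ ∞ (ψ ∘ s ∘ ψ.symm) R := contDiffOn_chart D.smooth_s.contMDiffOn q q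
  have hĴ : ContDiffOn ℝ ∞ (φ ∘ J ∘ ψ.symm) B := contDiffOn_chart hJ₁ q x
  have hqs : q ∈ ψ.source := mem_extChartAt_source q
  have hJqx : J q ∈ (φ).source := by rw [hqa]; exact (φ).map_target ha1
  have hψqB : ψ q ∈ B := by
    refine ⟨ψ.map_source hqs, ?_⟩
    simp only [mem_preimage, ψ.left_inv hqs]
    exact ⟨⟨hq, by simpa [hsq] using hqs⟩, hJqx⟩
  set k := ψ ∘ K ∘ (φ).symm with hk
  have hka : k a = ψ q := by simp [hk, hKa]
  -- points near `a` stay in the domains of all charts involved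
  have hcK : ContinuousWithinAt (K ∘ (φ).symm) A a :=
    (D.smoothK.continuousOn.comp ((continuousOn_extChartAt_symm x).mono inter_subset_left)
      fun b hb => hb.2.1) a ha
  have hKA : ∀ b ∈ A, K ((φ).symm b) ∈ S ∧
      J (K ((φ).symm b)) = (φ).symm b := by
    rintro b ⟨-, ⟨r, hr, hrb⟩, -⟩
    rw [← hrb, D.leftInv r hr]; exact ⟨hr, rfl⟩
  have ev1 : ∀ᶠ b in 𝓝[A] a, K ((φ).symm b) ∈ ψ.source :=
    hcK (by rw [Function.comp_apply, hKa]; exact (isOpen_extChartAt_source q).mem_nhds hqs)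
  have ev2 : ∀ᶠ b in 𝓝[A] a, s (K ((φ).symm b)) ∈ ψ.source :=
    hcK (by rw [Function.comp_apply, hKa]; exact hopen.mem_nhds (by simpa [hsq] using hqs))
  have hkB : ∀ᶠ b in 𝓝[A] a, k b ∈ B := by
    filter_upwards [ev1, ev2, eventually_mem_nhdsWithin] with b h1 h2 h3
    refine ⟨ψ.map_source h1, ?_⟩
    simp only [hk, Function.comp_apply, mem_preimage, ψ.left_inv h1]
    refine ⟨⟨(hKA b h3).1, h2⟩, ?_⟩
    simp only [mem_preimage, (hKA b h3).2]; exact (φ).map_target h3.1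
  have hkc : ContDiffWithinAt ℝ ∞ k A a := by
    have h1 := contDiffOn_chart D.smoothK x q
    refine (h1 a ⟨ha1, ⟨q, hq, hqa⟩, by
      rw [mem_preimage, hKa]; exact hqs⟩).mono_of_mem_nhdsWithin ?_
    filter_upwards [ev1, eventually_mem_nhdsWithin] with b h1 h2
    exact ⟨h2.1, h2.2.1, h1⟩
  have hsB : ∀ᶠ b in 𝓝[B] (ψ q), (ψ ∘ s ∘ ψ.symm) b ∈ B := by
    have hc : ContinuousAt (fun b => s (ψ.symm b)) (ψ q) :=
      D.smooth_s.continuous.continuousAt.comp (continuousAt_extChartAt_symm q)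
    have hq0 : s (ψ.symm (ψ q)) = q := by rw [ψ.left_inv hqs, hsq]
    have e1 : ∀ᶠ b in 𝓝[B] (ψ q), s (s (ψ.symm b)) ∈ ψ.source := by
      have h9 : s ⁻¹' ψ.source ∈ 𝓝 (s (ψ.symm (ψ q))) := by
        rw [hq0]; exact hopen.mem_nhds (by simpa [hsq] using hqs)
      exact nhdsWithin_le_nhds (hc h9)
    have hcJ : ContinuousWithinAt (fun b => J (s (ψ.symm b))) B (ψ q) := by
      have : ContinuousWithinAt J S (s (ψ.symm (ψ q))) := by
        rw [hq0]; exact D.imm.smooth.continuousOn q hq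
      exact ContinuousWithinAt.comp (f := fun b => s (ψ.symm b)) this hc.continuousWithinAt
        (fun b hb => D.mapsTo_s hb.2.1.1)
    have e2 : ∀ᶠ b in 𝓝[B] (ψ q), J (s (ψ.symm b)) ∈ (φ).source := by
      have h9 : φ.source ∈ 𝓝 (J (s (ψ.symm (ψ q)))) := by
        rw [hq0]; exact (isOpen_extChartAt_source x).mem_nhds hJqx
      exact hcJ h9
    filter_upwards [e1, e2, eventually_mem_nhdsWithin] with b h1 h2 h3
    refine ⟨ψ.map_source h3.2.1.2, ?_⟩
    simp only [Function.comp_apply, mem_preimage, ψ.left_inv h3.2.1.2]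
    exact ⟨⟨D.mapsTo_s h3.2.1.1, h1⟩, h2⟩
  have hsψ : (ψ ∘ s ∘ ψ.symm) (ψ q) = ψ q := by simp [ψ.left_inv hqs, hsq]
  -- the chart expression of `s` is the identity on a set accumulating at `ψ q`
  have hcl : ψ q ∈ closure ((interior (ψ.symm ⁻¹' Z)) ∩ R) := by
    rw [mem_closure_iff_nhds]
    intro V hV
    have h1 : q ∈ closure Z := D.dense ⟨hq, hqO⟩
    have hV' : ψ ⁻¹' V ∈ 𝓝 q := (continuousAt_extChartAt q) hV
    obtain ⟨z, ⟨⟨hzV, hzs⟩, hzss⟩, hzZ⟩ := mem_closure_iff_nhds.1 h1 _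
      (Filter.inter_mem (Filter.inter_mem hV' ((isOpen_extChartAt_source q).mem_nhds hqs))
      (hopen.mem_nhds (by simpa [hsq] using hqs)))
    refine ⟨ψ z, hzV, ?_, ψ.map_source hzs, ?_⟩
    · rw [mem_interior_iff_mem_nhds]
      have : ContinuousAt ψ.symm (ψ z) := continuousAt_extChartAt_symm' hzs
      refine this ?_
      rw [ψ.left_inv hzs]; exact D.openZ.mem_nhds hzZ
    · simpa [ψ.left_inv hzs] using hzss
  have hjet := ftaylorSeriesWithin_eq_id hBR hBu hRu hŝ isOpen_interior
    (fun b hb => by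
      have : b ∈ ψ.symm ⁻¹' Z := interior_subset hb.1
      have : ψ.symm b ∈ Z := this
      simp [D.idZ _ this, ψ.right_inv hb.2.1]) hψqB hcl
  have key := iteratedFDerivWithin_comp_comp_eq (J := φ ∘ J ∘ ψ.symm)
    (s := ψ ∘ s ∘ ψ.symm) (k := k) hBu hS' ha (by rw [hka]; exact hψqB)
    (by rw [hka]; exact hĴ _ hψqB) (by rw [hka]; exact (hŝ.mono hBR) _ hψqB) hkc hkB
    (by rw [hka]; exact hsB) (by rw [hka]; exact hsψ) (by rw [hka]; exact hjet) n
  have c1 : (φ ∘ J ∘ ψ.symm) ∘ (ψ ∘ s ∘ ψ.symm) ∘ k =ᶠ[𝓝[A] a]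
      φ ∘ (J ∘ s ∘ K) ∘ (φ).symm := by
    filter_upwards [ev1, ev2] with b h1 h2
    simp [hk, ψ.left_inv h1, ψ.left_inv h2]
  have c2 : (φ ∘ J ∘ ψ.symm) ∘ k =ᶠ[𝓝[A] a] id := by
    filter_upwards [ev1, eventually_mem_nhdsWithin] with b h1 h2
    simp [hk, ψ.left_inv h1, (hKA b h2).2, (φ).right_inv h2.1]
  rw [Filter.EventuallyEq.iteratedFDerivWithin_eq c1 (Filter.EventuallyEq.eq_of_nhdsWithin c1 ha) n,
    Filter.EventuallyEq.iteratedFDerivWithin_eq c2 (Filter.EventuallyEq.eq_of_nhdsWithin c2 ha)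
      n] at key
  have hn : (n : WithTop ℕ∞) ≤ ∞ := by exact_mod_cast le_top
  have := iteratedFDerivWithin_sub_apply (i := n) ((hΨ a ha).of_le hn)
    (contDiffWithinAt_id (𝕜 := ℝ) (n := n) (s := A) (x := a)) hS' ha
  rw [key, sub_self] at this
  exact this

lemma GraftData.smoothImmOn_leftInv [FiniteDimensional ℝ E] (D : GraftData I S O Z J K s) :
    SmoothImmOn I (J '' S) K where
  smooth := D.smoothK
  inj := by
    rintro _ ⟨q, hq, rfl⟩
    have hKd : MDifferentiableWithinAt I I K (J '' S) (J q) :=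
      (D.smoothK _ ⟨q, hq, rfl⟩).mdifferentiableWithinAt (by simp)
    have h1 := mfderivWithin_comp q hKd (D.imm.mdiff hq) (subset_preimage_image J S)
      (D.uniqueS q hq)
    have h2 : mfderivWithin I I (K ∘ J) S q = mfderivWithin I I id S q :=
      mfderivWithin_congr (fun r hr => D.leftInv r hr) (D.leftInv q hq)
    rw [h1, mfderivWithin_id (D.uniqueS q hq)] at h2
    obtain ⟨e, he⟩ := D.imm.isInvertible hq
    rw [← he] at h2
    intro v w hvw
    obtain ⟨v, rfl⟩ := e.surjective v
    obtain ⟨w, rfl⟩ := e.surjective w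
    have h3 : ∀ x, mfderivWithin I I K (J '' S) (J q) (e x) = x := fun x => DFunLike.congr_fun h2 x
    rw [h3, h3] at hvw
    rw [hvw]

lemma hasFDerivWithinAt_add_of_zero {f g : E → E} {A : E →L[ℝ] E} {C : Set E} {x : E}
    (hf : HasFDerivWithinAt f A C x) (hg : HasFDerivWithinAt g (0 : E →L[ℝ] E) C x) :
    HasFDerivWithinAt (f + g) A C x := by
  simpa using hf.add hg

/-- Near a point that `f` sends to `J (S \ O)`, gluing `J s J⁻¹ f` and `f` gives a smooth map with
the derivative of `f` at that point. -/
lemma GraftData.glue_at_end [FiniteDimensional ℝ E] [T2Space N] (D : GraftData I S O Z J K s)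
    (hT : ConvexInCharts I T) (hf : ContMDiffOn I I ∞ f T)
    (hclosed : IsClosed (J '' S)) (hOS : O ⊆ S) (hUo : ∀ p ∈ U, U ∈ 𝓝[T] p)
    (hUJ : ∀ p ∈ T, p ∈ U ↔ f p ∈ J '' O)
    (hh : ∀ p ∈ U, h p = (J ∘ s ∘ K) (f p)) (hh' : ∀ p ∈ T, p ∉ U → h p = f p)
    {p : N} (hp : p ∈ T) (hpU : p ∉ U) (hpJ : f p ∈ J '' S) :
    ContMDiffWithinAt I I ∞ h T p ∧
      HasMFDerivWithinAt I I h T p (mfderivWithin I I f T p) := by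
  obtain ⟨q, hq, hqp⟩ := hpJ
  have hqO : q ∉ O := fun h => hpU ((hUJ p hp).2 ⟨q, h, hqp⟩)
  have hpJ : f p ∈ J '' S := ⟨q, hq, hqp⟩
  have hΨp : (J ∘ s ∘ K) (f p) = f p := by
    rw [← hqp]; simp only [Function.comp_apply]
    rw [D.leftInv q hq, D.s_eq hq hqO]
  have hhp : h p = f p := hh' p hp hpU
  set φ := extChartAt I (f p) with hφ
  set χ := extChartAt I p with hχ
  have hfφ : f p ∈ φ.source := mem_extChartAt_source _
  -- near `p`, all points stay in the chart at `f p`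
  have hev : ∀ᶠ r in 𝓝[T] p, f r ∈ φ.source ∧ (f r ∈ J '' S → (J ∘ s ∘ K) (f r) ∈ φ.source) := by
    have hfc : Filter.Tendsto f (𝓝[T] p) (𝓝 (f p)) := hf.continuousOn p hp
    have h2 : ∀ᶠ y in 𝓝 (f p), y ∈ J '' S → (J ∘ s ∘ K) y ∈ φ.source := by
      have := D.smoothGraft.continuousOn (f p) hpJ
      rw [ContinuousWithinAt, hΨp] at this
      exact eventually_nhdsWithin_iff.1 (this ((isOpen_extChartAt_source (f p)).mem_nhds hfφ))
    exact Filter.Eventually.and (hfc ((isOpen_extChartAt_source (f p)).mem_nhds hfφ)) (hfc h2)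
  have hev' : ∀ᶠ a in 𝓝[χ.symm ⁻¹' T ∩ range I] (χ p), f (χ.symm a) ∈ φ.source ∧
      (f (χ.symm a) ∈ J '' S → (J ∘ s ∘ K) (f (χ.symm a)) ∈ φ.source) := by
    rw [← map_extChartAt_symm_nhdsWithin (I := I) p] at hev
    exact hev
  rw [eventually_nhdsWithin_iff] at hev'
  obtain ⟨C, hCV, hCc, hCu, hpC, hCT, hCn⟩ := hT p hp _ hev'
  have hCr : C ⊆ χ.symm ⁻¹' T ∩ range I := fun a ha =>
    ⟨(hCT ha).2, extChartAt_target_subset_range p (hCT ha).1⟩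
  have hC1 : ∀ a ∈ C, f (χ.symm a) ∈ φ.source ∧
      (f (χ.symm a) ∈ J '' S → (J ∘ s ∘ K) (f (χ.symm a)) ∈ φ.source) := fun a ha =>
    hCV ha (hCr ha)
  set f' := φ ∘ f ∘ χ.symm with hf'
  have hf'C : ContDiffOn ℝ ∞ f' C := (contDiffOn_chart hf p (f p)).mono fun a ha =>
    ⟨(hCT ha).1, (hCT ha).2, (hC1 a ha).1⟩
  set S' := φ.target ∩ φ.symm ⁻¹' (J '' S ∩ (J ∘ s ∘ K) ⁻¹' φ.source) with hS'
  have hS'u : UniqueDiffOn ℝ S' :=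
    (D.imm.uniqueMDiffOn_image D.uniqueS).uniqueDiffOn_inter_preimage (f p) (f p)
      D.smoothGraft.continuousOn
  set U' := C ∩ χ.symm ⁻¹' U with hU'
  have hflat := D.isFlatOff (f p)
  set w : E → E := fun a => (φ ∘ (J ∘ s ∘ K) ∘ φ.symm) a - a with hw
  have hmemS' : ∀ a ∈ C, f (χ.symm a) ∈ J '' S → f' a ∈ S' := fun a ha haS =>
    ⟨φ.map_source (hC1 a ha).1, by
      simp only [hf', Function.comp_apply, mem_preimage, φ.left_inv (hC1 a ha).1]
      exact ⟨haS, (hC1 a ha).2 haS⟩⟩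
  have hU'o : ∀ a ∈ U', U' ∈ 𝓝[C] a := by
    intro a ha
    have h1 : ContinuousWithinAt χ.symm C a :=
      ((continuousOn_extChartAt_symm p).mono fun b hb => (hCT hb).1) a ha.1
    have h2 : Filter.Tendsto χ.symm (𝓝[C] a) (𝓝[T] (χ.symm a)) :=
      tendsto_nhdsWithin_iff.2 ⟨h1, eventually_mem_nhdsWithin.mono fun b hb => (hCT hb).2⟩
    exact Filter.inter_mem self_mem_nhdsWithin (h2 (hUo _ ha.2))
  have hU'S : MapsTo f' U' S' := fun a ha =>
    hmemS' a ha.1 (image_mono hOS ((hUJ _ (hCT ha.1).2).1 ha.2))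
  have hlim : ∀ a ∈ C, a ∉ U' → a ∈ closure U' → f' a ∈ S' ∧ f' a ∉ φ.symm ⁻¹' (J '' O) := by
    intro a ha haU hac
    have haU2 : χ.symm a ∉ U := fun h => haU ⟨ha, h⟩
    have h1 : f (χ.symm a) ∈ J '' S := by
      have hc : ContinuousWithinAt (f ∘ χ.symm) C a :=
        (hf.continuousOn.comp ((continuousOn_extChartAt_symm p).mono fun b hb => (hCT hb).1)
          fun b hb => (hCT hb).2) a ha
      have h2 := (hc.mono (inter_subset_left : U' ⊆ C)).mem_closure_image hac
      refine hclosed.closure_subset_iff.2 ?_ h2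
      rintro _ ⟨b, hb, rfl⟩
      exact image_mono hOS ((hUJ _ (hCT hb.1).2).1 hb.2)
    refine ⟨hmemS' a ha h1, fun h2 => haU2 ?_⟩
    simp only [hf', Function.comp_apply, mem_preimage, φ.left_inv (hC1 a ha).1] at h2
    exact (hUJ _ (hCT ha).2).2 h2
  have hsm := hflat.contDiffOn_indicator hCc hS'u hf'C hCu inter_subset_left hU'o hU'S hlim
  have hdv := (hflat.hasFDerivWithinAt_indicator hCc hS'u hf'C hCu inter_subset_left hU'o hU'S
    hlim).2 (χ p) hpC
  have hχp : χ.symm (χ p) = p := extChartAt_to_inv p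
  have hχU' : χ p ∉ U' := fun h => hpU (by simpa [hχp] using h.2)
  rw [indicator_of_notMem hχU'] at hdv
  -- the chart expression of `h` is that of `f` plus a flat term
  have heq : ∀ a ∈ C, (φ ∘ h ∘ χ.symm) a = f' a + U'.indicator (w ∘ f') a := by
    intro a ha
    by_cases haU : χ.symm a ∈ U
    · rw [indicator_of_mem (show a ∈ U' from ⟨ha, haU⟩)]
      simp only [Function.comp_apply, hw, hf', hh _ haU, φ.left_inv (hC1 a ha).1]
      abel
    · rw [indicator_of_notMem (fun h => haU h.2), add_zero]
      change φ (h (χ.symm a)) = φ (f (χ.symm a))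
      rw [hh' _ (hCT ha).2 haU]
  have hcont : ContinuousWithinAt h T p := by
    have h1 : ∀ᶠ r in 𝓝[T] p, h r ∈ φ.source := by
      filter_upwards [hev, eventually_mem_nhdsWithin] with r hr hrT
      by_cases hrU : r ∈ U
      · rw [hh r hrU]; exact hr.2 (image_mono hOS ((hUJ r hrT).1 hrU))
      · rw [hh' r hrT hrU]; exact hr.1
    have h2 : ContinuousWithinAt (φ ∘ h ∘ χ.symm) (χ.symm ⁻¹' T ∩ range I) (χ p) := by
      refine ContinuousWithinAt.mono_of_mem_nhdsWithin ?_ hCn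
      exact ((hf'C.continuousOn.add hsm.continuousOn).congr heq) _ hpC
    have h3 : ContinuousWithinAt (φ ∘ h) T p := by
      have h4 : Filter.Tendsto (φ ∘ h) (Filter.map χ.symm (𝓝[χ.symm ⁻¹' T ∩ range I] (χ p)))
          (𝓝 ((φ ∘ h) (χ.symm (χ p)))) := h2
      rw [map_extChartAt_symm_nhdsWithin, hχp] at h4
      exact h4
    have h5 : Filter.Tendsto (fun r => φ.symm (φ (h r))) (𝓝[T] p) (𝓝 (φ.symm (φ (h p)))) := by
      refine Filter.Tendsto.comp ?_ h3
      rw [Function.comp_apply, hhp]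
      exact continuousAt_extChartAt_symm (f p)
    rw [ContinuousWithinAt]
    rw [hhp, φ.left_inv hfφ] at h5
    rw [hhp]
    exact h5.congr' (h1.mono fun r hr => φ.left_inv hr)
  constructor
  · rw [contMDiffWithinAt_iff, hhp]
    refine ⟨hcont, ?_⟩
    refine ContDiffWithinAt.mono_of_mem_nhdsWithin ?_ hCn
    exact ((hf'C.add hsm).congr heq) _ hpC
  · refine ⟨hcont, ?_⟩
    have hfd := ((hf p hp).mdifferentiableWithinAt (by simp)).hasMFDerivWithinAt.2
    have h1 := hasFDerivWithinAt_add_of_zero (hfd.mono hCr) hdv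
    refine HasFDerivWithinAt.mono_of_mem_nhdsWithin ?_ hCn
    refine h1.congr (fun a ha => ?_) ?_
    · rw [writtenInExtChartAt, hhp]; exact heq a ha
    · rw [writtenInExtChartAt, hhp]; exact heq _ hpC

/-- Gluing `J s J⁻¹ f` and `f` along the ends of `J` gives a smooth immersion. -/
lemma GraftData.glue [FiniteDimensional ℝ E] [T2Space N] (D : GraftData I S O Z J K s)
    (hs : ∀ p, Function.Injective (mfderiv I I s p))
    (hT : ConvexInCharts I T) (hTu : UniqueMDiffOn I T) (hf : SmoothImmOn I T f)
    (hclosed : IsClosed (J '' S)) (hOS : O ⊆ S) (hUT : U ⊆ T) (hUo : ∀ p ∈ U, U ∈ 𝓝[T] p)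
    (hUJ : ∀ p ∈ T, p ∈ U ↔ f p ∈ J '' O)
    (hh : ∀ p ∈ U, h p = (J ∘ s ∘ K) (f p)) (hh' : ∀ p ∈ T, p ∉ U → h p = f p) :
    SmoothImmOn I T h := by
  have hUu : UniqueMDiffOn I U := fun p hp => by
    have := (hTu p (hUT hp)).inter' (hUo p hp)
    rwa [inter_eq_right.2 hUT] at this
  have hsi : SmoothImmOn I S s := by
    refine ⟨D.smooth_s.contMDiffOn, fun p hp => ?_⟩
    rw [mfderivWithin_eq_mfderiv (D.uniqueS p hp) (D.smooth_s.mdifferentiable (by simp) p)]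
    exact hs p
  have hfU : SmoothImmOn I U f := by
    refine ⟨hf.smooth.mono hUT, fun p hp => ?_⟩
    rw [mfderivWithin_subset hUT (hUu p hp) (hf.mdiff (hUT hp))]
    exact hf.inj p (hUT hp)
  have hK : MapsTo K (J '' S) S := by rintro _ ⟨q, hq, rfl⟩; rwa [D.leftInv q hq]
  have hfUS : MapsTo f U (J '' S) := fun p hp => image_mono hOS ((hUJ p (hUT hp)).1 hp)
  have hin : SmoothImmOn I U (J ∘ s ∘ K ∘ f) :=
    D.imm.comp (hsi.comp (D.smoothImmOn_leftInv.comp hfU hUu hfUS) hUu (fun p hp => hK (hfUS hp)))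
      hUu (fun p hp => D.mapsTo_s (hK (hfUS hp)))
  have hall : ∀ p ∈ T, ContMDiffWithinAt I I ∞ h T p ∧
      Function.Injective (mfderivWithin I I h T p) := by
    intro p hp
    by_cases hpU : p ∈ U
    · have h1 : SmoothImmOn I U h :=
        ⟨hin.smooth.congr hh, fun r hr => by
          rw [mfderivWithin_congr (f := J ∘ s ∘ K ∘ f) hh (hh r hr)]; exact hin.inj r hr⟩
      have h2 : ContMDiffWithinAt I I ∞ h T p :=
        (h1.smooth p hpU).mono_of_mem_nhdsWithin (hUo p hpU)
      refine ⟨h2, ?_⟩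
      rw [← mfderivWithin_subset hUT (hUu p hpU) (h2.mdifferentiableWithinAt (by simp))]
      exact h1.inj p hpU
    · by_cases hpJ : f p ∈ J '' S
      · obtain ⟨h1, h2⟩ := D.glue_at_end hT hf.smooth hclosed hOS hUo hUJ hh hh' hp hpU hpJ
        refine ⟨h1, ?_⟩
        rw [h2.mfderivWithin (hTu p hp)]
        exact hf.inj p hp
      · have h1 : h =ᶠ[𝓝[T] p] f := by
          have h2 : ∀ᶠ r in 𝓝[T] p, f r ∈ (J '' S)ᶜ :=
            hf.smooth.continuousOn p hp (hclosed.isOpen_compl.mem_nhds hpJ)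
          filter_upwards [h2, eventually_mem_nhdsWithin] with r hr hrT
          exact hh' r hrT fun h => hr (hfUS h)
        refine ⟨(hf.smooth p hp).congr_of_eventuallyEq h1 (hh' p hp hpU), ?_⟩
        rw [h1.mfderivWithin_eq (hh' p hp hpU)]
        exact hf.inj p hp
  exact ⟨fun p hp => (hall p hp).1, fun p hp => (hall p hp).2⟩

end Immersions

/-! ### The cube times `M` -/

section Solid

variable (j : ℕ) (M : Type u)

lemma openSolid_subset_solid : openSolid j M ⊆ solid j M :=
  fun _ hp i => Ioo_subset_Icc_self (hp i)

variable {j M}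

variable [TopologicalSpace M]

variable (j M)

lemma isCompact_solid [CompactSpace M] : IsCompact (solid j M) := by
  have h1 : IsCompact {x : EuclideanSpace ℝ (Fin j) | ∀ i, x i ∈ Icc (-1 : ℝ) 1} := by
    have h2 := (EuclideanSpace.equiv (Fin j) ℝ).toHomeomorph.isCompact_preimage.2
      (isCompact_univ_pi fun _ : Fin j => isCompact_Icc (a := (-1 : ℝ)) (b := 1))
    convert h2 using 1
    ext x; simp only [mem_ofPred_eq, mem_preimage, mem_univ_pi]; rfl
  have h2 := h1.prod (isCompact_univ (X := M))
  convert h2 using 1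
  ext p; simp [solid]

lemma isClosed_solid : IsClosed (solid j M) := by
  simp only [solid, ofPred_forall]
  exact isClosed_iInter fun i => isClosed_Icc.preimage (by fun_prop)

lemma solid_diff_openSolid_subset : solid j M \ openSolid j M ⊆ closure (solid j M)ᶜ := by
  rintro p ⟨hp, hpo⟩
  have h1 : Filter.Tendsto (fun c : ℝ => ((c • p.1, p.2) : Amb j M)) (𝓝[>] 1) (𝓝 p) := by
    have : ContinuousAt (fun c : ℝ => ((c • p.1, p.2) : Amb j M)) 1 := by fun_prop
    have h := this.tendsto.mono_left (nhdsWithin_le_nhds (s := Ioi 1))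
    simpa using h
  refine mem_closure_of_tendsto h1 ?_
  filter_upwards [self_mem_nhdsWithin] with c hc h
  have hc : 1 < c := hc
  apply hpo
  intro i
  have := h i
  simp only [PiLp.smul_apply, smul_eq_mul, mem_Icc] at this
  constructor
  · by_contra h9
    nlinarith [(hp i).1]
  · by_contra h9
    nlinarith [(hp i).2]

variable {j M}

/-- Points of the closed cube are limits of points of the open cube with the same coordinate in
`M`. -/
lemma mem_closure_openSolid {p : Amb j M} (hp : p ∈ solid j M) {A : Set M} (hA : p.2 ∈ A) :
    p ∈ closure {q ∈ openSolid j M | q.2 ∈ A} := by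
  have h1 : Filter.Tendsto (fun c : ℝ => ((c • p.1, p.2) : Amb j M)) (𝓝[<] 1) (𝓝 p) := by
    have : ContinuousAt (fun c : ℝ => ((c • p.1, p.2) : Amb j M)) 1 := by fun_prop
    simpa using this.tendsto.mono_left (nhdsWithin_le_nhds (s := Iio 1))
  refine mem_closure_of_tendsto h1 ?_
  filter_upwards [Ioo_mem_nhdsLT (zero_lt_one (α := ℝ))] with c hc
  refine ⟨fun i => ?_, hA⟩
  have h2 := hp i
  simp only [PiLp.smul_apply, smul_eq_mul]
  constructor <;> nlinarith [h2.1, h2.2, hc.1, hc.2]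

end Solid

section SolidSmooth

variable {j m : ℕ} [NeZero m] {M : Type u} [TopologicalSpace M]
  [ChartedSpace (EuclideanHalfSpace m) M]

lemma convexInCharts_preimage_fst {A : Set (EuclideanSpace ℝ (Fin j))} (hA : Convex ℝ A)
    (hA' : (interior A).Nonempty) :
    ConvexInCharts (ambModel j m) (Prod.fst ⁻¹' A : Set (Amb j M)) := by
  intro p hp V hV
  set φ := extChartAt (ambModel j m) p with hφ
  have hsymm : ∀ a, (φ.symm a).1 = a.1 := by
    intro a; rw [hφ, extChartAt_prod]; rfl
  have hrange : range (ambModel j m) = univ ×ˢ range (𝓡∂ m) := by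
    rw [modelWithCorners_prod_coe, range_prodMap]; simp
  have hVt : V ∩ φ.target ∈ 𝓝[range (ambModel j m)] (φ p) :=
    Filter.inter_mem (mem_nhdsWithin_of_mem_nhds hV) (extChartAt_target_mem_nhdsWithin p)
  obtain ⟨r, hr, hball⟩ := Metric.mem_nhdsWithin_iff.1 hVt
  have hφp : φ p ∈ range (ambModel j m) :=
    extChartAt_target_subset_range p (mem_extChartAt_target p)
  have hφ1 : (φ p).1 = p.1 := by
    have h1 := hsymm (φ p)
    rw [φ.left_inv (mem_extChartAt_source p)] at h1
    exact h1.symm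
  refine ⟨(A ×ˢ range (𝓡∂ m)) ∩ Metric.ball (φ p) r, ?_, ?_, ?_, ?_, ?_, ?_⟩
  · rintro a ⟨⟨-, ha⟩, hab⟩
    exact (hball ⟨hab, by rw [hrange]; exact ⟨mem_univ _, ha⟩⟩).1
  · exact (hA.prod (𝓡∂ m).convex_range).inter (convex_ball _ _)
  · exact ((uniqueDiffOn_convex hA hA').prod (𝓡∂ m).uniqueDiffOn).inter Metric.isOpen_ball
  · rw [hrange] at hφp
    exact ⟨⟨by rw [hφ1]; exact hp, hφp.2⟩, Metric.mem_ball_self hr⟩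
  · rintro a ⟨⟨haA, ha⟩, hab⟩
    refine ⟨(hball ⟨hab, by rw [hrange]; exact ⟨mem_univ _, ha⟩⟩).2, ?_⟩
    rw [mem_preimage, mem_preimage, hsymm]; exact haA
  · filter_upwards [mem_nhdsWithin_of_mem_nhds (Metric.ball_mem_nhds (φ p) hr),
      self_mem_nhdsWithin] with a h1 h2
    rw [hrange, mem_inter_iff, mem_preimage, mem_preimage, hsymm] at h2
    exact ⟨⟨h2.1, h2.2.2⟩, h1⟩

lemma convexInCharts_univ : ConvexInCharts (ambModel j m) (univ : Set (Amb j M)) :=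
  convexInCharts_preimage_fst (A := univ) convex_univ (by simp)

lemma convexInCharts_solid : ConvexInCharts (ambModel j m) (solid j M) := by
  refine convexInCharts_preimage_fst (A := {x | ∀ i, x i ∈ Icc (-1 : ℝ) 1}) ?_ ?_
  · intro x hx y hy a b ha hb hab i
    exact (convex_Icc (-1 : ℝ) 1) (hx i) (hy i) ha hb hab
  · refine ⟨0, mem_interior.2 ⟨{x | ∀ i, x i ∈ Ioo (-1 : ℝ) 1},
      fun x hx i => Ioo_subset_Icc_self (hx i), ?_, fun i => by simp⟩⟩
    simp only [ofPred_forall]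
    exact isOpen_iInter_of_finite fun i => isOpen_Ioo.preimage (by fun_prop)

end SolidSmooth

/-! ### Long embeddings and pucks as maps -/

section Pucks

variable {j m : ℕ} [NeZero m] {M : Type u} [TopologicalSpace M]
  [ChartedSpace (EuclideanHalfSpace m) M]

lemma LongEmb.injective (s : LongEmb j m M) : Function.Injective s := s.embedding.injective

lemma LongEmb.mapsTo_solid (s : LongEmb j m M) : MapsTo s (solid j M) (solid j M) := by
  intro p hp
  by_contra h
  have h1 : s p = p := s.injective (s.support _ h)
  exact h (by rwa [h1])

/-- A long embedding is the identity on the boundary of the cube, hence preserves its interior. -/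
lemma LongEmb.eq_of_notMem_openSolid [T2Space M] (s : LongEmb j m M) {p : Amb j M}
    (hp : p ∉ openSolid j M) : s p = p := by
  by_cases h : p ∈ solid j M
  · have h1 := solid_diff_openSolid_subset j M ⟨h, hp⟩
    have h2 : closure (solid j M)ᶜ ⊆ {p | s p = p} :=
      closure_minimal (fun p hp => s.support p hp)
        (isClosed_eq s.smooth.continuous continuous_id)
    exact h2 h1
  · exact s.support p h

lemma LongEmb.mem_openSolid_iff [T2Space M] (s : LongEmb j m M) {p : Amb j M} :
    s p ∈ openSolid j M ↔ p ∈ openSolid j M := by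
  by_cases hp : p ∈ openSolid j M
  · refine iff_of_true ?_ hp
    by_contra h
    have h1 : s p = p := s.injective (s.eq_of_notMem_openSolid h)
    exact h (by rwa [h1])
  · rw [s.eq_of_notMem_openSolid hp]

lemma Puck.injOn (J : Puck j m M) : InjOn J (solid j M) := by
  have := J.embedding.injective
  exact injOn_iff_injective.2 this

lemma Puck.continuousOn (J : Puck j m M) : ContinuousOn J (solid j M) := J.smooth.continuousOn

lemma Puck.smoothImmOn (J : Puck j m M) : SmoothImmOn (ambModel j m) (solid j M) J :=
  ⟨J.smooth, J.immersion⟩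

lemma Puck.isCompact_image [CompactSpace M] (J : Puck j m M) : IsCompact (J '' solid j M) :=
  (isCompact_solid j M).image_of_continuousOn J.continuousOn

lemma Puck.isClosed_image [CompactSpace M] [T2Space M] (J : Puck j m M) :
    IsClosed (J '' solid j M) := J.isCompact_image.isClosed

lemma Puck.image_subset (J : Puck j m M) : J '' solid j M ⊆ solid j M := J.mapsTo.image_subset

/-- The inverse of a puck, with junk values off its image. -/
def Puck.inv (J : Puck j m M) : Amb j M → Amb j M :=
  open Classical in fun p => if h : ∃ q ∈ solid j M, J q = p then h.choose else p

lemma Puck.inv_apply (J : Puck j m M) {q : Amb j M} (hq : q ∈ solid j M) : J.inv (J q) = q := by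
  have h : ∃ q' ∈ solid j M, J q' = J q := ⟨q, hq, rfl⟩
  rw [Puck.inv, dif_pos h]
  exact J.injOn h.choose_spec.1 hq h.choose_spec.2

lemma Puck.continuousOn_inv (J : Puck j m M) : ContinuousOn J.inv (J '' solid j M) := by
  have hJ := J.embedding
  rw [continuousOn_iff_continuous_domRestrict]
  have h1 : range ((solid j M).domRestrict J) = J '' solid j M := range_domRestrict _ _
  have h2 := hJ.toHomeomorph.symm.continuous
  have h3 : (J '' solid j M).domRestrict J.inv =
      (fun x => ((hJ.toHomeomorph.symm x : solid j M) : Amb j M)) ∘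
        (Homeomorph.setCongr h1.symm) := by
    funext ⟨p, q, hq, hqp⟩
    subst hqp
    simp only [domRestrict_apply, J.inv_apply hq, Function.comp_apply]
    have : hJ.toHomeomorph.symm (Homeomorph.setCongr h1.symm ⟨J q, q, hq, rfl⟩) = ⟨q, hq⟩ := by
      rw [Homeomorph.symm_apply_eq]; rfl
    rw [this]
  rw [h3]
  fun_prop

variable [IsManifold (𝓡∂ m) ∞ M]

lemma Puck.contMDiffOn_inv (J : Puck j m M) :
    ContMDiffOn (ambModel j m) (ambModel j m) ∞ J.inv (J '' solid j M) :=
  J.smoothImmOn.contMDiffOn_leftInverse (uniqueMDiffOn_solid j m M) J.continuousOn_inv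
    (fun _ hq => J.inv_apply hq)

lemma graftData (J : Puck j m M) (s : LongEmb j m M) :
    GraftData (ambModel j m) (solid j M) (openSolid j M) (solid j M)ᶜ J J.inv s where
  uniqueS := uniqueMDiffOn_solid j m M
  imm := J.smoothImmOn
  leftInv _ hq := J.inv_apply hq
  smoothK := J.contMDiffOn_inv
  smooth_s := s.smooth
  mapsTo_s := s.mapsTo_solid
  openZ := (isClosed_solid j M).isOpen_compl
  idZ _ hq := s.support _ hq
  dense := solid_diff_openSolid_subset j M

end Pucks

section Graft

variable {j m : ℕ} [NeZero m] {M : Type u} [TopologicalSpace M]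
  [ChartedSpace (EuclideanHalfSpace m) M]

lemma graft_apply (J : Puck j m M) (s : Amb j M → Amb j M) {q : Amb j M} (hq : q ∈ solid j M) :
    graft J s (J q) = J (s q) := by
  have h : ∃ q' ∈ solid j M, J q' = J q := ⟨q, hq, rfl⟩
  rw [graft, dif_pos h, J.injOn h.choose_spec.1 hq h.choose_spec.2]

lemma graft_of_notMem (J : Puck j m M) (s : Amb j M → Amb j M) {p : Amb j M}
    (hp : p ∉ J '' solid j M) : graft J s p = p :=
  dif_neg hp

variable [T2Space M] (J : Puck j m M) (s : LongEmb j m M)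

lemma graft_of_notMem_openSolid {p : Amb j M} (hp : p ∉ J '' openSolid j M) :
    graft J s p = p := by
  by_cases h : p ∈ J '' solid j M
  · obtain ⟨q, hq, rfl⟩ := h
    rw [graft_apply J s hq, s.eq_of_notMem_openSolid fun h => hp ⟨q, h, rfl⟩]
  · exact graft_of_notMem J s h

lemma Puck.mem_image_openSolid_iff {q : Amb j M} (hq : q ∈ solid j M) :
    J q ∈ J '' openSolid j M ↔ q ∈ openSolid j M :=
  ⟨fun ⟨_, hq', h⟩ => J.injOn (openSolid_subset_solid j M hq') hq h ▸ hq', fun h => ⟨q, h, rfl⟩⟩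

lemma graft_mem_image_solid_iff {p : Amb j M} :
    graft J s p ∈ J '' solid j M ↔ p ∈ J '' solid j M := by
  by_cases h : p ∈ J '' solid j M
  · obtain ⟨q, hq, rfl⟩ := h
    rw [graft_apply J s hq]
    exact iff_of_true ⟨_, s.mapsTo_solid hq, rfl⟩ ⟨q, hq, rfl⟩
  · rw [graft_of_notMem J s h]

lemma graft_mem_image_openSolid_iff {p : Amb j M} :
    graft J s p ∈ J '' openSolid j M ↔ p ∈ J '' openSolid j M := by
  by_cases h : p ∈ J '' solid j M
  · obtain ⟨q, hq, rfl⟩ := h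
    rw [graft_apply J s hq, J.mem_image_openSolid_iff (s.mapsTo_solid hq), s.mem_openSolid_iff,
      J.mem_image_openSolid_iff hq]
  · rw [graft_of_notMem J s h]

lemma graft_injective : Function.Injective (graft J s) := by
  intro p p' h
  by_cases hp : p ∈ J '' solid j M
  · have hp' : p' ∈ J '' solid j M := by
      rw [← graft_mem_image_solid_iff J s, ← h, graft_mem_image_solid_iff]; exact hp
    obtain ⟨q, hq, rfl⟩ := hp
    obtain ⟨q', hq', rfl⟩ := hp'
    rw [graft_apply J s hq, graft_apply J s hq'] at h
    rw [s.injective (J.injOn (s.mapsTo_solid hq) (s.mapsTo_solid hq') h)]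
  · have hp' : p' ∉ J '' solid j M := by
      rw [← graft_mem_image_solid_iff J s, ← h, graft_mem_image_solid_iff]; exact hp
    rwa [graft_of_notMem J s hp, graft_of_notMem J s hp'] at h

lemma graft_mapsTo_solid : MapsTo (graft J s) (solid j M) (solid j M) := by
  intro p hp
  by_cases h : p ∈ J '' solid j M
  · exact J.image_subset ((graft_mem_image_solid_iff J s).2 h)
  · rwa [graft_of_notMem J s h]

lemma graft_of_notMem_solid {p : Amb j M} (hp : p ∉ solid j M) : graft J s p = p :=
  graft_of_notMem J s fun h => hp (J.image_subset h)

lemma graft_eq_of_mem {p : Amb j M} (hp : p ∈ J '' solid j M) :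
    graft J s p = (J ∘ s ∘ J.inv) p := by
  obtain ⟨q, hq, rfl⟩ := hp
  rw [graft_apply J s hq]; simp [J.inv_apply hq]

end Graft

/-! ### Layers: embeddings of `ℝ^j × M` or of the cube times `M` -/

section Layers

variable {j m : ℕ} [NeZero m] {M : Type u} [TopologicalSpace M]
  [ChartedSpace (EuclideanHalfSpace m) M]

/-- The properties shared by long embeddings (`T = ℝ^j × M`) and pucks (`T = [-1,1]^j × M`). -/
structure Layer (m : ℕ) [NeZero m] [ChartedSpace (EuclideanHalfSpace m) M]
    (T : Set (Amb j M)) (f : Amb j M → Amb j M) : Prop where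
  region : T = univ ∨ T = solid j M
  imm : SmoothImmOn (ambModel j m) T f
  inj : InjOn f T
  off : ∀ p, p ∉ solid j M → f p = p
  mapsTo : MapsTo f (solid j M) (solid j M)

/-- The continuity constraint for a layer `f` on `T` that lies below the puck `J`. -/
def Below (T : Set (Amb j M)) (f : Amb j M → Amb j M) (J : Puck j m M) : Prop :=
  closure (f '' T \ J '' solid j M) ∩ J '' openSide j m M = ∅

lemma LongEmb.layer (s : LongEmb j m M) : Layer m univ s where
  region := Or.inl rfl
  imm := ⟨s.smooth.contMDiffOn, fun p _ => by rw [mfderivWithin_univ]; exact s.immersion p⟩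
  inj := s.injective.injOn
  off := s.support
  mapsTo := s.mapsTo_solid

lemma Puck.layer (J : Puck j m M) : Layer m (solid j M) J where
  region := Or.inr rfl
  imm := J.smoothImmOn
  inj := J.injOn
  off := J.off_domain
  mapsTo := J.mapsTo

variable {T : Set (Amb j M)} {f : Amb j M → Amb j M}

lemma Layer.isClosed_region (h : Layer m T f) : IsClosed T := by
  rcases h.region with rfl | rfl
  · exact isClosed_univ
  · exact isClosed_solid j M

lemma Layer.continuousOn (h : Layer m T f) : ContinuousOn f T := h.imm.smooth.continuousOn

lemma Layer.convexInCharts (h : Layer m T f) : ConvexInCharts (ambModel j m) T := by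
  rcases h.region with rfl | rfl
  · exact convexInCharts_univ
  · exact convexInCharts_solid

lemma Layer.uniqueMDiffOn [IsManifold (𝓡∂ m) ∞ M] (h : Layer m T f) :
    UniqueMDiffOn (ambModel j m) T := by
  rcases h.region with rfl | rfl
  · exact uniqueMDiffOn_univ
  · exact uniqueMDiffOn_solid j m M

lemma Layer.isClosed_image [T2Space M] [CompactSpace M] (h : Layer m T f) {A : Set (Amb j M)}
    (hA : IsClosed A) (hAT : A ⊆ T) : IsClosed (f '' A) := by
  have h1 : IsClosed (f '' (A ∩ solid j M)) :=
    (((isCompact_solid j M).inter_left hA).image_of_continuousOn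
      (h.continuousOn.mono (inter_subset_left.trans hAT))).isClosed
  rcases h.region with hT | hT
  · subst hT
    have hf : Continuous f := continuousOn_univ.1 h.continuousOn
    have h2 : ∀ p ∈ closure (solid j M)ᶜ, f p = p :=
      closure_minimal (t := {p | f p = p}) h.off (isClosed_eq hf continuous_id)
    have h3 : f '' A = f '' (A ∩ solid j M) ∪ (A ∩ closure (solid j M)ᶜ) := by
      ext y
      constructor
      · rintro ⟨p, hp, rfl⟩
        by_cases hps : p ∈ solid j M
        · exact Or.inl ⟨p, ⟨hp, hps⟩, rfl⟩
        · rw [h.off p hps]; exact Or.inr ⟨hp, subset_closure hps⟩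
      · rintro (⟨p, hp, rfl⟩ | hp)
        · exact ⟨p, hp.1, rfl⟩
        · exact ⟨y, hp.1, h2 y hp.2⟩
    rw [h3]
    exact h1.union (hA.inter isClosed_closure)
  · rwa [inter_eq_left.2 (hAT.trans hT.le)] at h1

lemma Layer.closure_image_subset [T2Space M] [CompactSpace M] (h : Layer m T f)
    {A : Set (Amb j M)} (hAT : A ⊆ T) : closure (f '' A) ⊆ f '' closure A :=
  closure_minimal (image_mono subset_closure)
    (h.isClosed_image isClosed_closure (closure_minimal hAT h.isClosed_region))

/-- The long embedding given by a layer on `ℝ^j × M`. -/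
def Layer.toLongEmb [T2Space M] [CompactSpace M] (h : Layer m (univ : Set (Amb j M)) f) :
    LongEmb j m M where
  toFun := f
  smooth := contMDiffOn_univ.1 h.imm.smooth
  immersion p := by have := h.imm.inj p (mem_univ p); rwa [mfderivWithin_univ] at this
  embedding := (IsClosedEmbedding.of_continuous_injective_isClosedMap
    (continuousOn_univ.1 h.continuousOn) (injOn_univ.1 h.inj)
    (fun _ hA => h.isClosed_image hA (subset_univ _))).isEmbedding
  support := h.off

/-- The puck given by a layer on `[-1,1]^j × M`. -/
def Layer.toPuck [T2Space M] [CompactSpace M] (h : Layer m (solid j M) f) : Puck j m M where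
  toFun := f
  mapsTo := h.mapsTo
  smooth := h.imm.smooth
  immersion := h.imm.inj
  embedding := by
    have : CompactSpace (solid j M) := isCompact_iff_compactSpace.1 (isCompact_solid j M)
    exact (Continuous.isClosedEmbedding (continuousOn_iff_continuous_domRestrict.1 h.continuousOn)
      (injOn_iff_injective.1 h.inj)).isEmbedding
  off_domain := h.off

lemma Below.mono {T' : Set (Amb j M)} {f' : Amb j M → Amb j M} {J : Puck j m M}
    (h : Below T f J) (hs : f' '' T' ⊆ f '' T) : Below T' f' J :=
  subset_empty_iff.1 ((inter_subset_inter_left _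
    (closure_mono (sdiff_subset_sdiff_left hs))).trans h.le)

lemma isInteriorPoint_iff {p : Amb j M} :
    (ambModel j m).IsInteriorPoint p ↔ p.2 ∈ (𝓡∂ m).interior M := by
  have h := ModelWithCorners.interior_prod (I := 𝓡 j) (J := 𝓡∂ m)
    (M := EuclideanSpace ℝ (Fin j)) (N := M)
  change p ∈ (ambModel j m).interior _ ↔ _
  rw [h, ModelWithCorners.interior_eq_univ]; simp

lemma mem_interior_or_boundary (x : M) :
    x ∈ (𝓡∂ m).interior M ∨ x ∈ (𝓡∂ m).boundary M :=
  (𝓡∂ m).isInteriorPoint_or_isBoundaryPoint x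

lemma notMem_boundary_of_mem_interior {x : M} (hx : x ∈ (𝓡∂ m).interior M) :
    x ∉ (𝓡∂ m).boundary M := by
  rw [← ModelWithCorners.compl_interior]; exact fun h => h hx

section Smooth

variable [IsManifold (𝓡∂ m) ∞ M]

/-- Pucks are open maps at interior points. -/
lemma Puck.map_nhds (J : Puck j m M) {q : Amb j M} (hq : q ∈ openSolid j M)
    (hi : q.2 ∈ (𝓡∂ m).interior M) :
    (J q).2 ∈ (𝓡∂ m).interior M ∧ Filter.map J (𝓝 q) = 𝓝 (J q) := by
  have hn : solid j M ∈ 𝓝 q :=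
    Filter.mem_of_superset ((isOpen_openSolid j M).mem_nhds hq) (openSolid_subset_solid j M)
  have h1 := J.immersion q (openSolid_subset_solid j M hq)
  rw [mfderivWithin_of_mem_nhds hn] at h1
  have h2 := map_nhds_eq_of_isInteriorPoint ((J.smooth).contMDiffAt hn) h1
    (isInteriorPoint_iff.2 hi)
  exact ⟨isInteriorPoint_iff.1 h2.1, h2.2⟩

lemma LongEmb.map_nhds (s : LongEmb j m M) {q : Amb j M} (hi : q.2 ∈ (𝓡∂ m).interior M) :
    (s q).2 ∈ (𝓡∂ m).interior M ∧ Filter.map s (𝓝 q) = 𝓝 (s q) := by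
  have h2 := map_nhds_eq_of_isInteriorPoint s.smooth.contMDiffAt (s.immersion q)
    (isInteriorPoint_iff.2 hi)
  exact ⟨isInteriorPoint_iff.1 h2.1, h2.2⟩

/-- What the continuity constraint is for: near a point of `J((I^j)° × M)` the layer below `J` is
contained in the image of `J`. At interior points this is invariance of domain. -/
lemma Below.exists_nhds {J : Puck j m M} (h : Below T f J) {q : Amb j M}
    (hq : q ∈ openSolid j M) : ∃ V ∈ 𝓝 (J q), V ∩ f '' T ⊆ J '' solid j M := by
  rcases mem_interior_or_boundary (m := m) q.2 with hi | hb
  · refine ⟨J '' openSolid j M, ?_, inter_subset_left.trans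
      (image_mono (openSolid_subset_solid j M))⟩
    rw [← (J.map_nhds hq hi).2]
    exact Filter.image_mem_map ((isOpen_openSolid j M).mem_nhds hq)
  · refine ⟨(closure (f '' T \ J '' solid j M))ᶜ, isClosed_closure.isOpen_compl.mem_nhds ?_, ?_⟩
    · intro hc
      have : J q ∈ closure (f '' T \ J '' solid j M) ∩ J '' openSide j m M :=
        ⟨hc, q, ⟨hq, hb⟩, rfl⟩
      rw [h] at this; exact this
    · rintro y ⟨hy, hyT⟩
      by_contra hn
      exact hy (subset_closure ⟨hyT, hn⟩)

/-- Near a point that `f` sends into `J((I^j)° × M)`, a layer `f` below `J` takes values there. -/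
lemma Below.preimage_mem_nhdsWithin {J : Puck j m M} (h : Below T f J) {p : Amb j M}
    (hf : ContinuousWithinAt f T p) (hp : f p ∈ J '' openSolid j M) :
    f ⁻¹' (J '' openSolid j M) ∈ 𝓝[T] p := by
  obtain ⟨q, hq, hqp⟩ := hp
  obtain ⟨V, hV, hVT⟩ := h.exists_nhds hq
  have hq' := openSolid_subset_solid j M hq
  have h1 := J.continuousOn_inv (J q) ⟨q, hq', rfl⟩
  have h2 : J.inv ⁻¹' openSolid j M ∈ 𝓝[J '' solid j M] (J q) :=
    h1 (by rw [J.inv_apply hq']; exact (isOpen_openSolid j M).mem_nhds hq)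
  obtain ⟨W, hW, hWJ⟩ := mem_nhdsWithin_iff_exists_mem_nhds_inter.1 h2
  rw [hqp] at hV hW
  filter_upwards [hf hV, hf hW, self_mem_nhdsWithin] with r hr1 hr2 hrT
  obtain ⟨q', hq's, hq'r⟩ := hVT ⟨hr1, r, hrT, rfl⟩
  have h3 : J.inv (f r) ∈ openSolid j M := hWJ ⟨hr2, q', hq's, hq'r⟩
  rw [← hq'r, J.inv_apply hq's] at h3
  exact ⟨q', h3, hq'r⟩

/-- Splicing a long embedding into a layer along a puck above it. -/
lemma Layer.graft [T2Space M] [CompactSpace M] (h : Layer m T f) {J : Puck j m M}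
    (hJ : Below T f J) (s : LongEmb j m M) : Layer m T (graft J s ∘ f) where
  region := h.region
  imm := by
    refine (graftData J s).glue (U := T ∩ f ⁻¹' (J '' openSolid j M)) s.immersion
      h.convexInCharts h.uniqueMDiffOn h.imm J.isClosed_image (openSolid_subset_solid j M)
      inter_subset_left ?_ ?_ ?_ ?_
    · exact fun p hp => Filter.inter_mem self_mem_nhdsWithin
        (hJ.preimage_mem_nhdsWithin (h.continuousOn p hp.1) hp.2)
    · exact fun p hp => ⟨fun h => h.2, fun h => ⟨hp, h⟩⟩
    · exact fun p hp => graft_eq_of_mem J s (image_mono (openSolid_subset_solid j M) hp.2)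
    · exact fun p hp hpU => graft_of_notMem_openSolid J s fun h => hpU ⟨hp, h⟩
  inj := (graft_injective J s).comp_injOn h.inj
  off p hp := by rw [Function.comp_apply, h.off p hp, graft_of_notMem_solid J s hp]
  mapsTo := (graft_mapsTo_solid J s).comp h.mapsTo

end Smooth

lemma graft_image_subset [T2Space M] (J : Puck j m M) (s : LongEmb j m M) (A : Set (Amb j M)) :
    graft J s '' A ⊆ A ∪ J '' solid j M := by
  rintro _ ⟨p, hp, rfl⟩
  by_cases h : p ∈ J '' solid j M
  · exact Or.inr ((graft_mem_image_solid_iff J s).2 h)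
  · rw [graft_of_notMem J s h]; exact Or.inl hp

/-- Splicing along `J` does not violate the continuity constraint with respect to a puck `J'`
above `J`. -/
lemma Below.graft [T2Space M] {J J' : Puck j m M} (h : Below T f J')
    (hJ : Below (solid j M) J J') (s : LongEmb j m M) : Below T (graft J s ∘ f) J' := by
  rw [Below, ← subset_empty_iff]
  have h1 : (Splicing.graft J s ∘ f) '' T \ J' '' solid j M ⊆
      (f '' T \ J' '' solid j M) ∪ (J '' solid j M \ J' '' solid j M) := by
    rw [← union_sdiff_distrib, image_comp]
    exact sdiff_subset_sdiff_left (graft_image_subset J s _)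
  refine (inter_subset_inter_left _ (closure_mono h1)).trans ?_
  rw [closure_union, union_inter_distrib_right, show _ = _ from h, show _ = _ from hJ]
  simp

lemma Below.graft_self [T2Space M] {J : Puck j m M} (h : Below T f J) (s : LongEmb j m M) :
    Below T (Splicing.graft J s ∘ f) J := by
  rw [Below, ← subset_empty_iff]
  refine (inter_subset_inter_left _ (closure_mono ?_)).trans h.le
  rw [image_comp]
  intro y hy
  exact ⟨(graft_image_subset J s _ hy.1).resolve_right hy.2, hy.2⟩

/-- The constraint between a long embedding and a puck keeps the sides of the puck away from the
ends of the cube, where the long embedding is the identity. -/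
lemma Below.image_openSide_subset {s : LongEmb j m M} {P : Puck j m M} (h : Below univ s P) :
    P '' openSide j m M ⊆ openSolid j M := by
  rintro _ ⟨q, hq, rfl⟩
  by_contra hn
  have h1 := solid_diff_openSolid_subset j M ⟨P.mapsTo (openSolid_subset_solid j M hq.1), hn⟩
  have h2 : P q ∈ closure (s '' univ \ P '' solid j M) ∩ P '' openSide j m M := by
    refine ⟨closure_mono ?_ h1, q, hq, rfl⟩
    exact fun p hp => ⟨⟨p, mem_univ _, s.support p hp⟩, fun h => hp (P.image_subset h)⟩
  rw [h] at h2; exact h2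

lemma Below.image_openSolid_subset [IsManifold (𝓡∂ m) ∞ M] {s : LongEmb j m M} {P : Puck j m M}
    (h : Below univ s P) : P '' openSolid j M ⊆ openSolid j M := by
  rintro _ ⟨q, hq, rfl⟩
  rcases mem_interior_or_boundary (m := m) q.2 with hi | hb
  · by_contra hn
    have h1 := solid_diff_openSolid_subset j M ⟨P.mapsTo (openSolid_subset_solid j M hq), hn⟩
    have h2 : P '' openSolid j M ∈ 𝓝 (P q) := by
      rw [← (P.map_nhds hq hi).2]
      exact Filter.image_mem_map ((isOpen_openSolid j M).mem_nhds hq)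
    obtain ⟨y, hy, hys⟩ := mem_closure_iff_nhds.1 h1 _ h2
    exact hys (P.image_subset (image_mono (openSolid_subset_solid j M) hy))
  · exact h.image_openSide_subset ⟨q, ⟨hq, hb⟩, rfl⟩

/-- Transport of a continuity constraint along an injective map `G` such that `G ∘ f₁` is a
layer. -/
lemma Layer.closure_transfer [T2Space M] [CompactSpace M] {G f₁ : Amb j M → Amb j M}
    (h : Layer m T (G ∘ f₁)) {D B C : Set (Amb j M)} (hG : InjOn G D) (hD : MapsTo f₁ T D)
    (hf₁ : ContinuousOn f₁ T) (hC : C ⊆ D)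
    (hcon : closure (f₁ '' T \ B) ∩ C = ∅) :
    closure ((G ∘ f₁) '' T \ G '' B) ∩ G '' C = ∅ := by
  have h1 : (G ∘ f₁) '' T \ G '' B ⊆ (G ∘ f₁) '' {p ∈ T | f₁ p ∉ B} := by
    rintro _ ⟨⟨p, hp, rfl⟩, hn⟩
    exact ⟨p, ⟨hp, fun h => hn ⟨_, h, rfl⟩⟩, rfl⟩
  rw [← subset_empty_iff]
  rintro y ⟨hy, c, hc, rfl⟩
  obtain ⟨p, hp, hpc⟩ := h.closure_image_subset (fun p hp => hp.1) (closure_mono h1 hy)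
  have hpT : p ∈ T := closure_minimal (fun p hp => hp.1) h.isClosed_region hp
  have h2 : f₁ p = c := hG (hD hpT) (hC hc) hpc
  have h3 : f₁ p ∈ closure (f₁ '' T \ B) := by
    have h4 : ContinuousWithinAt f₁ {p ∈ T | f₁ p ∉ B} p := (hf₁ p hpT).mono fun p hp => hp.1
    refine closure_mono ?_ (h4.mem_closure_image hp)
    rintro _ ⟨r, hr, rfl⟩
    exact ⟨⟨r, hr.1, rfl⟩, hr.2⟩
  have : c ∈ closure (f₁ '' T \ B) ∩ C := ⟨h2 ▸ h3, hc⟩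
  rw [hcon] at this; exact this

/-- The constraint between a layer spliced with `s` along `J` and the puck `J ∘ P`, where `P` is a
puck above `s`. -/
lemma Below.comp_puck [T2Space M] [CompactSpace M] [IsManifold (𝓡∂ m) ∞ M] {J P : Puck j m M}
    (h : Below T f J) {s : LongEmb j m M} (hP : Below univ s P) :
    closure ((Splicing.graft J s ∘ f) '' T \ (J ∘ P) '' solid j M) ∩
      (J ∘ P) '' openSide j m M = ∅ := by
  rw [← subset_empty_iff]
  rintro y ⟨hy, q, hq, rfl⟩
  have hu : P q ∈ openSolid j M := hP.image_openSide_subset ⟨q, hq, rfl⟩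
  obtain ⟨V, hV, hVT⟩ := (h.graft_self s).exists_nhds hu
  have h1 : (J ∘ P) q ∈ closure (J '' (s '' solid j M \ P '' solid j M)) := by
    rw [mem_closure_iff_nhds]
    intro W hW
    obtain ⟨y, ⟨hyW, hyV⟩, hyT, hyn⟩ := mem_closure_iff_nhds.1 hy _ (Filter.inter_mem hW hV)
    refine ⟨y, hyW, ?_⟩
    have hyJ := hVT ⟨hyV, hyT⟩
    obtain ⟨p, hp, rfl⟩ := hyT
    rw [Function.comp_apply, graft_mem_image_solid_iff] at hyJ
    obtain ⟨r, hr, hrp⟩ := hyJ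
    rw [Function.comp_apply, ← hrp, graft_apply J s hr] at hyn ⊢
    refine ⟨s r, ⟨⟨r, hr, rfl⟩, fun ⟨t, ht, htr⟩ => hyn ⟨t, ht, by
      rw [Function.comp_apply, htr]⟩⟩, rfl⟩
  have hss : s '' solid j M ⊆ solid j M := s.mapsTo_solid.image_subset
  have h2 := J.layer.closure_image_subset (sdiff_subset.trans hss) h1
  obtain ⟨r, hr, hrq⟩ := h2
  have hrS : r ∈ solid j M := closure_minimal (sdiff_subset.trans hss) (isClosed_solid j M) hr
  have h3 : r = P q := J.injOn hrS (openSolid_subset_solid j M hu) hrq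
  have h4 : P q ∈ closure (s '' univ \ P '' solid j M) ∩ P '' openSide j m M := by
    refine ⟨?_, q, hq, rfl⟩
    rw [← h3]
    exact closure_mono (sdiff_subset_sdiff_left (image_mono (subset_univ _))) hr
  rw [hP] at h4; exact h4

lemma Layer.comp_puck [IsManifold (𝓡∂ m) ∞ M] (J P : Puck j m M) :
    Layer m (solid j M) (J ∘ P) where
  region := Or.inr rfl
  imm := J.smoothImmOn.comp P.smoothImmOn (uniqueMDiffOn_solid j m M) P.mapsTo
  inj := J.injOn.comp P.injOn P.mapsTo
  off p hp := by rw [Function.comp_apply, P.off_domain p hp, J.off_domain p hp]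
  mapsTo := J.mapsTo.comp P.mapsTo

/-- Two pucks each of which could be above the other, and that do not overlap in their interiors,
only meet along their ends. -/
lemma Below.disjoint [T2Space M] [IsManifold (𝓡∂ m) ∞ M] {J J' : Puck j m M}
    (h : Below (solid j M) J' J)
    (hd : J '' openSolid j M ∩ J' '' openSolid j M = ∅) :
    Disjoint (J '' openSolid j M) (J' '' solid j M) := by
  rw [Set.disjoint_left]
  rintro y hy ⟨p, hp, rfl⟩
  have h1 := h.preimage_mem_nhdsWithin (J'.continuousOn p hp) hy
  have h2 : p ∈ closure (openSolid j M) := by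
    have h3 : Filter.Tendsto (fun c : ℝ => ((c • p.1, p.2) : Amb j M)) (𝓝[<] 1) (𝓝 p) := by
      have : ContinuousAt (fun c : ℝ => ((c • p.1, p.2) : Amb j M)) 1 := by fun_prop
      simpa using this.tendsto.mono_left (nhdsWithin_le_nhds (s := Iio 1))
    refine mem_closure_of_tendsto h3 ?_
    filter_upwards [Ioo_mem_nhdsLT (zero_lt_one (α := ℝ))] with c hc i
    have h4 := hp i
    simp only [PiLp.smul_apply, smul_eq_mul]
    constructor <;> nlinarith [h4.1, h4.2, hc.1, hc.2]
  have h3 : J' ⁻¹' (J '' openSolid j M) ∈ 𝓝[openSolid j M] p :=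
    nhdsWithin_mono _ (openSolid_subset_solid j M) h1
  have : (𝓝[openSolid j M] p).NeBot := mem_closure_iff_nhdsWithin_neBot.1 h2
  obtain ⟨r, hr, hrO⟩ := Filter.nonempty_of_mem (Filter.inter_mem h3 self_mem_nhdsWithin)
  have : J' r ∈ J '' openSolid j M ∩ J' '' openSolid j M := ⟨hr, r, hrO, rfl⟩
  rw [hd] at this; exact this

end Layers

/-! ### Compositions of families of maps in order of height -/

section ComposeFrom

lemma filter_finRange_le (k c : ℕ) :
    (List.finRange k).filter (fun i => c ≤ i.val) = (List.finRange k).drop c := by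
  induction k generalizing c with
  | zero => simp
  | succ k ih =>
    cases c with
    | zero => simp
    | succ c =>
      rw [List.finRange_succ, List.filter_cons_of_neg (by simp), List.drop_succ_cons,
        List.filter_map, ← List.map_drop, ← ih]
      congr 2
      ext i; simp

/-- The composite of the maps `F x`, for `x` in a list, the head of the list being applied first. -/
def runList {ι : Type*} {X : Type u} (F : ι → X → X) : List ι → X → X
  | [] => id
  | x :: l => runList F l ∘ F x

lemma foldl_eq_runList {ι : Type*} {X : Type u} (F : ι → X → X) (l : List ι) (a : X → X) :
    l.foldl (fun acc i => F i ∘ acc) a = runList F l ∘ a := by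
  induction l generalizing a with
  | nil => rfl
  | cons x l ih => rw [List.foldl_cons, ih]; rfl

lemma runList_map {ι κ : Type*} {X : Type u} (F : κ → X → X) (e : ι → κ) (l : List ι) :
    runList (F ∘ e) l = runList F (l.map e) := by
  induction l with
  | nil => rfl
  | cons x l ih => rw [runList, ih]; rfl

/-- Two orderings of a family of maps have the same composite if any two maps that are in different
order commute. -/
lemma runList_eq_of_perm {ι : Type*} {X : Type u} (F : ι → X → X) {l l' : List ι}
    (hl : l.Perm l')
    (hc : ∀ x y, [x, y].Sublist l → [y, x].Sublist l' → F x ∘ F y = F y ∘ F x) :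
    runList F l = runList F l' := by
  induction l' generalizing l with
  | nil => rw [hl.eq_nil]
  | cons x t ih =>
    obtain ⟨u, v, rfl⟩ := List.append_of_mem (hl.mem_iff.2 List.mem_cons_self)
    have h1 : (u ++ v).Perm t := List.perm_cons x |>.1 (List.perm_middle.symm.trans hl)
    have h2 : runList F (u ++ x :: v) = runList F (x :: (u ++ v)) := by
      have hu : ∀ y ∈ u, F y ∘ F x = F x ∘ F y := by
        intro y hy
        refine hc y x ?_ ?_
        · exact (List.singleton_sublist.2 hy).append
            (List.singleton_sublist.2 (List.mem_cons_self (a := x) (l := v)))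
        · exact (List.singleton_sublist.2 (h1.mem_iff.1 (List.mem_append_left _ hy))).cons_cons x
      clear hl hc ih h1
      induction u with
      | nil => rfl
      | cons y u ihu =>
        have h3 := ihu fun z hz => hu z (List.mem_cons_of_mem _ hz)
        have h4 := hu y List.mem_cons_self
        change runList F (u ++ x :: v) ∘ F y = (runList F (u ++ v) ∘ F y) ∘ F x
        rw [h3, Function.comp_assoc, h4]; rfl
    rw [h2, runList, runList, ih h1 fun a b ha hb => hc a b ?_
      (hb.trans (List.sublist_cons_self _ _))]
    exact ha.trans ((List.sublist_cons_self _ _).append_left _)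

variable {X : Type u} {k : ℕ} (g : Fin k → X → X)

lemma composeFrom_eq_runList (c : ℕ) :
    composeFrom g c = runList g ((List.finRange k).drop c) := by
  rw [composeFrom, foldl_eq_runList, filter_finRange_le]; rfl

lemma composeFrom_of_le {c : ℕ} (hc : k ≤ c) : composeFrom g c = id := by
  rw [composeFrom_eq_runList, List.drop_eq_nil_of_le (by simpa using hc)]; rfl

lemma composeFrom_eq_comp (i : Fin k) : composeFrom g i = composeFrom g (i + 1) ∘ g i := by
  rw [composeFrom_eq_runList, composeFrom_eq_runList,
    List.drop_eq_getElem_cons (by simp), runList]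
  simp

/-- Induction along the factors of `composeFrom`. -/
lemma composeFrom_induction {Y : Type*} {P : ℕ → (Y → X) → Prop}
    (step : ∀ (i : Fin k) f, P i f → P (i + 1) (g i ∘ f)) {c : ℕ} (hc : c ≤ k) {f : Y → X}
    (h : P c f) : P k (composeFrom g c ∘ f) := by
  obtain ⟨d, hd⟩ : ∃ d, c + d = k := ⟨k - c, by omega⟩
  induction d generalizing c f with
  | zero =>
    obtain rfl : c = k := by omega
    rw [composeFrom_of_le _ le_rfl]; exact h
  | succ d ih =>
    have h1 := ih (c := c + 1) (by omega) (step ⟨c, by omega⟩ f h) (by omega)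
    rw [composeFrom_eq_comp g ⟨c, by omega⟩]; exact h1

/-- The factors of `composeFrom g c` below height `h`. -/
lemma composeFrom_split {Y : Type*} {P : ℕ → (Y → X) → Prop}
    (step : ∀ (i : Fin k) f, P i f → P (i + 1) (g i ∘ f)) {c h : ℕ} (hch : c ≤ h) (hh : h ≤ k)
    {f : Y → X} (hf : P c f) : ∃ f', P h f' ∧ composeFrom g c ∘ f = composeFrom g h ∘ f' := by
  obtain ⟨d, hd⟩ : ∃ d, c + d = h := ⟨h - c, by omega⟩
  induction d generalizing c f with
  | zero =>
    obtain rfl : c = h := by omega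
    exact ⟨f, hf, rfl⟩
  | succ d ih =>
    obtain ⟨f', h1, h2⟩ := ih (c := c + 1) (by omega) (step ⟨c, by omega⟩ f hf) (by omega)
    refine ⟨f', h1, ?_⟩
    rw [composeFrom_eq_comp g ⟨c, by omega⟩, ← h2]; rfl

lemma composeFrom_injective (hg : ∀ i, Function.Injective (g i)) (c : ℕ) :
    Function.Injective (composeFrom g c) := by
  rcases le_total c k with hc | hc
  · exact composeFrom_induction g (P := fun _ f => Function.Injective f)
      (fun i f hf => (hg i).comp hf) hc Function.injective_id
  · rw [composeFrom_of_le g hc]; exact Function.injective_id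

/-- The composite in order of height only depends on the heights through the relative order of
maps that do not commute. -/
lemma composeFrom_zero_congr (F : Fin k → X → X) (α α' : Equiv.Perm (Fin k))
    (h : ∀ x y, α⁻¹ x < α⁻¹ y → α'⁻¹ y < α'⁻¹ x → F x ∘ F y = F y ∘ F x) :
    composeFrom (F ∘ α) 0 = composeFrom (F ∘ α') 0 := by
  simp only [composeFrom_eq_runList, List.drop_zero, runList_map]
  have hs : ∀ (β : Equiv.Perm (Fin k)) {x y}, [x, y].Sublist ((List.finRange k).map β) →
      β⁻¹ x < β⁻¹ y := by
    intro β x y hxy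
    have h1 : ((List.finRange k).map β).Pairwise (fun x y => β⁻¹ x < β⁻¹ y) := by
      rw [List.pairwise_map]
      simpa using List.pairwise_lt_finRange k
    exact List.pairwise_iff_forall_sublist.1 h1 hxy
  refine runList_eq_of_perm F ?_ fun x y hx hy => h x y (hs α hx) (hs α' hy)
  rw [List.perm_ext_iff_of_nodup ((List.nodup_finRange k).map α.injective)
    ((List.nodup_finRange k).map α'.injective)]
  simp only [List.mem_map, List.mem_finRange, true_and]
  exact fun a => iff_of_true (α.surjective a) (α'.surjective a)

/-- The composite of the maps above a marked index `a`, on a set `A`, only depends on the heights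
through the relative order of maps that do not commute, if the maps that change place with `a`
fix `A` pointwise. -/
lemma composeFrom_succ_congr (F : Fin k → X → X) (α α' : Equiv.Perm (Fin k)) (a : Fin k)
    (A : Set X)
    (h : ∀ x y, α⁻¹ x < α⁻¹ y → α'⁻¹ y < α'⁻¹ x → F x ∘ F y = F y ∘ F x)
    (ha : ∀ x, ¬ (α⁻¹ x < α⁻¹ a ↔ α'⁻¹ x < α'⁻¹ a) → ∀ p ∈ A, F x p = p) {p : X} (hp : p ∈ A) :
    composeFrom (F ∘ α) (α⁻¹ a + 1) p = composeFrom (F ∘ α') (α'⁻¹ a + 1) p := by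
  classical
  let F' : Fin k → X ⊕ X → X ⊕ X := fun x => if x = a then
      Sum.elim (fun p => if p ∈ A then Sum.inr p else Sum.inl p) Sum.inr
    else Sum.elim Sum.inl (fun p => Sum.inr (F x p))
  have key : ∀ β : Equiv.Perm (Fin k), composeFrom (F' ∘ β) 0 (Sum.inl p) =
      Sum.inr (composeFrom (F ∘ β) (β⁻¹ a + 1) p) := by
    intro β
    have h1 : ∀ c, ∀ q, (β⁻¹ a : ℕ) + 1 ≤ c → composeFrom (F' ∘ β) c (Sum.inr q) =
        Sum.inr (composeFrom (F ∘ β) c q) := by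
      intro c q hc
      rcases le_total k c with hk | hk
      · rw [composeFrom_of_le _ hk, composeFrom_of_le _ hk]; rfl
      obtain ⟨d, hd⟩ : ∃ d, c + d = k := ⟨k - c, by omega⟩
      induction d generalizing c q with
      | zero => rw [composeFrom_of_le _ (by omega), composeFrom_of_le _ (by omega)]; rfl
      | succ d ih =>
        have hc' : c < k := by omega
        have hne : β ⟨c, hc'⟩ ≠ a := by
          intro hβ
          have : β⁻¹ a = ⟨c, hc'⟩ := by rw [← hβ]; simp
          rw [this] at hc; simp at hc
        have e1 := composeFrom_eq_comp (F' ∘ β) ⟨c, hc'⟩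
        have e2 := composeFrom_eq_comp (F ∘ β) ⟨c, hc'⟩
        simp only at e1 e2
        rw [e1, e2, Function.comp_apply, Function.comp_apply (f := composeFrom (F ∘ β) (c + 1)),
          ← ih (c + 1) _ (by omega) (by omega) (by omega)]
        congr 1
        simp [F', hne]
    have h2 : ∀ c, c ≤ (β⁻¹ a : ℕ) → composeFrom (F' ∘ β) c (Sum.inl p) =
        Sum.inr (composeFrom (F ∘ β) (β⁻¹ a + 1) p) := by
      intro c hc
      obtain ⟨d, hd⟩ : ∃ d, c + d = (β⁻¹ a : ℕ) := ⟨(β⁻¹ a : ℕ) - c, by omega⟩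
      induction d generalizing c with
      | zero =>
        obtain rfl : c = (β⁻¹ a : ℕ) := by omega
        rw [composeFrom_eq_comp (F' ∘ β) (β⁻¹ a), Function.comp_apply, ← h1 _ _ le_rfl]
        congr 1
        simp [F', hp]
      | succ d ih =>
        have hlt : c < k := by omega
        have hne : β ⟨c, hlt⟩ ≠ a := by
          intro hβ
          have : β⁻¹ a = ⟨c, hlt⟩ := by rw [← hβ]; simp
          rw [this] at hd; simp at hd
        have e1 := composeFrom_eq_comp (F' ∘ β) ⟨c, hlt⟩
        simp only at e1
        rw [e1, Function.comp_apply, ← ih (c + 1) (by omega) (by omega)]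
        congr 1
        simp [F', hne]
    exact h2 0 (Nat.zero_le _)
  have h3 : composeFrom (F' ∘ α) 0 = composeFrom (F' ∘ α') 0 := by
    refine composeFrom_zero_congr F' α α' fun x y hxy hyx => ?_
    by_cases hx : x = a
    · subst hx
      have hy : y ≠ x := by rintro rfl; exact lt_irrefl _ hxy
      have hfix := ha y fun h => lt_asymm hxy (h.2 hyx)
      funext q
      rcases q with q | q
      · by_cases hq : q ∈ A
        · simp [F', hy, hq, hfix q hq]
        · simp [F', hy, hq]
      · simp [F', hy]
    · by_cases hy : y = a
      · subst hy
        have hfix := ha x fun h => lt_asymm hyx (h.1 hxy)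
        funext q
        rcases q with q | q
        · by_cases hq : q ∈ A
          · simp [F', hx, hq, hfix q hq]
          · simp [F', hx, hq]
        · simp [F', hx]
      · funext q
        rcases q with q | q
        · simp [F', hx, hy]
        · simpa [F', hx, hy] using congrFun (h x y hxy hyx) q
  exact Sum.inr_injective ((key α).symm.trans ((congrFun h3 _).trans (key α')))

end ComposeFrom

section Heights

lemma finSigmaFinEquiv_lt_of_lt {k : ℕ} {n : Fin k → ℕ} {i i' : Fin k} (h : i < i')
    (b : Fin (n i)) (b' : Fin (n i')) :
    (finSigmaFinEquiv ⟨i, b⟩ : Fin (∑ i, n i)) < finSigmaFinEquiv ⟨i', b'⟩ := by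
  rw [Fin.lt_def, finSigmaFinEquiv_apply, finSigmaFinEquiv_apply]
  have h1 : ∑ x : Fin (i + 1), n (Fin.castLE i.2 x) ≤ ∑ x : Fin i', n (Fin.castLE i'.2.le x) := by
    have hle : (i : ℕ) + 1 ≤ i' := h
    obtain ⟨d, hd⟩ := Nat.exists_eq_add_of_le hle
    have h2 : ∀ (e : ℕ) (he : e ≤ k), (∑ x : Fin e, n (Fin.castLE he x)) =
        ∑ x ∈ Finset.range e, if hx : x < k then n ⟨x, hx⟩ else 0 := by
      intro e he
      rw [← Fin.sum_univ_eq_sum_range (fun x => if hx : x < k then n ⟨x, hx⟩ else 0)]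
      refine Finset.sum_congr rfl fun x _ => ?_
      rw [dif_pos (lt_of_lt_of_le x.2 he)]; rfl
    rw [h2, h2]
    exact Finset.sum_le_sum_of_subset (Finset.range_mono hle)
  rw [Fin.sum_univ_castSucc] at h1
  have h3 : n (Fin.castLE i.2 (Fin.last i)) = n i := by congr 1
  have h4 : (b : ℕ) < n (Fin.castLE i.2 (Fin.last i)) := lt_of_lt_of_eq b.2 h3.symm
  calc _ < _ := Nat.add_lt_add_left h4 _
    _ ≤ _ := h1
    _ ≤ _ := Nat.le_add_right _ _

variable {k : ℕ} {n : Fin k → ℕ} (α : Equiv.Perm (Fin k)) (σ : ∀ a, Equiv.Perm (Fin (n a)))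

lemma compHeight_apply (a : Fin k) (b : Fin (n a)) :
    ∃ c : Fin (n (α (α⁻¹ a))), (c : ℕ) = ((σ a)⁻¹ b : ℕ) ∧
      (compHeight α σ (finSigmaFinEquiv ⟨a, b⟩) : ℕ) =
        (finSigmaFinEquiv (n := fun i => n (α i)) ⟨α⁻¹ a, c⟩ : ℕ) := by
  obtain ⟨i, rfl⟩ := α.surjective a
  have : α⁻¹ (α i) = i := by simp
  rw [this]
  refine ⟨(σ (α i))⁻¹ b, rfl, ?_⟩
  simp only [compHeight, Equiv.trans_apply, Equiv.symm_apply_apply, finCongr_apply, Fin.val_cast]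
  congr 2
  rw [Equiv.symm_apply_eq]
  rfl

lemma compHeight_lt_of_lt {a a' : Fin k} (h : α⁻¹ a < α⁻¹ a') (b : Fin (n a)) (b' : Fin (n a')) :
    compHeight α σ (finSigmaFinEquiv ⟨a, b⟩) < compHeight α σ (finSigmaFinEquiv ⟨a', b'⟩) := by
  obtain ⟨c, -, h1⟩ := compHeight_apply α σ a b
  obtain ⟨c', -, h2⟩ := compHeight_apply α σ a' b'
  rw [Fin.lt_def, h1, h2, ← Fin.lt_def]
  exact finSigmaFinEquiv_lt_of_lt (n := fun i => n (α i)) h c c'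

lemma compHeight_lt_iff_of_ne {a a' : Fin k} (h : a ≠ a') (b : Fin (n a)) (b' : Fin (n a')) :
    compHeight α σ (finSigmaFinEquiv ⟨a, b⟩) < compHeight α σ (finSigmaFinEquiv ⟨a', b'⟩) ↔
      α⁻¹ a < α⁻¹ a' := by
  refine ⟨fun h1 => ?_, fun h1 => compHeight_lt_of_lt α σ h1 b b'⟩
  by_contra h2
  have h3 : α⁻¹ a' < α⁻¹ a := lt_of_le_of_ne (not_lt.1 h2) fun h4 => h (α⁻¹.injective h4).symm
  exact lt_asymm h1 (compHeight_lt_of_lt α σ h3 b' b)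

lemma compHeight_lt_iff (a : Fin k) (b b' : Fin (n a)) :
    compHeight α σ (finSigmaFinEquiv ⟨a, b⟩) < compHeight α σ (finSigmaFinEquiv ⟨a, b'⟩) ↔
      (σ a)⁻¹ b < (σ a)⁻¹ b' := by
  obtain ⟨c, hc, h1⟩ := compHeight_apply α σ a b
  obtain ⟨c', hc', h2⟩ := compHeight_apply α σ a b'
  rw [Fin.lt_def, h1, h2, finSigmaFinEquiv_apply, finSigmaFinEquiv_apply, Nat.add_lt_add_iff_left,
    hc, hc', Fin.lt_def]

end Heights

/-! ### The structure maps are well defined -/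

section Composite

variable {j m : ℕ} [NeZero m] {M : Type u} [TopologicalSpace M]
  [ChartedSpace (EuclideanHalfSpace m) M] {k : ℕ} {n : Fin k → ℕ}

lemma PreDiagram.below_long (P : PreDiagram j m M k) (a : Fin k) :
    Below univ P.long (P.puck a) := by
  rw [Below, image_univ]; exact P.constraint_long a

lemma PreDiagram.below_puck (P : PreDiagram j m M k) {a a' : Fin k}
    (h : P.perm⁻¹ a < P.perm⁻¹ a') : Below (solid j M) (P.puck a) (P.puck a') :=
  P.constraint_puck a a' h

lemma PreDiagram.below_perm (P : PreDiagram j m M k) {i i' : Fin k} (h : i < i') :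
    Below (solid j M) (P.puck (P.perm i)) (P.puck (P.perm i')) :=
  P.below_puck (by simpa using h)

section

variable [T2Space M] (P : PreDiagram j m M k) (Q : ∀ a, PreDiagram j m M (n a))

lemma graftAt_injective (i : Fin k) : Function.Injective (graftAt P Q i) :=
  graft_injective _ _

lemma graftAt_inv (a : Fin k) : graftAt P Q (P.perm⁻¹ a) = graft (P.puck a) (Q a).long := by
  have : ∀ i, i = P.perm⁻¹ a → graftAt P Q i = graft (P.puck a) (Q a).long := by
    rintro i rfl
    rw [graftAt]
    have : P.perm (P.perm⁻¹ a) = a := by simp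
    rw [this]
  exact this _ rfl

variable [CompactSpace M] [IsManifold (𝓡∂ m) ∞ M]

/-- `f` is a layer below all pucks of height at least `c`. -/
def LayerBelow (P : PreDiagram j m M k) (T : Set (Amb j M)) (c : ℕ)
    (f : Amb j M → Amb j M) : Prop :=
  Layer m T f ∧ ∀ i : Fin k, c ≤ i → Below T f (P.puck (P.perm i))

lemma LayerBelow.step {T : Set (Amb j M)} (i : Fin k) (f : Amb j M → Amb j M)
    (h : LayerBelow P T i f) : LayerBelow P T (i + 1) (graftAt P Q i ∘ f) :=
  ⟨h.1.graft (h.2 i le_rfl) _, fun i' hi' =>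
    (h.2 i' ((Nat.le_succ _).trans hi')).graft (P.below_perm hi') _⟩

lemma layerBelow_long : LayerBelow P univ 0 P.long :=
  ⟨P.long.layer, fun _ _ => P.below_long _⟩

lemma layerBelow_puck (a : Fin k) (b : Fin (n a)) :
    LayerBelow P (solid j M) (P.perm⁻¹ a + 1) (P.puck a ∘ (Q a).puck b) := by
  refine ⟨Layer.comp_puck _ _, fun i hi => ?_⟩
  refine (P.below_puck (a := a) (a' := P.perm i) ?_).mono ?_
  · simpa using hi
  · rw [image_comp]; exact image_mono ((Q a).puck b).image_subset

lemma layer_compLong : Layer m univ (compLong P Q) :=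
  (composeFrom_induction (graftAt P Q) (LayerBelow.step P Q) (Nat.zero_le k)
    (layerBelow_long P)).1

lemma layer_compPuck (a : Fin k) (b : Fin (n a)) : Layer m (solid j M) (compPuck P Q a b) :=
  (composeFrom_induction (graftAt P Q) (LayerBelow.step P Q) (P.perm⁻¹ a).2
    (layerBelow_puck P Q a b)).1

/-- The continuity constraint of the composite, for a layer that starts at height `c`, below the
puck `J_a`. -/
lemma below_compPuck {T : Set (Amb j M)} {c : ℕ} {f : Amb j M → Amb j M}
    (hf : LayerBelow P T c f) (a : Fin k) (hc : c ≤ P.perm⁻¹ a) (b : Fin (n a)) :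
    closure ((composeFrom (graftAt P Q) c ∘ f) '' T \ compPuck P Q a b '' solid j M) ∩
      compPuck P Q a b '' openSide j m M = ∅ := by
  obtain ⟨f', hf', he⟩ := composeFrom_split (graftAt P Q) (LayerBelow.step P Q) hc
    (P.perm⁻¹ a).2.le hf
  have hl : Layer m T (composeFrom (graftAt P Q) c ∘ f) :=
    (composeFrom_induction (graftAt P Q) (LayerBelow.step P Q)
      (hc.trans (P.perm⁻¹ a).2.le) hf).1
  have hb : Below T f' (P.puck a) := by simpa using hf'.2 (P.perm⁻¹ a) le_rfl
  rw [composeFrom_eq_comp (graftAt P Q) (P.perm⁻¹ a), graftAt_inv, Function.comp_assoc] at he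
  rw [he] at hl ⊢
  rw [compPuck, image_comp _ _ (solid j M), image_comp _ _ (openSide j m M)]
  exact hl.closure_transfer (D := univ) (composeFrom_injective _ (graftAt_injective P Q) _).injOn
    (mapsTo_univ _ _) (hf'.1.graft hb _).continuousOn (subset_univ _)
    (hb.comp_puck ((Q a).below_long b))

lemma below_compPuck_same (a : Fin k) {b b' : Fin (n a)} (h : (Q a).perm⁻¹ b < (Q a).perm⁻¹ b') :
    closure (compPuck P Q a b '' solid j M \ compPuck P Q a b' '' solid j M) ∩
      compPuck P Q a b' '' openSide j m M = ∅ := by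
  have h1 := layer_compPuck P Q a b
  have e : ∀ b, compPuck P Q a b = (composeFrom (graftAt P Q) (P.perm⁻¹ a + 1) ∘ P.puck a) ∘
    (Q a).puck b := fun _ => rfl
  rw [e] at h1 ⊢
  rw [e b', image_comp _ _ (solid j M), image_comp _ ((Q a).puck b') (solid j M),
    image_comp _ _ (openSide j m M)]
  rw [← image_comp]
  refine h1.closure_transfer (D := solid j M) ?_ ((Q a).puck b).mapsTo
    ((Q a).puck b).continuousOn ?_ ((Q a).constraint_puck b b' h)
  · exact (composeFrom_injective _ (graftAt_injective P Q) _).comp_injOn (P.puck a).injOn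
  · exact (image_mono (fun p hp => openSolid_subset_solid j M hp.1)).trans
      ((Q a).puck b').image_subset

/-- The tuple `P.Q`. -/
def compose : PreDiagram j m M (∑ a, n a) where
  long := (layer_compLong P Q).toLongEmb
  puck x := (layer_compPuck P Q (finSigmaFinEquiv.symm x).1 (finSigmaFinEquiv.symm x).2).toPuck
  perm := (compHeight P.perm (fun a => (Q a).perm))⁻¹
  constraint_long x := by
    obtain ⟨⟨a, b⟩, rfl⟩ := finSigmaFinEquiv.surjective x
    have h := below_compPuck P Q (layerBelow_long P) a (Nat.zero_le _) b
    rw [image_univ] at h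
    rw [Equiv.symm_apply_apply]
    exact h
  constraint_puck x x' hx := by
    obtain ⟨⟨a, b⟩, rfl⟩ := finSigmaFinEquiv.surjective x
    obtain ⟨⟨a', b'⟩, rfl⟩ := finSigmaFinEquiv.surjective x'
    rw [Equiv.symm_apply_apply, Equiv.symm_apply_apply]
    rw [inv_inv] at hx
    by_cases haa : a = a'
    · subst haa
      exact below_compPuck_same P Q a ((compHeight_lt_iff _ _ a b b').1 hx)
    · exact below_compPuck P Q (layerBelow_puck P Q a b) a'
        ((compHeight_lt_iff_of_ne _ _ haa b b').1 hx) b'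

lemma compose_puck (a : Fin k) (b : Fin (n a)) :
    ((compose P Q).puck (finSigmaFinEquiv ⟨a, b⟩) : Amb j M → Amb j M) = compPuck P Q a b := by
  change compPuck P Q (finSigmaFinEquiv.symm (finSigmaFinEquiv ⟨a, b⟩)).1
    (finSigmaFinEquiv.symm (finSigmaFinEquiv ⟨a, b⟩)).2 = _
  rw [Equiv.symm_apply_apply]

lemma compose_perm : (compose P Q).perm⁻¹ = compHeight P.perm (fun a => (Q a).perm) := inv_inv _

end

section Independence

variable [T2Space M] {P P' : PreDiagram j m M k} {Q Q' : ∀ a, PreDiagram j m M (n a)}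

lemma graft_comm {J J' : Puck j m M} (h : J '' openSolid j M ∩ J' '' openSolid j M = ∅)
    (s s' : LongEmb j m M) : graft J s ∘ graft J' s' = graft J' s' ∘ graft J s := by
  have key : ∀ {J J' : Puck j m M}, J '' openSolid j M ∩ J' '' openSolid j M = ∅ →
      ∀ (s s' : LongEmb j m M) p, p ∈ J '' openSolid j M →
      graft J s (graft J' s' p) = graft J' s' (graft J s p) := by
    intro J J' h s s' p hp
    have hd : ∀ p, p ∈ J '' openSolid j M → p ∉ J' '' openSolid j M := fun p h1 h2 => by
      have h3 : p ∈ J '' openSolid j M ∩ J' '' openSolid j M := ⟨h1, h2⟩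
      rw [h] at h3; exact h3
    rw [graft_of_notMem_openSolid J' s' (hd p hp), graft_of_notMem_openSolid J' s'
      (hd _ ((graft_mem_image_openSolid_iff J s).2 hp))]
  funext p
  simp only [Function.comp_apply]
  by_cases h1 : p ∈ J '' openSolid j M
  · exact key h s s' p h1
  by_cases h2 : p ∈ J' '' openSolid j M
  · exact (key (by rwa [inter_comm]) s' s p h2).symm
  · rw [graft_of_notMem_openSolid J s h1, graft_of_notMem_openSolid J' s' h2,
      graft_of_notMem_openSolid J s h1]

/-- Pucks in different order in two representatives of a diagram do not overlap. -/
lemma image_inter_eq_empty (h : diagramSetoid j m M k P P') {x y : Fin k}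
    (hxy : P.perm⁻¹ x < P.perm⁻¹ y) (hyx : P'.perm⁻¹ y < P'.perm⁻¹ x) :
    P.puck x '' openSolid j M ∩ P.puck y '' openSolid j M = ∅ := by
  rw [← not_nonempty_iff_eq_empty]
  exact fun hne => lt_asymm hyx ((h.2.2 x y hne).1 hxy)

lemma graftAt_eq (h : diagramSetoid j m M k P P')
    (hQ : ∀ a, diagramSetoid j m M (n a) (Q a) (Q' a)) :
    graftAt P Q = (fun a => graft (P.puck a) (Q a).long) ∘ P.perm ∧
    graftAt P' Q' = (fun a => graft (P.puck a) (Q a).long) ∘ P'.perm := by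
  refine ⟨rfl, ?_⟩
  funext i
  rw [graftAt, Function.comp_apply, h.2.1, (hQ _).1]

lemma compLong_congr (h : diagramSetoid j m M k P P')
    (hQ : ∀ a, diagramSetoid j m M (n a) (Q a) (Q' a)) : compLong P Q = compLong P' Q' := by
  rw [compLong, compLong, (graftAt_eq h hQ).1, (graftAt_eq h hQ).2, h.1]
  congr 1
  exact composeFrom_zero_congr _ _ _ fun x y hxy hyx =>
    graft_comm (image_inter_eq_empty h hxy hyx) _ _

lemma compPuck_congr [IsManifold (𝓡∂ m) ∞ M] (h : diagramSetoid j m M k P P')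
    (hQ : ∀ a, diagramSetoid j m M (n a) (Q a) (Q' a)) (a : Fin k) (b : Fin (n a)) :
    compPuck P Q a b = compPuck P' Q' a b := by
  funext p
  by_cases hp : p ∈ solid j M
  · simp only [compPuck, Function.comp_apply]
    rw [(graftAt_eq h hQ).1, (graftAt_eq h hQ).2, ← h.2.1, ← (hQ a).2.1]
    refine composeFrom_succ_congr _ _ _ a (P.puck a '' solid j M)
      (fun x y hxy hyx => graft_comm (image_inter_eq_empty h hxy hyx) _ _) ?_
      ⟨_, ((Q a).puck b).mapsTo hp, rfl⟩
    intro x hx p hp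
    have hxa : x ≠ a := by rintro rfl; exact hx (by simp)
    have hne : ∀ R : PreDiagram j m M k, ¬ R.perm⁻¹ x < R.perm⁻¹ a → R.perm⁻¹ a < R.perm⁻¹ x :=
      fun R hR => lt_of_le_of_ne (not_lt.1 hR) fun h => hxa (R.perm⁻¹.injective h).symm
    have hd : Disjoint (P.puck x '' openSolid j M) (P.puck a '' solid j M) := by
      by_cases h1 : P.perm⁻¹ x < P.perm⁻¹ a
      · have h2 := hne P' fun h2 => hx (iff_of_true h1 h2)
        have h3 := P'.below_puck h2
        rw [← h.2.1] at h3
        exact h3.disjoint (image_inter_eq_empty h h1 h2)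
      · have h2 : P'.perm⁻¹ x < P'.perm⁻¹ a := by
          by_contra h2; exact hx (iff_of_false h1 h2)
        refine (P.below_puck (hne P h1)).disjoint ?_
        rw [inter_comm]
        exact image_inter_eq_empty h (hne P h1) h2
    exact graft_of_notMem_openSolid _ _ fun h1 => (Set.disjoint_left.1 hd) h1 hp
  · have h1 : ∀ (P : PreDiagram j m M k) (Q : ∀ a, PreDiagram j m M (n a)),
        compPuck P Q a b p = p := by
      intro P Q
      have h2 := composeFrom_induction (graftAt P Q) (P := fun _ f => f p = p) (fun i f hf => by
        rw [Function.comp_apply, hf]; exact graft_of_notMem_solid _ _ hp)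
        (P.perm⁻¹ a).2 (f := P.puck a ∘ (Q a).puck b) (by
        rw [Function.comp_apply, ((Q a).puck b).off_domain p hp, (P.puck a).off_domain p hp])
      exact h2
    rw [h1, h1]

/-- A point of `J_a((I^j)° × M)` that is carried by the maps `Φ_i` into `J_{a'}((I^j)° × M)` goes
from one puck to the next one only where these overlap. Hence if `a` is below `a'` in one
representative, it is in the other. -/
lemma lt_of_overlap (h : diagramSetoid j m M k P P') {a a' : Fin k} {z : Amb j M}
    (hz : z ∈ P.puck a' '' openSolid j M) {c : ℕ} (hc : c ≤ P.perm⁻¹ a') {x : Amb j M} {d : Fin k}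
    (hd : (P.perm⁻¹ d : ℕ) < c) (hd' : P'.perm⁻¹ a ≤ P'.perm⁻¹ d)
    (hx : x ∈ P.puck d '' openSolid j M)
    (hxz : composeFrom (graftAt P Q) c x = composeFrom (graftAt P Q) (P.perm⁻¹ a' + 1) z) :
    P'.perm⁻¹ a < P'.perm⁻¹ a' := by
  obtain ⟨e, he⟩ : ∃ e, c + e = P.perm⁻¹ a' := ⟨P.perm⁻¹ a' - c, by omega⟩
  induction e generalizing c x d with
  | zero =>
    obtain rfl : c = P.perm⁻¹ a' := by omega
    rw [composeFrom_eq_comp (graftAt P Q) (P.perm⁻¹ a')] at hxz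
    have h1 := composeFrom_injective _ (graftAt_injective P Q) _ hxz
    rw [graftAt_inv] at h1
    rw [← h1, graft_mem_image_openSolid_iff] at hz
    exact lt_of_le_of_lt hd' ((h.2.2 d a' ⟨x, hx, hz⟩).1 hd)
  | succ e ih =>
    have hck : c < k := by have := (P.perm⁻¹ a').2; omega
    have e1 := composeFrom_eq_comp (graftAt P Q) ⟨c, hck⟩
    simp only at e1
    rw [e1, Function.comp_apply] at hxz
    by_cases hxc : x ∈ P.puck (P.perm ⟨c, hck⟩) '' openSolid j M
    · have h1 : P.perm⁻¹ d < P.perm⁻¹ (P.perm ⟨c, hck⟩) := by simpa [Fin.lt_def] using hd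
      refine ih (by omega) (d := P.perm ⟨c, hck⟩) (by simp)
        (hd'.trans ((h.2.2 d _ ⟨x, hx, hxc⟩).1 h1).le) ?_ hxz (by omega)
      exact (graft_mem_image_openSolid_iff _ _).2 hxc
    · rw [graftAt, graft_of_notMem_openSolid _ _ hxc] at hxz
      exact ih (by omega) (by omega) hd' hx hxz (by omega)

variable [CompactSpace M] [IsManifold (𝓡∂ m) ∞ M]

lemma compose_lt_of_overlap (h : diagramSetoid j m M k P P') {a a' : Fin k} (b : Fin (n a))
    (b' : Fin (n a')) (hne : (compPuck P Q a b '' openSolid j M ∩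
      compPuck P Q a' b' '' openSolid j M).Nonempty) (hlt : P.perm⁻¹ a < P.perm⁻¹ a') :
    P'.perm⁻¹ a < P'.perm⁻¹ a' := by
  obtain ⟨_, ⟨p, hp, rfl⟩, p', hp', hpp⟩ := hne
  refine lt_of_overlap (Q := Q) h (a := a) (d := a) (c := P.perm⁻¹ a + 1)
    (x := P.puck a ((Q a).puck b p)) (z := P.puck a' ((Q a').puck b' p')) ?_ hlt
    (Nat.lt_succ_self _) le_rfl ?_ hpp.symm
  · exact ⟨_, ((Q a').below_long b').image_openSolid_subset ⟨p', hp', rfl⟩, rfl⟩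
  · exact ⟨_, ((Q a).below_long b).image_openSolid_subset ⟨p, hp, rfl⟩, rfl⟩

lemma compose_congr (h : diagramSetoid j m M k P P')
    (hQ : ∀ a, diagramSetoid j m M (n a) (Q a) (Q' a)) :
    diagramSetoid j m M _ (compose P Q) (compose P' Q') := by
  refine ⟨LongEmb.ext (compLong_congr h hQ), ?_, ?_⟩
  · funext x
    obtain ⟨⟨a, b⟩, rfl⟩ := finSigmaFinEquiv.surjective x
    refine Puck.ext ?_
    rw [compose_puck, compose_puck, compPuck_congr h hQ]
  · intro x x' hne
    obtain ⟨⟨a, b⟩, rfl⟩ := finSigmaFinEquiv.surjective x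
    obtain ⟨⟨a', b'⟩, rfl⟩ := finSigmaFinEquiv.surjective x'
    rw [compose_puck, compose_puck] at hne
    rw [compose_perm, compose_perm]
    by_cases haa : a = a'
    · subst haa
      rw [compHeight_lt_iff, compHeight_lt_iff]
      refine (hQ a).2.2 b b' ?_
      obtain ⟨_, ⟨p, hp, rfl⟩, p', hp', hpp⟩ := hne
      have h1 := (P.puck a).injOn (((Q a).puck b').mapsTo (openSolid_subset_solid j M hp'))
        (((Q a).puck b).mapsTo (openSolid_subset_solid j M hp))
        (composeFrom_injective _ (graftAt_injective P Q) _ hpp)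
      exact ⟨_, ⟨p, hp, rfl⟩, p', hp', h1⟩
    · rw [compHeight_lt_iff_of_ne _ _ haa, compHeight_lt_iff_of_ne _ _ haa]
      refine ⟨compose_lt_of_overlap h b b' hne, ?_⟩
      rw [compPuck_congr h hQ, compPuck_congr h hQ] at hne
      exact compose_lt_of_overlap ((diagramSetoid j m M k).symm h) b b' hne

/-- The composite of two classes of tuples. -/
lemma isComposite_mk_compose (P : PreDiagram j m M k) (Q : ∀ a, PreDiagram j m M (n a)) :
    IsComposite (SC.mk P) (fun a => SC.mk (Q a)) (SC.mk (compose P Q)) := by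
  intro P' Q' hP hQ
  refine ⟨compose P' Q', Quotient.sound (compose_congr (Quotient.exact hP)
    fun a => Quotient.exact (hQ a)), rfl, compose_puck P' Q', compose_perm P' Q'⟩

lemma existsUnique_isComposite (J : SC j m M k) (L : ∀ a, SC j m M (n a)) :
    ∃! K, IsComposite J L K := by
  obtain ⟨P, rfl⟩ : ∃ P, SC.mk P = J := Quotient.exists_rep J
  choose Q hQ using fun a => (Quotient.exists_rep (L a) : ∃ Q, SC.mk Q = L a)
  obtain rfl : (fun a => SC.mk (Q a)) = L := funext hQ
  refine ⟨SC.mk (compose P Q), isComposite_mk_compose P Q, fun K hK => ?_⟩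
  obtain ⟨R, rfl, h1, h2, h3⟩ := hK P Q rfl fun a => rfl
  congr 1
  refine PreDiagram.ext (LongEmb.ext h1) (funext fun x => ?_) ?_
  · obtain ⟨⟨a, b⟩, rfl⟩ := finSigmaFinEquiv.surjective x
    exact Puck.ext ((h2 a b).trans (compose_puck P Q a b).symm)
  · exact inv_injective (h3.trans (compose_perm P Q).symm)

end Independence

end Composite

/-! ### Diagrams with disjoint components form a suboperad -/

section Suboperad

variable {j m : ℕ} [NeZero m] {M : Type u} [TopologicalSpace M]
  [ChartedSpace (EuclideanHalfSpace m) M]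

lemma side_subset_closure_openSide : side j m M ⊆ closure (openSide j m M) :=
  fun _ hp => mem_closure_openSolid hp.1 hp.2

section

variable [T2Space M] [CompactSpace M] [IsManifold (𝓡∂ m) ∞ M]

/-- The interior of a layer below a puck does not meet the sides of that puck: otherwise, by
the continuity constraint, the puck would map a boundary point to an interior point of its image. -/
lemma Layer.notMem_image_side {T : Set (Amb j M)} {f : Amb j M → Amb j M} (h : Layer m T f)
    {J : Puck j m M} (hJ : Below T f J) {p : Amb j M} (hp : T ∈ 𝓝 p)
    (hi : p.2 ∈ (𝓡∂ m).interior M) : f p ∉ J '' side j m M := by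
  have hmap : ∀ r, T ∈ 𝓝 r → r.2 ∈ (𝓡∂ m).interior M →
      (ambModel j m).IsInteriorPoint (f r) ∧ Filter.map f (𝓝 r) = 𝓝 (f r) := by
    intro r hr hri
    have h1 := h.imm.inj r (mem_of_mem_nhds hr)
    rw [mfderivWithin_of_mem_nhds hr] at h1
    exact map_nhds_eq_of_isInteriorPoint (h.imm.smooth.contMDiffAt hr) h1
      (isInteriorPoint_iff.2 hri)
  have hopen : ∀ r, T ∈ 𝓝 r → r.2 ∈ (𝓡∂ m).interior M → f r ∉ J '' openSide j m M := by
    rintro r hr hri ⟨v, hv, hvr⟩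
    obtain ⟨V, hV, hVT⟩ := hJ.exists_nhds hv.1
    obtain ⟨h1, h2⟩ := hmap r hr hri
    have hn : J '' solid j M ∈ 𝓝 (f r) := by
      refine Filter.mem_of_superset (Filter.inter_mem (hvr ▸ hV) ?_) hVT
      rw [← h2]; exact Filter.image_mem_map hr
    have hi := ((graftData J (idLong j m M)).smoothImmOn_leftInv).inj (f r) (mem_of_mem_nhds hn)
    rw [mfderivWithin_of_mem_nhds hn] at hi
    have h3 := (map_nhds_eq_of_isInteriorPoint (J.contMDiffOn_inv.contMDiffAt hn) hi h1).1
    rw [← hvr, J.inv_apply (openSolid_subset_solid j M hv.1), isInteriorPoint_iff] at h3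
    exact notMem_boundary_of_mem_interior h3 hv.2
  rintro ⟨v, hv, hvp⟩
  have h1 : f '' (interior T ∩ Prod.snd ⁻¹' (𝓡∂ m).interior M) ∈ 𝓝 (J v) := by
    rw [hvp, ← (hmap p hp hi).2]
    refine Filter.image_mem_map (Filter.inter_mem (interior_mem_nhds.2 hp) ?_)
    exact continuous_snd.continuousAt
      (((𝓡∂ m).isOpen_interior (M := M) (n := ∞) (by simp)).mem_nhds hi)
  have h2 := J.continuousOn v hv.1 h1
  have h3 : J ⁻¹' (f '' (interior T ∩ Prod.snd ⁻¹' (𝓡∂ m).interior M)) ∈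
      𝓝[openSide j m M] v :=
    nhdsWithin_mono _ (fun p hp => openSolid_subset_solid j M hp.1) h2
  have : (𝓝[openSide j m M] v).NeBot :=
    mem_closure_iff_nhdsWithin_neBot.1 (side_subset_closure_openSide hv)
  obtain ⟨w, ⟨r, hr, hrw⟩, hw⟩ := Filter.nonempty_of_mem (Filter.inter_mem h3 self_mem_nhdsWithin)
  exact hopen r (mem_interior_iff_mem_nhds.1 hr.1) hr.2 ⟨w, hw, hrw.symm⟩

lemma LongEmb.disjoint_image_side {s : LongEmb j m M} {J : Puck j m M} (h : Below univ s J) :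
    Disjoint (s '' {p | p.2 ∈ (𝓡∂ m).interior M}) (J '' side j m M) := by
  rw [Set.disjoint_left]
  rintro _ ⟨p, hp, rfl⟩
  exact s.layer.notMem_image_side h Filter.univ_mem hp

lemma Puck.notMem_image_side {J J' : Puck j m M} (h : Below (solid j M) J J') {p : Amb j M}
    (hp : p ∈ openSolid j M) (hi : p.2 ∈ (𝓡∂ m).interior M) : J p ∉ J' '' side j m M :=
  J.layer.notMem_image_side h (Filter.mem_of_superset
    ((isOpen_openSolid j M).mem_nhds hp) (openSolid_subset_solid j M)) hi

end

/-- `disjointDiagrams` on the level of tuples. -/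
def IsDisjoint {n : ℕ} (S : Set M) (P : PreDiagram j m M n) : Prop :=
  (∀ i, Disjoint (P.long '' {p | p.2 ∈ S}) (P.puck i '' side j m M)) ∧
    ∀ i k, i ≠ k → Disjoint (P.puck i '' side j m M) (P.puck k '' side j m M)

variable [T2Space M] [CompactSpace M] [IsManifold (𝓡∂ m) ∞ M]
  {k : ℕ} {n : Fin k → ℕ} {P : PreDiagram j m M k} {Q : ∀ a, PreDiagram j m M (n a)}

/-- `x` is not on the sides of the pucks of height at least `c`. -/
def OffSides (P : PreDiagram j m M k) (c : ℕ) (x : Amb j M) : Prop :=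
  ∀ i : Fin k, c ≤ i → x ∉ P.puck (P.perm i) '' side j m M

lemma OffSides.step (i : Fin k) {x : Amb j M} (h : OffSides P i x) :
    OffSides P (i + 1) (graftAt P Q i x) := by
  intro i' hi'
  by_cases hx : x ∈ P.puck (P.perm i) '' openSolid j M
  · obtain ⟨w, hw, rfl⟩ := hx
    have hwi : w.2 ∈ (𝓡∂ m).interior M := (mem_interior_or_boundary w.2).resolve_right fun hb =>
      h i le_rfl ⟨w, ⟨openSolid_subset_solid j M hw, hb⟩, rfl⟩
    rw [graftAt, graft_apply _ _ (openSolid_subset_solid j M hw)]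
    exact Puck.notMem_image_side (P.below_perm hi') ((LongEmb.mem_openSolid_iff _).2 hw)
      ((Q (P.perm i)).long.map_nhds hwi).1
  · rw [graftAt, graft_of_notMem_openSolid _ _ hx]
    exact h i' ((Nat.le_succ _).trans hi')

/-- The point on which disjointness of the composite rests: if `Φ_h x` lies on a side of
`J_a L_{a,b}`, where `J_a` has height `h`, then `x` lies on a side of `J_a`. -/
lemma mem_side_of_graft {S : Set M} {a : Fin k} {b : Fin (n a)} (hQ : IsDisjoint S (Q a))
    {x : Amb j M} (hx : graft (P.puck a) (Q a).long x ∈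
      P.puck a '' ((Q a).puck b '' side j m M)) : ∃ v ∈ solid j M, v.2 ∉ S ∧ P.puck a v = x := by
  obtain ⟨u, ⟨q, hq, hqu⟩, hu⟩ := hx
  have huS : u ∈ solid j M := hqu ▸ ((Q a).puck b).mapsTo hq.1
  have h1 : x ∈ P.puck a '' solid j M := by
    rw [← graft_mem_image_solid_iff (P.puck a) (Q a).long, ← hu]; exact ⟨u, huS, rfl⟩
  obtain ⟨v, hv, rfl⟩ := h1
  rw [graft_apply _ _ hv] at hu
  have h2 := (P.puck a).injOn huS ((Q a).long.mapsTo_solid hv) hu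
  exact ⟨v, hv, fun hvS => Set.disjoint_left.1 (hQ.1 b) ⟨v, hvS, h2.symm⟩ ⟨q, hq, hqu⟩, rfl⟩

lemma composeFrom_eq_compPuck {a : Fin k} {b : Fin (n a)} {x q : Amb j M}
    (h : composeFrom (graftAt P Q) (P.perm⁻¹ a) x = compPuck P Q a b q) :
    graft (P.puck a) (Q a).long x = P.puck a ((Q a).puck b q) := by
  rw [composeFrom_eq_comp (graftAt P Q) (P.perm⁻¹ a), graftAt_inv] at h
  exact composeFrom_injective _ (graftAt_injective P Q) _ h

lemma IsDisjoint.compose {S : Set M} (hS : S = (𝓡∂ m).interior M ∨ S = univ)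
    (hP : S = univ ∨ IsDisjoint S P) (hQ : ∀ a, IsDisjoint S (Q a)) :
    IsDisjoint S (compose P Q) := by
  constructor
  · intro x
    rcases hS with rfl | rfl
    · exact LongEmb.disjoint_image_side ((Splicing.compose P Q).below_long x)
    · obtain ⟨⟨a, b⟩, rfl⟩ := finSigmaFinEquiv.surjective x
      rw [compose_puck, Set.disjoint_left]
      rintro _ ⟨p, -, rfl⟩ ⟨q, hq, hqp⟩
      change compPuck P Q a b q = composeFrom (graftAt P Q) 0 (P.long p) at hqp
      obtain ⟨f', -, hf'⟩ := composeFrom_split (graftAt P Q) (Y := Unit) (P := fun _ _ => True)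
        (fun _ _ _ => trivial) (Nat.zero_le _) (P.perm⁻¹ a).2.le (f := fun _ => P.long p) trivial
      have h1 := congrFun hf' ()
      simp only [Function.comp_apply] at h1
      rw [h1] at hqp
      obtain ⟨v, -, hv, -⟩ := mem_side_of_graft (P := P) (hQ a) (b := b) (x := f' ())
        ⟨_, ⟨q, hq, rfl⟩, (composeFrom_eq_compPuck hqp.symm).symm⟩
      exact hv (mem_univ _)
  · have key : ∀ {a a' : Fin k} (b : Fin (n a)) (b' : Fin (n a')), P.perm⁻¹ a < P.perm⁻¹ a' →
        Disjoint (compPuck P Q a b '' side j m M) (compPuck P Q a' b' '' side j m M) := by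
      intro a a' b b' hlt
      rw [Set.disjoint_left]
      rintro _ ⟨q, hq, rfl⟩ ⟨q', hq', hqq⟩
      have h0 : OffSides P (P.perm⁻¹ a + 1) (P.puck a ((Q a).puck b q)) ∨ S = univ := by
        rcases hP with h | hP
        · exact Or.inr h
        rcases hS with rfl | h
        · left
          intro i hi
          have hai : P.perm⁻¹ a < P.perm⁻¹ (P.perm i) := by simpa using hi
          rcases mem_interior_or_boundary (m := m) ((Q a).puck b q).2 with hint | hbd
          · refine Puck.notMem_image_side (P.below_puck hai) ?_ hint
            -- the long embedding is the identity at the ends, so its interior would meet the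
            -- side of the puck there
            by_contra hn
            exact Set.disjoint_left.1 ((hQ a).1 b) ⟨_, hint, (Q a).long.eq_of_notMem_openSolid hn⟩
              ⟨q, hq, rfl⟩
          · intro hmem
            refine Set.disjoint_left.1 (hP.2 a (P.perm i) ?_)
              ⟨_, ⟨((Q a).puck b).mapsTo hq.1, hbd⟩, rfl⟩ hmem
            rintro rfl; exact lt_irrefl _ hai
        · exact Or.inr h
      obtain ⟨f', hf, hf'⟩ := composeFrom_split (graftAt P Q) (Y := Unit)
        (P := fun c f => OffSides P c (f ()) ∨ S = univ)
        (fun i f hf => hf.imp_left (OffSides.step i)) (show (P.perm⁻¹ a : ℕ) + 1 ≤ _ from hlt)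
        (P.perm⁻¹ a').2.le (f := fun _ => P.puck a ((Q a).puck b q)) h0
      have h1 := congrFun hf' ()
      change compPuck P Q a b q = composeFrom (graftAt P Q) (P.perm⁻¹ a') (f' ()) at h1
      rw [← hqq] at h1
      obtain ⟨v, hvS, hv, hvx⟩ := mem_side_of_graft (P := P) (hQ a') (b := b') (x := f' ())
        ⟨_, ⟨q', hq', rfl⟩, (composeFrom_eq_compPuck h1.symm).symm⟩
      rcases hf with hf | rfl
      · have h2 := hf (P.perm⁻¹ a') le_rfl
        have e : P.perm (P.perm⁻¹ a') = a' := by simp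
        rw [e] at h2
        refine h2 ⟨v, ⟨hvS, (mem_interior_or_boundary v.2).resolve_left fun hi => ?_⟩, hvx⟩
        rcases hS with rfl | rfl
        · exact hv hi
        · exact hv (mem_univ _)
      · exact hv (mem_univ _)
    intro x x' hne
    obtain ⟨⟨a, b⟩, rfl⟩ := finSigmaFinEquiv.surjective x
    obtain ⟨⟨a', b'⟩, rfl⟩ := finSigmaFinEquiv.surjective x'
    rw [compose_puck, compose_puck]
    by_cases haa : a = a'
    · subst haa
      rw [Set.disjoint_left]
      rintro _ ⟨q, hq, rfl⟩ ⟨q', hq', hqq⟩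
      have h1 := (P.puck a).injOn (((Q a).puck b').mapsTo hq'.1) (((Q a).puck b).mapsTo hq.1)
        (composeFrom_injective _ (graftAt_injective P Q) _ hqq)
      refine Set.disjoint_left.1 ((hQ a).2 b' b ?_) ⟨q', hq', rfl⟩ ⟨q, hq, h1.symm⟩
      rintro rfl; exact hne rfl
    · rcases lt_or_gt_of_ne (fun h => haa (P.perm⁻¹.injective h) : P.perm⁻¹ a ≠ P.perm⁻¹ a')
        with h | h
      · exact key b b' h
      · exact (key b' b h).symm

lemma isSuboperad_disjointDiagrams {S : Set M} (hS : S = (𝓡∂ m).interior M ∨ S = univ) :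
    IsSuboperadWithoutIdentity (disjointDiagrams j m M S) := by
  constructor
  · intro n x hx σ
    obtain ⟨P, rfl⟩ : ∃ P, SC.mk P = x := Quotient.exists_rep x
    exact ⟨fun i => hx.1 (σ i), fun i k hik => hx.2 _ _ fun h => hik (σ.injective h)⟩
  · intro k n J L hJ hL
    obtain ⟨P, rfl⟩ : ∃ P, SC.mk P = J := Quotient.exists_rep J
    choose Q hQ using fun a => (Quotient.exists_rep (L a) : ∃ Q, SC.mk Q = L a)
    obtain rfl : (fun a => SC.mk (Q a)) = L := funext hQ
    exact ⟨SC.mk (Splicing.compose P Q), IsDisjoint.compose hS (Or.inr hJ) hL,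
      isComposite_mk_compose P Q⟩

lemma one_notMem_SCstrict (hM : ((𝓡∂ m).boundary M).Nonempty) :
    SC.one j m M ∉ SCstrict j m M 1 := by
  obtain ⟨x, hx⟩ := hM
  intro h
  have hp : ((0, x) : Amb j M) ∈ side j m M := ⟨fun i => by simp, hx⟩
  exact Set.disjoint_left.1 (h.1 0) ⟨(0, x), mem_univ _, rfl⟩ ⟨(0, x), hp, rfl⟩

end Suboperad

/-! ### Splicing on iterated tangent bundles -/

section TangentLift

open Filter in
lemma t2Space_tangentBundle {E : Type} [NormedAddCommGroup E] [NormedSpace ℝ E]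
    {H : Type} [TopologicalSpace H] (I : ModelWithCorners ℝ E H)
    (N : Type u) [TopologicalSpace N] [ChartedSpace H N] [IsManifold I 1 N] [T2Space N] :
    T2Space (TangentBundle I N) := by
  rw [t2_iff_ultrafilter]
  intro x y F hx hy
  have hp := FiberBundle.continuous_proj E (TangentSpace I : N → Type _)
  have h1 : x.proj = y.proj :=
    tendsto_nhds_unique ((hp.tendsto x).mono_left hx) ((hp.tendsto y).mono_left hy)
  set e := trivializationAt E (TangentSpace I : N → Type _) x.proj
  have hxe : x ∈ e.source := e.mem_source.2 (mem_baseSet_trivializationAt _ _ _)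
  have hye : y ∈ e.source := e.mem_source.2 (h1 ▸ mem_baseSet_trivializationAt _ _ _)
  have h2 := tendsto_nhds_unique ((e.continuousAt hxe).tendsto.mono_left hx)
    ((e.continuousAt hye).tendsto.mono_left hy)
  exact e.injOn hxe hye h2

variable {E : Type} [NormedAddCommGroup E] [NormedSpace ℝ E]
  {H : Type} [TopologicalSpace H] {I : ModelWithCorners ℝ E H}
  {N : Type u} [TopologicalSpace N] [ChartedSpace H N] [IsManifold I ∞ N]

/-- The part of the tangent bundle over `S`. -/
abbrev tanOver (I : ModelWithCorners ℝ E H) (S : Set N) : Set (TangentBundle I N) :=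
  (fun v : TangentBundle I N => v.proj) ⁻¹' S

lemma continuous_tangentBundle_proj :
    Continuous (fun v : TangentBundle I N => v.proj) :=
  FiberBundle.continuous_proj E (TangentSpace I : N → Type _)

lemma isOpenMap_tangentBundle_proj :
    IsOpenMap (fun v : TangentBundle I N => v.proj) :=
  FiberBundle.isOpenMap_proj E (TangentSpace I : N → Type _)

lemma uniqueMDiffOn_tanOver {S : Set N} (hS : UniqueMDiffOn I S) :
    UniqueMDiffOn I.tangent (tanOver I S) := hS.tangentBundle_proj_preimage

lemma contMDiffOn_tangentMapWithin' {S : Set N} {f : N → N} (hS : UniqueMDiffOn I S)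
    (hf : ContMDiffOn I I ∞ f S) :
    ContMDiffOn I.tangent I.tangent ∞ (tangentMapWithin I I f S) (tanOver I S) :=
  hf.contMDiffOn_tangentMapWithin (by simp) hS

lemma tangentMapWithin_congr' {S : Set N} {f g : N → N} (h : ∀ p ∈ S, f p = g p)
    {v : TangentBundle I N} (hv : v.proj ∈ S) :
    tangentMapWithin I I f S v = tangentMapWithin I I g S v :=
  tangentMapWithin_congr h v hv

lemma tangentMapWithin_congr_nhds {S : Set N} {f g : N → N} {v : TangentBundle I N}
    (hv : v.proj ∈ S) (h : f =ᶠ[𝓝[S] v.proj] g) :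
    tangentMapWithin I I f S v = tangentMapWithin I I g S v := by
  have h1 := h.self_of_nhdsWithin hv
  refine Bundle.TotalSpace.ext h1 ?_
  simp only [tangentMapWithin]
  rw [h.mfderivWithin_eq h1, h1]

/-- The tangent map within a relatively open subset. -/
lemma tangentMapWithin_of_mem_nhdsWithin {S U : Set N} {f : N → N} (hUS : U ⊆ S)
    {v : TangentBundle I N} (hU : U ∈ 𝓝[S] v.proj) (hv : v.proj ∈ S) (hS : UniqueMDiffOn I S)
    (hf : ContMDiffOn I I ∞ f S) :
    tangentMapWithin I I f U v = tangentMapWithin I I f S v := by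
  refine tangentMapWithin_subset hUS ?_ ((hf _ hv).mdifferentiableWithinAt (by simp))
  have := (hS v.proj hv).inter' hU
  rwa [inter_eq_right.2 hUS] at this

lemma tangentMapWithin_leftInv {S : Set N} {J K : N → N} (hS : UniqueMDiffOn I S)
    (hJ : ContMDiffOn I I ∞ J S) (hK : ContMDiffOn I I ∞ K (J '' S))
    (hKJ : ∀ q ∈ S, K (J q) = q) {w : TangentBundle I N} (hw : w.proj ∈ S) :
    tangentMapWithin I I K (J '' S) (tangentMapWithin I I J S w) = w := by
  rw [← tangentMapWithin_comp_at w
    ((hK _ (mem_image_of_mem J hw)).mdifferentiableWithinAt (by simp))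
    ((hJ _ hw).mdifferentiableWithinAt (by simp)) (fun q hq => ⟨q, hq, rfl⟩) (hS _ hw),
    tangentMapWithin_congr (f := K ∘ J) (f₁ := id) (fun q hq => hKJ q hq) w hw,
    tangentMapWithin_id (hS _ hw)]

/-- A smooth map with a smooth left inverse is an immersion. -/
lemma smoothImmOn_of_leftInv {S : Set N} {J K : N → N} (hS : UniqueMDiffOn I S)
    (hJ : ContMDiffOn I I ∞ J S) (hK : ContMDiffOn I I ∞ K (J '' S))
    (hKJ : ∀ q ∈ S, K (J q) = q) : SmoothImmOn I S J := by
  refine ⟨hJ, fun p hp v w hvw => ?_⟩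
  have h1 := tangentMapWithin_leftInv hS hJ hK hKJ (w := ⟨p, v⟩) hp
  have h2 := tangentMapWithin_leftInv hS hJ hK hKJ (w := ⟨p, w⟩) hp
  have h3 : tangentMapWithin I I J S ⟨p, v⟩ = tangentMapWithin I I J S ⟨p, w⟩ := by
    simp only [tangentMapWithin]; rw [hvw]
  rw [h3, h2] at h1
  exact (Bundle.TotalSpace.mk_injective p h1).symm

/-- Tangent vectors at points of `J(S)` are in the image of the tangent map. -/
lemma exists_tangentMapWithin_eq [FiniteDimensional ℝ E] {S : Set N} {J : N → N}
    (hJ : SmoothImmOn I S J) {q : N} (hq : q ∈ S) {v : TangentBundle I N} (hv : v.proj = J q) :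
    ∃ w : TangentBundle I N, w.proj = q ∧ tangentMapWithin I I J S w = v := by
  obtain ⟨p, v⟩ := v
  simp only at hv
  subst hv
  obtain ⟨e, he⟩ := hJ.isInvertible hq
  refine ⟨⟨q, e.symm v⟩, rfl, ?_⟩
  simp only [tangentMapWithin]
  rw [← he]
  congr 1
  exact e.apply_symm_apply v

lemma tanOver_image_eq [FiniteDimensional ℝ E] {S A : Set N} {J : N → N}
    (hJ : SmoothImmOn I S J) (hA : A ⊆ S) :
    tangentMapWithin I I J S '' tanOver I A = tanOver I (J '' A) := by
  ext v
  constructor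
  · rintro ⟨w, hw, rfl⟩
    exact ⟨w.proj, hw, rfl⟩
  · rintro ⟨q, hq, hqv⟩
    obtain ⟨w, hw, hwv⟩ := exists_tangentMapWithin_eq hJ (hA hq) hqv.symm
    exact ⟨w, by simpa [hw] using hq, hwv⟩

lemma tangentMap_eq_of_eqOn_isOpen {Z : Set N} (hZ : IsOpen Z) {s : N → N} (h : ∀ q ∈ Z, s q = q)
    {v : TangentBundle I N} (hv : v.proj ∈ Z) : tangentMap I I s v = v := by
  have h1 : s =ᶠ[𝓝[univ] v.proj] id := by
    rw [nhdsWithin_univ]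
    filter_upwards [hZ.mem_nhds hv] with q hq using h q hq
  rw [← tangentMapWithin_univ, tangentMapWithin_congr_nhds (mem_univ _) h1,
    tangentMapWithin_id (uniqueMDiffWithinAt_univ I)]

/-- The tangent maps of the maps in a `GraftData` form a `GraftData` on the tangent bundle. -/
lemma GraftData.tangent [FiniteDimensional ℝ E] {S O Z : Set N} {J K s : N → N}
    (D : GraftData I S O Z J K s) :
    GraftData I.tangent (tanOver I S) (tanOver I O) (tanOver I Z) (tangentMapWithin I I J S)
      (tangentMapWithin I I K (J '' S)) (tangentMap I I s) := by
  have hu := uniqueMDiffOn_tanOver D.uniqueS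
  have hJ := contMDiffOn_tangentMapWithin' D.uniqueS D.imm.smooth
  have hK : ContMDiffOn I.tangent I.tangent ∞ (tangentMapWithin I I K (J '' S))
      (tangentMapWithin I I J S '' tanOver I S) := by
    rw [tanOver_image_eq D.imm subset_rfl]
    exact contMDiffOn_tangentMapWithin' (D.imm.uniqueMDiffOn_image D.uniqueS) D.smoothK
  have hKJ : ∀ w ∈ tanOver I S, tangentMapWithin I I K (J '' S) (tangentMapWithin I I J S w) = w :=
    fun w hw => tangentMapWithin_leftInv D.uniqueS D.imm.smooth D.smoothK D.leftInv hw
  exact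
  { uniqueS := hu
    imm := smoothImmOn_of_leftInv hu hJ hK hKJ
    leftInv := hKJ
    smoothK := hK
    smooth_s := D.smooth_s.contMDiff_tangentMap (by simp)
    mapsTo_s := fun v hv => D.mapsTo_s hv
    openZ := D.openZ.preimage continuous_tangentBundle_proj
    idZ := fun v hv => tangentMap_eq_of_eqOn_isOpen D.openZ D.idZ hv
    dense := (preimage_mono D.dense).trans
      (isOpenMap_tangentBundle_proj.preimage_closure_subset_closure_preimage) }

/-- The map `h` is `f`, spliced with `s` along `J`; all maps are smooth. In place of an equation for
`h` there are the relations `rel` and `off`, in which the inverse of `J` does not occur: these pass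
to tangent maps. The condition `openU` is what remains of the continuity constraint. -/
structure SpliceData (I : ModelWithCorners ℝ E H) (T S O Z : Set N) (J K s f h : N → N) : Prop
    extends GraftData I S O Z J K s where
  subset : O ⊆ S
  closed : IsClosed (J '' S)
  uniqueT : UniqueMDiffOn I T
  smooth_f : ContMDiffOn I I ∞ f T
  smooth_h : ContMDiffOn I I ∞ h T
  rel : ∀ p ∈ T, ∀ q ∈ S, f p = J q → h p = J (s q)
  off : ∀ p ∈ T, f p ∉ J '' O → h p = f p
  openU : ∀ p ∈ T, f p ∈ J '' O → f ⁻¹' (J '' O) ∈ 𝓝[T] p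

/-- Splicing is compatible with passage to the tangent bundle. Off the image of the interior of
`J` this holds by continuity: such points are either limits of points that `f` maps there, or
`h = f` in a neighbourhood. -/
lemma SpliceData.tangent [FiniteDimensional ℝ E] [T2Space N] {T S O Z : Set N}
    {J K s f h : N → N} (D : SpliceData I T S O Z J K s f h) :
    SpliceData I.tangent (tanOver I T) (tanOver I S) (tanOver I O) (tanOver I Z)
      (tangentMapWithin I I J S)
      (tangentMapWithin I I K (J '' S)) (tangentMap I I s) (tangentMapWithin I I f T)
      (tangentMapWithin I I h T) := by
  have : T2Space (TangentBundle I N) := t2Space_tangentBundle I N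
  have D' := D.toGraftData.tangent
  have hJO := tanOver_image_eq D.imm D.subset
  have hJS := tanOver_image_eq D.imm (subset_refl S)
  have hf' := contMDiffOn_tangentMapWithin' D.uniqueT D.smooth_f
  have hh' := contMDiffOn_tangentMapWithin' D.uniqueT D.smooth_h
  set U := T ∩ f ⁻¹' (J '' O) with hU
  have hUn : ∀ p ∈ U, U ∈ 𝓝[T] p := fun p hp =>
    Filter.inter_mem self_mem_nhdsWithin (D.openU p hp.1 hp.2)
  have hUu : UniqueMDiffOn I U := fun p hp => by
    have := (D.uniqueT p hp.1).inter' (hUn p hp)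
    rwa [inter_eq_right.2 inter_subset_left] at this
  -- the relation between `f`, `h` and `J` over the interior of `J`
  have hrel : ∀ v ∈ tanOver I T, ∀ w ∈ tanOver I O,
      tangentMapWithin I I f T v = tangentMapWithin I I J S w →
      tangentMapWithin I I h T v = tangentMapWithin I I J S (tangentMap I I s w) := by
    intro v hv w hw hvw
    have hproj : f v.proj = J w.proj := congrArg Bundle.TotalSpace.proj hvw
    have hvU : v.proj ∈ U := ⟨hv, w.proj, hw, hproj.symm⟩
    have hmaps : MapsTo f U (J '' S) := fun p hp => image_mono D.subset hp.2
    have e1 := tangentMapWithin_of_mem_nhdsWithin inter_subset_left (hUn _ hvU) hv D.uniqueT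
      D.smooth_f
    have e2 := tangentMapWithin_of_mem_nhdsWithin inter_subset_left (hUn _ hvU) hv D.uniqueT
      D.smooth_h
    have hh : ∀ p ∈ U, h p = ((J ∘ s ∘ K) ∘ f) p := by
      rintro p ⟨hp, q, hq, hqp⟩
      rw [D.rel p hp q (D.subset hq) hqp.symm]
      simp [← hqp, D.leftInv q (D.subset hq)]
    have hsm : ContMDiffOn I I ∞ (J ∘ s ∘ K) (J '' S) := D.smoothGraft
    have hfv : f v.proj ∈ J '' S := hmaps hvU
    have hKv : K (f v.proj) = w.proj := by rw [hproj, D.leftInv _ (D.subset hw)]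
    have huJ := D.imm.uniqueMDiffOn_image D.uniqueS
    rw [← e2, tangentMapWithin_congr' hh hvU, tangentMapWithin_comp_at v
      ((hsm _ hfv).mdifferentiableWithinAt (by simp))
      (((D.smooth_f.mono inter_subset_left) _ hvU).mdifferentiableWithinAt (by simp)) hmaps
      (hUu _ hvU), e1, hvw]
    have hq : w.proj ∈ S := D.subset hw
    have hJw : (tangentMapWithin I I J S w).proj = J w.proj := rfl
    have m1 : MapsTo K (J '' S) S := by rintro _ ⟨q, hq, rfl⟩; rwa [D.leftInv q hq]
    have hKw : K (J w.proj) = w.proj := D.leftInv _ hq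
    have hsK : MDifferentiableWithinAt I I (s ∘ K) (J '' S) (J w.proj) :=
      ((D.smooth_s.contMDiffOn (s := univ)).comp D.smoothK (fun _ _ => mem_univ _) _
        (mem_image_of_mem J hq)).mdifferentiableWithinAt (by simp)
    rw [tangentMapWithin_comp_at (g := J) (f := s ∘ K) (u := S) _ ?_ hsK
      (fun p hp => D.mapsTo_s (m1 hp)) (huJ _ (mem_image_of_mem J hq)),
      tangentMapWithin_comp_at (g := s) (f := K) (u := univ) _ ?_
      ((D.smoothK _ (mem_image_of_mem J hq)).mdifferentiableWithinAt (by simp))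
      (fun p _ => mem_univ _) (huJ _ (mem_image_of_mem J hq)),
      tangentMapWithin_leftInv D.uniqueS D.imm.smooth D.smoothK D.leftInv hq,
      tangentMapWithin_univ]
    · exact (D.smooth_s.mdifferentiable (by simp) _).mdifferentiableWithinAt
    · refine (D.imm.smooth _ ?_).mdifferentiableWithinAt (by simp)
      exact D.mapsTo_s (m1 (mem_image_of_mem J hq))
  have hoff : ∀ v ∈ tanOver I T,
      tangentMapWithin I I f T v ∉ tangentMapWithin I I J S '' tanOver I O →
      tangentMapWithin I I h T v = tangentMapWithin I I f T v := by
    intro v hv hvO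
    by_cases hcl : v ∈ closure (tanOver I U)
    · have hne : (𝓝[tanOver I U] v).NeBot := mem_closure_iff_nhdsWithin_neBot.1 hcl
      have hUT : tanOver I U ⊆ tanOver I T := fun _ h => h.1
      have hfc := (hf'.continuousOn v hv).mono hUT
      have hhc := (hh'.continuousOn v hv).mono hUT
      have hfS : MapsTo (tangentMapWithin I I f T) (tanOver I U)
          (tangentMapWithin I I J S '' tanOver I S) := by
        intro r hr
        rw [hJS]; exact image_mono D.subset hr.2
      have hclS : IsClosed (tangentMapWithin I I J S '' tanOver I S) := by
        rw [hJS]; exact D.closed.preimage continuous_tangentBundle_proj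
      have hfv : tangentMapWithin I I f T v ∈ tangentMapWithin I I J S '' tanOver I S :=
        hclS.closure_subset (closure_mono hfS.image_subset (hfc.mem_closure_image hcl))
      have hlim := (D'.smoothGraft.continuousOn _ hfv).comp hfc hfS
      have heq : ∀ r ∈ tanOver I U, (tangentMapWithin I I J S ∘ tangentMap I I s ∘
          tangentMapWithin I I K (J '' S)) (tangentMapWithin I I f T r) =
          tangentMapWithin I I h T r := by
        intro r hr
        have h1 : tangentMapWithin I I f T r ∈ tangentMapWithin I I J S '' tanOver I O := by
          rw [hJO]; exact hr.2
        obtain ⟨w, hw, hwr⟩ := h1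
        rw [hrel r hr.1 w hw hwr.symm, ← hwr]
        simp only [Function.comp_apply]
        rw [D'.leftInv w (D.subset hw)]
      have h2 := tendsto_nhds_unique (hlim.tendsto.congr' ?_) hhc.tendsto
      · obtain ⟨w, hw, hwv⟩ := hfv
        rw [← h2, Function.comp_apply, ← hwv, Function.comp_apply, Function.comp_apply,
          D'.leftInv w hw, D'.s_eq hw]
        exact fun hwO => hvO ⟨w, hwO, hwv⟩
      · filter_upwards [self_mem_nhdsWithin] with r hr using heq r hr
    · have h1 : v.proj ∉ closure U := fun h =>
        hcl (isOpenMap_tangentBundle_proj.preimage_closure_subset_closure_preimage h)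
      refine tangentMapWithin_congr_nhds hv ?_
      filter_upwards [mem_nhdsWithin_of_mem_nhds (isClosed_closure.isOpen_compl.mem_nhds h1),
        self_mem_nhdsWithin] with r hr hrT
      exact D.off r hrT fun h => hr (subset_closure ⟨hrT, h⟩)
  refine { D' with
    subset := preimage_mono D.subset
    closed := by rw [hJS]; exact D.closed.preimage continuous_tangentBundle_proj
    uniqueT := uniqueMDiffOn_tanOver D.uniqueT
    smooth_f := hf'
    smooth_h := hh'
    rel := ?_
    off := hoff
    openU := ?_ }
  · intro v hv w hw hvw
    by_cases hwO : w ∈ tanOver I O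
    · exact hrel v hv w hwO hvw
    · rw [D'.s_eq hw hwO, ← hvw]
      refine hoff v hv ?_
      rw [hvw]
      rintro ⟨w', hw', hww⟩
      have := congrArg (tangentMapWithin I I K (J '' S)) hww
      rw [D'.leftInv w' (D.subset hw'), D'.leftInv w hw] at this
      exact hwO (this ▸ hw')
  · intro v hv hvO
    rw [hJO] at hvO ⊢
    have h1 := D.openU v.proj hv hvO
    exact (continuous_tangentBundle_proj.continuousWithinAt.tendsto_nhdsWithin
      (fun _ h => h)) h1

end TangentLift

/-! ### Continuous families and the `C^∞` topology -/

section Families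

/-- The family `f` of maps `N → N` is continuous on `S` together with its `k`-fold iterated
tangent maps, jointly in the parameter and the tangent vector. -/
def JointCk {X : Type u} [TopologicalSpace X] : ℕ → ∀ (E : Type) [NormedAddCommGroup E]
    [NormedSpace ℝ E] (H : Type) [TopologicalSpace H] (I : ModelWithCorners ℝ E H)
    (N : Type u) [TopologicalSpace N] [ChartedSpace H N] [IsManifold I ∞ N] (_S : Set N)
    (_f : X → N → N), Prop
  | 0, _, _, _, _, _, _, N, _, _, _, S, f =>
      ContinuousOn (fun z : X × N => f z.1 z.2) (univ ×ˢ S)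
  | k + 1, E, _, _, H, _, I, N, _, _, _, S, f =>
      JointCk k (E × E) (ModelProd H E) I.tangent (TangentBundle I N) (tanOver I S)
        (fun x => tangentMapWithin I I (f x) S)

/-- The family `f` is jointly continuous on `S` together with all its iterated tangent maps. -/
def JointCInfty {X : Type u} [TopologicalSpace X] {E : Type} [NormedAddCommGroup E]
    [NormedSpace ℝ E] {H : Type} [TopologicalSpace H] (I : ModelWithCorners ℝ E H)
    {N : Type u} [TopologicalSpace N] [ChartedSpace H N] [IsManifold I ∞ N] (S : Set N)
    (f : X → N → N) : Prop :=
  ∀ k, JointCk k E H I N S f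

section Basic

variable {X : Type u} [TopologicalSpace X]

lemma JointCk.congr : ∀ (k : ℕ) {E : Type}
    [NormedAddCommGroup E] [NormedSpace ℝ E] {H : Type} [TopologicalSpace H]
    {I : ModelWithCorners ℝ E H} {N : Type u} [TopologicalSpace N] [ChartedSpace H N]
    [IsManifold I ∞ N] {S : Set N} {f g : X → N → N}, JointCk k E H I N S f →
    (∀ x, EqOn (g x) (f x) S) → JointCk k E H I N S g
  | 0, _, _, _, _, _, _, _, _, _, _, _, _, _ => fun h hfg =>
      ContinuousOn.congr h fun z hz => hfg z.1 hz.2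
  | k + 1, _, _, _, _, _, _, _, _, _, _, _, _, _ => fun h hfg =>
      JointCk.congr k h fun x _ hv => tangentMapWithin_congr' (fun _ hp => hfg x hp) hv

/-- Composites of families of smooth maps. -/
lemma JointCk.comp : ∀ (k : ℕ) {E : Type}
    [NormedAddCommGroup E] [NormedSpace ℝ E] {H : Type} [TopologicalSpace H]
    {I : ModelWithCorners ℝ E H} {N : Type u} [TopologicalSpace N] [ChartedSpace H N]
    [IsManifold I ∞ N] {S T : Set N} {f g : X → N → N}, JointCk k E H I N S g →
    JointCk k E H I N T f → UniqueMDiffOn I S → UniqueMDiffOn I T →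
    (∀ x, ContMDiffOn I I ∞ (g x) S) → (∀ x, ContMDiffOn I I ∞ (f x) T) →
    (∀ x, MapsTo (f x) T S) → JointCk k E H I N T (fun x => g x ∘ f x)
  | 0, _, _, _, _, _, _, N, _, _, _, S, T, f, g => fun hg hf _ _ _ _ hfm =>
      ContinuousOn.comp (g := fun z : X × N => g z.1 z.2) (f := fun z : X × N => (z.1, f z.1 z.2))
        hg (continuous_fst.continuousOn.prodMk hf) (fun z hz => ⟨mem_univ _, hfm z.1 hz.2⟩)
  | k + 1, _, _, _, _, _, _, _, _, _, _, S, T, f, g => fun hg hf hS hT hgs hfs hfm => by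
      refine JointCk.congr k (JointCk.comp k hg hf (uniqueMDiffOn_tanOver hS)
        (uniqueMDiffOn_tanOver hT) (fun x => contMDiffOn_tangentMapWithin' hS (hgs x))
        (fun x => contMDiffOn_tangentMapWithin' hT (hfs x)) (fun x v hv => hfm x hv))
        fun x v hv => ?_
      exact tangentMapWithin_comp_at v (((hgs x) _ (hfm x hv)).mdifferentiableWithinAt (by simp))
        (((hfs x) _ hv).mdifferentiableWithinAt (by simp)) (hfm x) (hT _ hv)

/-- Joint continuity of iterated tangent maps implies continuity in the `C^k` topology. -/
lemma JointCk.continuous : ∀ (k : ℕ) {E : Type}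
    [NormedAddCommGroup E] [NormedSpace ℝ E] {H : Type} [TopologicalSpace H]
    {I : ModelWithCorners ℝ E H} {N : Type u} [TopologicalSpace N] [ChartedSpace H N]
    [IsManifold I ∞ N] {S : Set N} {f : X → N → N}, JointCk k E H I N S f →
    @Continuous _ _ _ (ckTopology k E H I N S) f
  | 0, _, _, _, _, _, _, N, _, _, _, S, f => fun h => by
      rw [ckTopology, continuous_generateFrom_iff]
      rintro _ ⟨K, U, hK, hKS, hU, rfl⟩
      rw [isOpen_iff_mem_nhds]
      intro x hx
      have h1 : ∀ᶠ y in 𝓝 x, ∀ p ∈ K, p ∈ S → f y p ∈ U := by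
        refine hK.eventually_forall_of_forall_eventually fun p hp => ?_
        have h2 := h (x, p) ⟨mem_univ _, hKS hp⟩ (hU.mem_nhds (hx hp))
        have h3 := mem_nhdsWithin_iff_eventually.1 h2
        filter_upwards [h3] with z hz hzS using hz ⟨mem_univ _, hzS⟩
      filter_upwards [h1] with y hy p hp using hy p hp (hKS hp)
  | k + 1, _, _, _, _, _, _, _, _, _, _, S, f => fun h =>
      continuous_induced_rng.2 (JointCk.continuous k h)

/-- A family of smooth maps that is continuous in the `C^k` topology has jointly continuous
iterated tangent maps. -/
lemma jointCk_of_continuous : ∀ (k : ℕ) {E : Type}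
    [NormedAddCommGroup E] [NormedSpace ℝ E] [FiniteDimensional ℝ E] {H : Type}
    [TopologicalSpace H] {I : ModelWithCorners ℝ E H} {N : Type u} [TopologicalSpace N] [T2Space N]
    [ChartedSpace H N] [IsManifold I ∞ N] {S : Set N} {f : X → N → N}, IsClosed S →
    UniqueMDiffOn I S → (∀ x, ContMDiffOn I I ∞ (f x) S) →
    @Continuous _ _ _ (ckTopology k E H I N S) f → JointCk k E H I N S f
  | 0, E, _, _, _, H, _, I, N, _, _, _, _, S, f => fun hS _ hf h => by
      have : LocallyCompactSpace N := Manifold.locallyCompact_of_finiteDimensional I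
      rintro ⟨x, p⟩ ⟨-, hp⟩
      refine Filter.tendsto_def.2 fun U hU => ?_
      obtain ⟨V, hVU, hV, hxV⟩ := mem_nhds_iff.1 hU
      have h1 : f x ⁻¹' V ∈ 𝓝[S] p := (hf x).continuousOn p hp (hV.mem_nhds hxV)
      obtain ⟨W, hW, hWV⟩ := mem_nhdsWithin_iff_exists_mem_nhds_inter.1 h1
      obtain ⟨K, hK, hKW, hKc⟩ := LocallyCompactSpace.local_compact_nhds p W hW
      have h2 : {y | MapsTo (f y) (K ∩ S) V} ∈ 𝓝 x := by
        have h3 : IsOpen (f ⁻¹' {g : N → N | MapsTo g (K ∩ S) V}) := by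
          refine @IsOpen.preimage _ _ _ (ckTopology 0 E H I N S) f h _ ?_
          exact TopologicalSpace.isOpen_generateFrom_of_mem
            ⟨K ∩ S, V, hKc.inter_right hS, inter_subset_right, hV, rfl⟩
        exact h3.mem_nhds fun q hq => hWV ⟨hKW hq.1, hq.2⟩
      rw [mem_nhdsWithin_iff_exists_mem_nhds_inter]
      refine ⟨_, prod_mem_nhds h2 hK, ?_⟩
      rintro ⟨y, q⟩ ⟨⟨hy, hq⟩, -, hqS⟩
      exact hVU (hy ⟨hq, hqS⟩)
  | k + 1, _, _, _, _, _, _, I, N, _, _, _, _, S, f => fun hS hu hf h => by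
      have : T2Space (TangentBundle I N) := t2Space_tangentBundle I N
      exact jointCk_of_continuous k (hS.preimage continuous_tangentBundle_proj)
        (uniqueMDiffOn_tanOver hu) (fun x => contMDiffOn_tangentMapWithin' hu (hf x))
        (continuous_induced_rng.1 h)

lemma JointCInfty.continuous {E : Type}
    [NormedAddCommGroup E] [NormedSpace ℝ E] {H : Type} [TopologicalSpace H]
    {I : ModelWithCorners ℝ E H} {N : Type u} [TopologicalSpace N] [ChartedSpace H N]
    [IsManifold I ∞ N] {S : Set N} {f : X → N → N} (h : JointCInfty I S f) :
    @Continuous _ _ _ (cInftyTopology I S) f :=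
  continuous_iInf_rng.2 fun k => (h k).continuous

lemma jointCInfty_of_continuous {E : Type}
    [NormedAddCommGroup E] [NormedSpace ℝ E] [FiniteDimensional ℝ E] {H : Type}
    [TopologicalSpace H] {I : ModelWithCorners ℝ E H} {N : Type u} [TopologicalSpace N] [T2Space N]
    [ChartedSpace H N] [IsManifold I ∞ N] {S : Set N} {f : X → N → N} (hS : IsClosed S)
    (hu : UniqueMDiffOn I S) (hf : ∀ x, ContMDiffOn I I ∞ (f x) S)
    (h : @Continuous _ _ _ (cInftyTopology I S) f) : JointCInfty I S f :=
  fun k => jointCk_of_continuous k hS hu hf (continuous_iInf_rng.1 h k)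

end Basic

/-! ### Families that depend smoothly on a real parameter -/

section SmoothFamily

variable {E : Type} [NormedAddCommGroup E] [NormedSpace ℝ E]
  {H : Type} [TopologicalSpace H] {I : ModelWithCorners ℝ E H}
  {N : Type u} [TopologicalSpace N] [ChartedSpace H N] [IsManifold I ∞ N]

/-- The tangent maps of a smooth family are a smooth family. -/
lemma contMDiff_tangentMap_family {F : ℝ × N → N}
    (hF : ContMDiff (𝓘(ℝ, ℝ).prod I) I ∞ F) :
    ContMDiff (𝓘(ℝ, ℝ).prod I.tangent) I.tangent ∞
      (fun z : ℝ × TangentBundle I N => tangentMap I I (fun p => F (z.1, p)) z.2) := by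
  have h1 : ContMDiff (𝓘(ℝ, ℝ).prod I).tangent I.tangent ∞ (tangentMap (𝓘(ℝ, ℝ).prod I) I F) :=
    hF.contMDiff_tangentMap (by simp)
  have h2 : ContMDiff 𝓘(ℝ, ℝ) 𝓘(ℝ, ℝ).tangent ∞
      (fun t : ℝ => (⟨t, 0⟩ : TangentBundle 𝓘(ℝ, ℝ) ℝ)) :=
    Bundle.contMDiff_zeroSection ℝ (TangentSpace 𝓘(ℝ, ℝ) : ℝ → Type _)
  have h3 : ContMDiff (𝓘(ℝ, ℝ).prod I.tangent) (𝓘(ℝ, ℝ).prod I).tangent ∞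
      (fun z : ℝ × TangentBundle I N => (equivTangentBundleProd 𝓘(ℝ, ℝ) ℝ I N).symm
        ((⟨z.1, 0⟩ : TangentBundle 𝓘(ℝ, ℝ) ℝ), z.2)) :=
    contMDiff_equivTangentBundleProd_symm.comp
      ((h2.comp contMDiff_fst).prodMk contMDiff_snd)
  have h4 := h1.comp h3
  convert h4 using 1
  funext ⟨t, ⟨p, v⟩⟩
  have hd : MDifferentiableAt (𝓘(ℝ, ℝ).prod I) I F (t, p) := hF.mdifferentiable (by simp) _
  refine Bundle.TotalSpace.ext rfl (heq_of_eq ?_)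
  simp only [tangentMap, Function.comp_apply, equivTangentBundleProd]
  change mfderiv I I (fun p => F (t, p)) p v = mfderiv (𝓘(ℝ, ℝ).prod I) I F (t, p) (0, v)
  have h5 : HasMFDerivAt I (𝓘(ℝ, ℝ).prod I) (fun q : N => (t, q)) p
      (ContinuousLinearMap.inr ℝ ℝ E) := by
    exact (hasMFDerivAt_const (I := I) (I' := 𝓘(ℝ, ℝ)) t p).prodMk (hasMFDerivAt_id (I := I) p)
  have h6 := (hd.hasMFDerivAt.comp p h5).mfderiv
  have h7 : mfderiv I I (fun p => F (t, p)) p = mfderiv I I (F ∘ fun q => (t, q)) p := rfl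
  rw [h7, h6]; rfl

/-- Smooth families have jointly continuous iterated tangent maps. -/
lemma jointCk_of_contMDiff {X : Type u} [TopologicalSpace X] {τ : X → ℝ} (hτ : Continuous τ) :
    ∀ (k : ℕ) {E : Type} [NormedAddCommGroup E] [NormedSpace ℝ E]
    {H : Type} [TopologicalSpace H] {I : ModelWithCorners ℝ E H}
    {N : Type u} [TopologicalSpace N] [ChartedSpace H N] [IsManifold I ∞ N] {S : Set N}
    {F : ℝ × N → N} {f : X → N → N}, ContMDiff (𝓘(ℝ, ℝ).prod I) I ∞ F → UniqueMDiffOn I S →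
    (∀ x, EqOn (f x) (fun p => F (τ x, p)) S) → JointCk k E H I N S f
  | 0, _, _, _, _, _, _, _, _, _, _, _, _, _ => fun hF _ hf => by
      refine ContinuousOn.congr (f := fun z => _) ?_ fun z hz => hf z.1 hz.2
      exact (hF.continuous.comp (by fun_prop : Continuous fun z : X × _ =>
        (τ z.1, z.2))).continuousOn
  | k + 1, _, _, _, _, _, _, _, _, _, _, S, F, f => fun hF hS hf => by
      refine jointCk_of_contMDiff hτ k (contMDiff_tangentMap_family hF) (uniqueMDiffOn_tanOver hS)
        fun x v hv => ?_
      rw [tangentMapWithin_congr' (hf x) hv]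
      refine tangentMapWithin_eq_tangentMap (hS _ hv) ?_
      exact (hF.mdifferentiable (by simp) _).comp _
        ((mdifferentiableAt_const).prodMk mdifferentiableAt_id)

end SmoothFamily

end Families

/-! ### Splicing in families -/

section SpliceFamilies

open Filter

variable {X : Type u} [TopologicalSpace X]
  {E : Type} [NormedAddCommGroup E] [NormedSpace ℝ E]
  {H : Type} [TopologicalSpace H] {I : ModelWithCorners ℝ E H}
  {N : Type u} [TopologicalSpace N] [ChartedSpace H N] [IsManifold I ∞ N]

/-- A family of splicings. The map `(x, q) ↦ (x, J_x q)` on `X × S` is proper, and the set of all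
`(x, p)` such that `f_x` maps `p` into `J_x(O)` is open in `X × T`. -/
structure SpliceFamily (I : ModelWithCorners ℝ E H) (T S O Z : Set N) (J K s f h : X → N → N) :
    Prop where
  data : ∀ x, SpliceData I T S O Z (J x) (K x) (s x) (f x) (h x)
  proper : ∀ (G : Ultrafilter (X × N)) (x : X) (y : N), (∀ᶠ z in (G : Filter (X × N)), z.2 ∈ S) →
    Tendsto Prod.fst (G : Filter (X × N)) (𝓝 x) →
    Tendsto (fun z : X × N => J z.1 z.2) G (𝓝 y) →
    ∃ q ∈ S, Tendsto Prod.snd (G : Filter (X × N)) (𝓝 q)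
  openU : ∀ x, ∀ p ∈ T, f x p ∈ J x '' O →
    ∀ᶠ z : X × N in 𝓝[univ ×ˢ T] (x, p), f z.1 z.2 ∈ J z.1 '' O

variable {T S O Z : Set N} {J K s f h : X → N → N}

/-- The spliced family is continuous. -/
lemma SpliceFamily.continuousOn [T2Space N] (D : SpliceFamily I T S O Z J K s f h)
    (hf : ContinuousOn (fun z : X × N => f z.1 z.2) (univ ×ˢ T))
    (hJ : ContinuousOn (fun z : X × N => J z.1 z.2) (univ ×ˢ S))
    (hs : ContinuousOn (fun z : X × N => s z.1 z.2) (univ ×ˢ univ)) :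
    ContinuousOn (fun z : X × N => h z.1 z.2) (univ ×ˢ T) := by
  rintro ⟨x, p⟩ ⟨-, hp⟩
  rw [ContinuousWithinAt, tendsto_iff_ultrafilter]
  intro G hG
  have hGT : ∀ᶠ z : X × N in G, z.2 ∈ T := by
    have : ∀ᶠ z : X × N in 𝓝[univ ×ˢ T] (x, p), z ∈ univ ×ˢ T := self_mem_nhdsWithin
    exact (this.filter_mono hG).mono fun z hz => hz.2
  have hG' : (G : Filter (X × N)) ≤ 𝓝 (x, p) := hG.trans nhdsWithin_le_nhds
  have hGx : Tendsto Prod.fst (G : Filter (X × N)) (𝓝 x) :=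
    (continuous_fst.tendsto (x, p)).mono_left hG'
  have hGf : Tendsto (fun z : X × N => f z.1 z.2) G (𝓝 (f x p)) :=
    (hf (x, p) ⟨mem_univ _, hp⟩).mono_left hG
  by_cases hU : ∀ᶠ z : X × N in G, f z.1 z.2 ∈ J z.1 '' O
  · -- write `f_x p = J_x q`; the points `q` converge by properness
    have : Nonempty N := ⟨p⟩
    choose! q hqO hqf using fun (z : X × N) (hz : f z.1 z.2 ∈ J z.1 '' O) => hz
    have hqS : ∀ᶠ z : X × N in G, q z ∈ S := hU.mono fun z hz => (D.data z.1).subset (hqO z hz)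
    have hGJ : Tendsto (fun z : X × N => J z.1 (q z)) G (𝓝 (f x p)) :=
      hGf.congr' (hU.mono fun z hz => (hqf z hz).symm)
    obtain ⟨q₀, hq₀, hlim⟩ := D.proper (G.map fun z : X × N => (z.1, q z)) x (f x p)
      (by simpa using hqS) (tendsto_map'_iff.2 hGx) (tendsto_map'_iff.2 hGJ)
    have hlim : Tendsto q G (𝓝 q₀) := tendsto_map'_iff.1 hlim
    have hJlim : ∀ r : X × N → N, ∀ r₀ ∈ S, Tendsto r G (𝓝 r₀) → (∀ᶠ z in G, r z ∈ S) →
        Tendsto (fun z : X × N => J z.1 (r z)) G (𝓝 (J x r₀)) := by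
      intro r r₀ hr₀ hr hrS
      refine (hJ (x, r₀) ⟨mem_univ _, hr₀⟩).tendsto.comp (f := fun z : X × N => (z.1, r z))
        (tendsto_nhdsWithin_iff.2 ⟨hGx.prodMk_nhds hr, hrS.mono fun z hz => ⟨mem_univ _, hz⟩⟩)
    have hJq : J x q₀ = f x p := tendsto_nhds_unique (hJlim q q₀ hq₀ hlim hqS) hGJ
    have hslim : Tendsto (fun z : X × N => s z.1 (q z)) G (𝓝 (s x q₀)) := by
      rw [univ_prod_univ, continuousOn_univ] at hs
      exact (hs.tendsto (x, q₀)).comp (f := fun z : X × N => (z.1, q z)) (hGx.prodMk_nhds hlim)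
    have h1 := hJlim (fun z => s z.1 (q z)) _ ((D.data x).mapsTo_s hq₀) hslim
      (hqS.mono fun z hz => (D.data z.1).mapsTo_s hz)
    have h2 : h x p = J x (s x q₀) := (D.data x).rel p hp q₀ hq₀ hJq.symm
    simp only [h2]
    refine h1.congr' ?_
    filter_upwards [hU, hqS, hGT] with z hz hzS hzT
    exact ((D.data z.1).rel z.2 hzT _ hzS (hqf z hz).symm).symm
  · have hU' : ∀ᶠ z : X × N in G, f z.1 z.2 ∉ J z.1 '' O := Ultrafilter.eventually_not.2 hU
    have h1 : f x p ∉ J x '' O := fun hxp => by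
      obtain ⟨z, hz⟩ := (((D.openU x p hp hxp).filter_mono hG).and hU').exists
      exact hz.2 hz.1
    simp only [(D.data x).off p hp h1]
    refine hGf.congr' ?_
    filter_upwards [hU', hGT] with z hz hzT
    exact ((D.data z.1).off z.2 hzT hz).symm

/-- Properness of the family of tangent maps of `J`: as the derivatives are injective, a family of
vectors with convergent images cannot be unbounded. -/
lemma SpliceFamily.proper_tangent [FiniteDimensional ℝ E] [T2Space N]
    (D : SpliceFamily I T S O Z J K s f h)
    (hJ : ContinuousOn (fun z : X × TangentBundle I N => tangentMapWithin I I (J z.1) S z.2)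
      (univ ×ˢ tanOver I S)) (G : Ultrafilter (X × TangentBundle I N)) (x : X)
    (y : TangentBundle I N)
    (hGS : ∀ᶠ z in (G : Filter (X × TangentBundle I N)), z.2 ∈ tanOver I S)
    (hGx : Tendsto Prod.fst (G : Filter (X × TangentBundle I N)) (𝓝 x))
    (hGy : Tendsto (fun z : X × TangentBundle I N => tangentMapWithin I I (J z.1) S z.2) G (𝓝 y)) :
    ∃ w ∈ tanOver I S, Tendsto Prod.snd (G : Filter (X × TangentBundle I N)) (𝓝 w) := by
  have : ProperSpace E := FiniteDimensional.proper_real E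
  have : T2Space (TangentBundle I N) := t2Space_tangentBundle I N
  have hπ : Continuous (fun v : TangentBundle I N => v.proj) := continuous_tangentBundle_proj
  obtain ⟨q, hq, hGq⟩ := D.proper (G.map fun z : X × TangentBundle I N => (z.1, z.2.proj)) x y.proj
    (by simpa using hGS) (tendsto_map'_iff.2 hGx) (tendsto_map'_iff.2 ((hπ.tendsto y).comp hGy))
  have hGq : Tendsto (fun z : X × TangentBundle I N => z.2.proj) G (𝓝 q) :=
    tendsto_map'_iff.1 hGq
  set e := trivializationAt E (TangentSpace I : N → Type _) q
  have hqe : q ∈ e.baseSet := mem_baseSet_trivializationAt _ _ _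
  have hGe : ∀ᶠ z : X × TangentBundle I N in G, z.2.proj ∈ e.baseSet :=
    hGq (e.open_baseSet.mem_nhds hqe)
  set a : X × TangentBundle I N → E := fun z => (e z.2).2
  -- convergence of coordinates implies convergence of vectors
  have hconv : ∀ (r : X × TangentBundle I N → TangentBundle I N) (b : E),
      (∀ᶠ z in G, (r z).proj = z.2.proj) → Tendsto (fun z => (e (r z)).2) G (𝓝 b) →
      Tendsto r G (𝓝 (e.toOpenPartialHomeomorph.symm (q, b))) := by
    intro r b hr hb
    have h1 : (q, b) ∈ e.target := e.mem_target.2 hqe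
    have h2 : Tendsto (fun z => e.toOpenPartialHomeomorph.symm (z.2.proj, (e (r z)).2)) G
        (𝓝 (e.toOpenPartialHomeomorph.symm (q, b))) :=
      (e.toOpenPartialHomeomorph.symm.continuousAt h1).tendsto.comp (hGq.prodMk_nhds hb)
    refine h2.congr' ?_
    filter_upwards [hGe, hr] with z hz hrz
    have h3 : r z ∈ e.source := e.mem_source.2 (hrz ▸ hz)
    have h4 : (z.2.proj, (e (r z)).2) = e (r z) := by
      rw [← hrz]; exact Prod.ext (e.coe_fst h3).symm rfl
    rw [h4]
    exact e.toOpenPartialHomeomorph.left_inv h3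
  have hproj : ∀ b, (e.toOpenPartialHomeomorph.symm (q, b)).proj = q := fun b =>
    e.proj_symm_apply (e.mem_target.2 hqe)
  by_cases hR : ∃ R, ∀ᶠ z in (G : Filter (X × TangentBundle I N)), ‖a z‖ ≤ R
  · obtain ⟨R, hR⟩ := hR
    obtain ⟨b, -, hb⟩ := (isCompact_closedBall (0 : E) R).ultrafilter_le_nhds (G.map a)
      (by
        rw [le_principal_iff]
        change ∀ᶠ z in G, a z ∈ Metric.closedBall (0 : E) R
        filter_upwards [hR] with z hz; simpa using hz)
    exact ⟨_, by rw [mem_preimage, hproj]; exact hq,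
      hconv Prod.snd b (Eventually.of_forall fun _ => rfl) hb⟩
  exfalso
  have hR' : ∀ R, ∀ᶠ z in (G : Filter (X × TangentBundle I N)), R < ‖a z‖ := by
    intro R
    by_contra h
    exact hR ⟨R, by
      have := Ultrafilter.eventually_not.2 h
      filter_upwards [this] with z hz using not_lt.1 hz⟩
  have hinf : Tendsto (fun z => ‖a z‖) G atTop :=
    tendsto_atTop.2 fun R => (hR' R).mono fun z hz => hz.le
  -- rescale to unit length
  set c : X × TangentBundle I N → ℝ := fun z => ‖a z‖⁻¹
  have hc : Tendsto c G (𝓝 0) := tendsto_inv_atTop_zero.comp hinf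
  set w : X × TangentBundle I N → TangentBundle I N := fun z => ⟨z.2.proj, c z • z.2.snd⟩
  have hsmul : ∀ (e : Bundle.Trivialization E (Bundle.TotalSpace.proj : TangentBundle I N → N))
      [MemTrivializationAtlas e] (v : TangentBundle I N) (c : ℝ), v.proj ∈ e.baseSet →
      (e (⟨v.proj, c • v.snd⟩ : TangentBundle I N)).2 = c • (e v).2 := fun e _ v c hv =>
    (e.linear ℝ hv).map_smul c v.snd
  have haw : ∀ᶠ z in (G : Filter (X × TangentBundle I N)), (e (w z)).2 = c z • a z :=
    hGe.mono fun z hz => hsmul e z.2 (c z) hz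
  have hu : ∀ᶠ z in (G : Filter (X × TangentBundle I N)),
      (e (w z)).2 ∈ Metric.sphere (0 : E) 1 := by
    filter_upwards [haw, hR' 0] with z hz hz0
    rw [hz, mem_sphere_zero_iff_norm, norm_smul, norm_inv, norm_norm, inv_mul_cancel₀ hz0.ne']
  obtain ⟨b, hb1, hb⟩ := (isCompact_sphere (0 : E) 1).ultrafilter_le_nhds
    (G.map fun z => (e (w z)).2) (le_principal_iff.2 hu)
  have hw := hconv w b (Eventually.of_forall fun _ => rfl) hb
  set w₀ := e.toOpenPartialHomeomorph.symm (q, b)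
  have hw₀ : w₀.proj = q := hproj b
  have hw₀S : w₀ ∈ tanOver I S := by rw [mem_preimage, hw₀]; exact hq
  have hJw : Tendsto (fun z => tangentMapWithin I I (J z.1) S (w z)) G
      (𝓝 (tangentMapWithin I I (J x) S w₀)) :=
    (hJ (x, w₀) ⟨mem_univ _, hw₀S⟩).tendsto.comp
      (f := fun z : X × TangentBundle I N => (z.1, w z))
      (tendsto_nhdsWithin_iff.2 ⟨hGx.prodMk_nhds hw, hGS.mono fun z hz => ⟨mem_univ _, hz⟩⟩)
  have hyproj : y.proj = J x q := by
    have h1 := (hπ.tendsto _).comp hJw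
    have h2 := (hπ.tendsto y).comp hGy
    have h3 := tendsto_nhds_unique h2 h1
    rw [h3, ← hw₀]; rfl
  set e₁ := trivializationAt E (TangentSpace I : N → Type _) (J x q)
  have hqe₁ : J x q ∈ e₁.baseSet := mem_baseSet_trivializationAt _ _ _
  have h1 : Tendsto
      (fun z : X × TangentBundle I N => (e₁ (tangentMapWithin I I (J z.1) S (w z))).2) G
      (𝓝 (e₁ (tangentMapWithin I I (J x) S w₀)).2) := by
    have hs : tangentMapWithin I I (J x) S w₀ ∈ e₁.source := by
      rw [e₁.mem_source]; change J x w₀.proj ∈ _; rwa [hw₀]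
    exact (continuous_snd.tendsto _).comp ((e₁.continuousAt hs).tendsto.comp hJw)
  have h2 : Tendsto (fun z : X × TangentBundle I N => (e₁ (tangentMapWithin I I (J z.1) S z.2)).2)
      G (𝓝 (e₁ y).2) :=
    (continuous_snd.tendsto _).comp
      ((e₁.continuousAt (e₁.mem_source.2 (hyproj ▸ hqe₁))).tendsto.comp hGy)
  have h3 : Tendsto (fun z : X × TangentBundle I N =>
      c z • (e₁ (tangentMapWithin I I (J z.1) S z.2)).2) G (𝓝 0) := by
    simpa using hc.smul h2
  have h4 : ∀ᶠ z in (G : Filter (X × TangentBundle I N)),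
      c z • (e₁ (tangentMapWithin I I (J z.1) S z.2)).2 =
        (e₁ (tangentMapWithin I I (J z.1) S (w z))).2 := by
    have hb : ∀ᶠ z in (G : Filter (X × TangentBundle I N)),
        (tangentMapWithin I I (J z.1) S z.2).proj ∈ e₁.baseSet :=
      ((hπ.tendsto y).comp hGy) (e₁.open_baseSet.mem_nhds (by rw [hyproj]; exact hqe₁))
    filter_upwards [hb] with z hz
    rw [← hsmul e₁ _ (c z) hz]
    congr 2
    simp only [tangentMapWithin, w]
    congr 1
    exact ((mfderivWithin I I (J z.1) S z.2.proj).map_smul (c z) z.2.snd).symm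
  have h5 : (e₁ (tangentMapWithin I I (J x) S w₀)).2 = 0 :=
    tendsto_nhds_unique h1 (h3.congr' h4)
  have hzero : ∀ (e : Bundle.Trivialization E (Bundle.TotalSpace.proj : TangentBundle I N → N))
      [MemTrivializationAtlas e] (p : N), p ∈ e.baseSet →
      (e (⟨p, 0⟩ : TangentBundle I N)).2 = 0 := fun e _ p hp => (e.linear ℝ hp).map_zero
  have h6 : tangentMapWithin I I (J x) S w₀ = tangentMapWithin I I (J x) S ⟨w₀.proj, 0⟩ := by
    have hb : J x w₀.proj ∈ e₁.baseSet := by rwa [hw₀]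
    have h7 : tangentMapWithin I I (J x) S ⟨w₀.proj, 0⟩ = ⟨J x w₀.proj, 0⟩ := by
      simp only [tangentMapWithin, map_zero]
    rw [h7]
    have hs₁ : tangentMapWithin I I (J x) S w₀ ∈ e₁.source := e₁.mem_source.2 hb
    have hs₂ : (⟨J x w₀.proj, 0⟩ : TangentBundle I N) ∈ e₁.source := e₁.mem_source.2 hb
    refine e₁.injOn hs₁ hs₂ (Prod.ext ?_ ?_)
    · exact (e₁.coe_fst hs₁).trans (e₁.coe_fst hs₂).symm
    · exact h5.trans (hzero e₁ _ hb).symm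
  have h8 : w₀ = ⟨w₀.proj, 0⟩ := by
    have h9 := congrArg (tangentMapWithin I I (K x) (J x '' S)) h6
    rwa [(D.data x).toGraftData.tangent.leftInv _ hw₀S,
      (D.data x).toGraftData.tangent.leftInv ⟨w₀.proj, 0⟩ hw₀S] at h9
  have h10 : (e w₀).2 = b := by
    have : e w₀ = (q, b) := e.toOpenPartialHomeomorph.right_inv (e.mem_target.2 hqe)
    rw [this]
  have h11 : b = 0 := by rw [← h10, h8, hzero e _ (by rw [hw₀]; exact hqe)]
  rw [h11] at hb1
  simp at hb1

lemma SpliceFamily.tangent [FiniteDimensional ℝ E] [T2Space N]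
    (D : SpliceFamily I T S O Z J K s f h) (hJ : JointCInfty I S J) :
    SpliceFamily I.tangent (tanOver I T) (tanOver I S) (tanOver I O) (tanOver I Z)
      (fun x => tangentMapWithin I I (J x) S) (fun x => tangentMapWithin I I (K x) (J x '' S))
      (fun x => tangentMap I I (s x)) (fun x => tangentMapWithin I I (f x) T)
      (fun x => tangentMapWithin I I (h x) T) where
  data x := (D.data x).tangent
  proper := D.proper_tangent (hJ 1)
  openU x v hv hvO := by
    have hJO : ∀ x, tangentMapWithin I I (J x) S '' tanOver I O = tanOver I (J x '' O) :=
      fun x => tanOver_image_eq (D.data x).imm (D.data x).subset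
    rw [hJO] at hvO
    simp only [hJO]
    have h1 := D.openU x v.proj hv hvO
    have hc : Continuous fun z : X × TangentBundle I N => (z.1, z.2.proj) :=
      continuous_fst.prodMk (continuous_tangentBundle_proj.comp continuous_snd)
    exact (hc.continuousWithinAt (x := (x, v))).tendsto_nhdsWithin
      (t := univ ×ˢ T) (fun _ h => ⟨mem_univ _, h.2⟩) h1

/-- The spliced family is as regular as the given families. -/
lemma SpliceFamily.jointCk : ∀ (k : ℕ)
    {E : Type} [NormedAddCommGroup E] [NormedSpace ℝ E] [FiniteDimensional ℝ E]
    {H : Type} [TopologicalSpace H] {I : ModelWithCorners ℝ E H}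
    {N : Type u} [TopologicalSpace N] [T2Space N] [ChartedSpace H N] [IsManifold I ∞ N]
    {T S O Z : Set N} {J K s f h : X → N → N}, SpliceFamily I T S O Z J K s f h →
    JointCInfty I T f → JointCInfty I S J → JointCInfty I univ s → JointCk k E H I N T h
  | 0, _, _, _, _, _, _, _, _, _, _, _, _, _, _, _, _, _, _, _, _, _ => fun D hf hJ hs =>
      D.continuousOn (hf 0) (hJ 0) (hs 0)
  | k + 1, _, _, _, _, _, _, I, N, _, _, _, _, _, _, _, _, _, _, s, _, _ => fun D hf hJ hs => by
      have : T2Space (TangentBundle I N) := t2Space_tangentBundle I N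
      refine SpliceFamily.jointCk k (D.tangent hJ) (fun l => hf (l + 1)) (fun l => hJ (l + 1))
        (fun l => ?_)
      have := hs (l + 1)
      simp only [JointCk, tangentMapWithin_univ] at this
      exact this

end SpliceFamilies

/-! ### Splicing families of layers -/

section ChartNeighbourhoods

variable {E : Type} [NormedAddCommGroup E] [NormedSpace ℝ E]
  {H : Type} [TopologicalSpace H] {I : ModelWithCorners ℝ E H}
  {N : Type u} [TopologicalSpace N] [ChartedSpace H N]

lemma ConvexInCharts.exists_isPreconnected {T : Set N} (hT : ConvexInCharts I T) {p : N}
    (hp : p ∈ T) {W : Set N} (hW : W ∈ 𝓝[T] p) :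
    ∃ C ⊆ W, C ⊆ T ∧ C ∈ 𝓝[T] p ∧ IsPreconnected C := by
  set φ := extChartAt I p with hφ
  obtain ⟨W₀, hW₀, hWT⟩ := mem_nhdsWithin_iff_exists_mem_nhds_inter.1 hW
  have h1 : φ.symm ⁻¹' W₀ ∈ 𝓝 (φ p) := by
    refine (continuousAt_extChartAt_symm p) ?_
    rwa [φ.left_inv (mem_extChartAt_source p)]
  obtain ⟨C, hCV, hCc, -, -, hCT, hCn⟩ := hT p hp _ h1
  have hsub : φ.symm '' C ⊆ T := by rintro _ ⟨a, ha, rfl⟩; exact (hCT ha).2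
  refine ⟨φ.symm '' C, ?_, hsub, ?_, ?_⟩
  · rintro _ ⟨a, ha, rfl⟩
    exact hWT ⟨hCV ha, (hCT ha).2⟩
  · rw [← map_extChartAt_symm_nhdsWithin (I := I) p]
    exact Filter.image_mem_map hCn
  · exact hCc.isPreconnected.image _ ((continuousOn_extChartAt_symm p).mono fun a ha => (hCT ha).1)

/-- The interior of a manifold with boundary is dense. -/
lemma dense_manifold_interior [IsManifold I ∞ N] : Dense (I.interior N) := by
  intro x
  rw [mem_closure_iff_nhds]
  intro V hV
  set φ := extChartAt I x with hφ
  have h1 : φ.symm ⁻¹' V ∈ 𝓝 (φ x) := by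
    refine (continuousAt_extChartAt_symm x) ?_
    rwa [φ.left_inv (mem_extChartAt_source x)]
  obtain ⟨W, hW, hxW, hWt⟩ := mem_nhdsWithin.1 (extChartAt_target_mem_nhdsWithin (I := I) x)
  have h2 : φ x ∈ closure (interior (range I)) := I.range_subset_closure_interior
    (extChartAt_target_subset_range x (mem_extChartAt_target x))
  obtain ⟨a, ⟨haV, haW⟩, hai⟩ := mem_closure_iff_nhds.1 h2 _
    (Filter.inter_mem h1 (hW.mem_nhds hxW))
  have hat : a ∈ φ.target := hWt ⟨haW, interior_subset hai⟩
  refine ⟨φ.symm a, haV, ?_⟩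
  have hs : φ.symm a ∈ (chartAt H x).source := by
    rw [← extChartAt_source I]; exact φ.map_target hat
  refine (I.isInteriorPoint_iff_of_mem_atlas (n := ∞) (by simp) (chart_mem_atlas H x) hs).2 ?_
  have h3 : (chartAt H x).extend I (φ.symm a) = a := φ.right_inv hat
  rw [h3, mem_interior_iff_mem_nhds]
  refine Filter.mem_of_superset ((hW.inter isOpen_interior).mem_nhds ⟨haW, hai⟩) ?_
  exact fun b hb => hWt ⟨hb.1, interior_subset hb.2⟩

end ChartNeighbourhoods

section LayerFamilies

open Filter

/-- An open condition on `J_x q` that holds for all `q` in a compact set is stable. -/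
lemma eventually_forall_of_continuousOn {X A B : Type u} [TopologicalSpace X]
    [TopologicalSpace A] [TopologicalSpace B] {g : X → A → B} {S K : Set A}
    (hg : ContinuousOn (fun z : X × A => g z.1 z.2) (univ ×ˢ S)) (hK : IsCompact K) (hKS : K ⊆ S)
    {V : Set B} (hV : IsOpen V) {x : X} (h : ∀ q ∈ K, g x q ∈ V) :
    ∀ᶠ y in 𝓝 x, ∀ q ∈ K, g y q ∈ V := by
  have h1 : ∀ᶠ y in 𝓝 x, ∀ q ∈ K, q ∈ S → g y q ∈ V := by
    refine hK.eventually_forall_of_forall_eventually fun q hq => ?_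
    have h2 := hg (x, q) ⟨mem_univ _, hKS hq⟩ (hV.mem_nhds (h q hq))
    have h3 := mem_nhdsWithin_iff_eventually.1 h2
    filter_upwards [h3] with z hz hzS using hz ⟨mem_univ _, hzS⟩
  filter_upwards [h1] with y hy q hq using hy q hq (hKS hq)

variable {j m : ℕ} [NeZero m] {M : Type u} [TopologicalSpace M]
  [ChartedSpace (EuclideanHalfSpace m) M] [IsManifold (𝓡∂ m) ∞ M]

/-- Layers have interior points near every point. -/
lemma Layer.exists_interior {T : Set (Amb j M)} {f : Amb j M → Amb j M} (h : Layer m T f)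
    {p : Amb j M} (hp : p ∈ T) {W : Set (Amb j M)} (hW : W ∈ 𝓝[T] p) :
    ∃ r ∈ W, T ∈ 𝓝 r ∧ r.2 ∈ (𝓡∂ m).interior M := by
  have h1 : p ∈ closure (interior T) := by
    rcases h.region with rfl | rfl
    · simp
    · exact closure_mono (interior_maximal (openSolid_subset_solid j M) (isOpen_openSolid j M))
        (closure_mono (sep_subset _ _) (mem_closure_openSolid hp (mem_univ p.2)))
  have hd : Dense (Prod.snd ⁻¹' (𝓡∂ m).interior M : Set (Amb j M)) :=
    (dense_manifold_interior).preimage isOpenMap_snd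
  have h2 := closure_minimal (hd.open_subset_closure_inter isOpen_interior) isClosed_closure h1
  obtain ⟨W₀, hW₀, hWT⟩ := mem_nhdsWithin_iff_exists_mem_nhds_inter.1 hW
  obtain ⟨r, hr, hrT, hri⟩ := mem_closure_iff_nhds.1 h2 W₀ hW₀
  exact ⟨r, hWT ⟨hr, interior_subset hrT⟩, mem_interior_iff_mem_nhds.1 hrT, hri⟩

variable [T2Space M] [CompactSpace M] {X : Type u} [TopologicalSpace X]

/-- Near an interior point of `J_{x₀}`, the images of the pucks `J_x` for `x` close to `x₀` contain
a common open set. This is invariance of domain in a family; it rests on a connectedness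
argument. -/
lemma exists_nhds_subset_image {J : X → Puck j m M}
    (hJ : ContinuousOn (fun z : X × Amb j M => J z.1 z.2) (univ ×ˢ solid j M)) (x₀ : X)
    {q : Amb j M} (hq : q ∈ openSolid j M) (hi : q.2 ∈ (𝓡∂ m).interior M) :
    ∃ B ∈ 𝓝 (J x₀ q), ∀ᶠ x in 𝓝 x₀, B ⊆ J x '' solid j M := by
  set A : Set (Amb j M) := openSolid j M ∩ Prod.snd ⁻¹' (𝓡∂ m).interior M with hA
  have hAo : IsOpen A := (isOpen_openSolid j M).inter
    (((𝓡∂ m).isOpen_interior (M := M) (n := ∞) (by simp)).preimage continuous_snd)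
  have hAS : A ⊆ solid j M := fun p hp => openSolid_subset_solid j M hp.1
  have hopen : ∀ x, IsOpen (J x '' A) := by
    intro x
    rw [isOpen_iff_mem_nhds]
    rintro _ ⟨p, hp, rfl⟩
    rw [← ((J x).map_nhds hp.1 hp.2).2]
    exact Filter.image_mem_map (hAo.mem_nhds hp)
  have : LocallyCompactSpace (Amb j M) :=
    Manifold.locallyCompact_of_finiteDimensional (ambModel j m)
  obtain ⟨B₀, hB₀, hB₀A, hB₀c⟩ := LocallyCompactSpace.local_compact_nhds (J x₀ q) (J x₀ '' A)
    ((hopen x₀).mem_nhds ⟨q, ⟨hq, hi⟩, rfl⟩)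
  obtain ⟨B, hBB, -, hBn, hBc⟩ :=
    (convexInCharts_univ (j := j) (m := m) (M := M)).exists_isPreconnected
    (mem_univ (J x₀ q)) (by rwa [nhdsWithin_univ])
  rw [nhdsWithin_univ] at hBn
  refine ⟨B, hBn, ?_⟩
  have h1 : ∀ᶠ x in 𝓝 x₀, ∀ p ∈ solid j M \ A, J x p ∈ B₀ᶜ := by
    refine eventually_forall_of_continuousOn hJ ((isCompact_solid j M).diff hAo) sdiff_subset
      hB₀c.isClosed.isOpen_compl ?_
    rintro p ⟨hp, hpA⟩ hpB
    obtain ⟨r, hr, hrp⟩ := hB₀A hpB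
    exact hpA ((J x₀).injOn (hAS hr) hp hrp ▸ hr)
  have h2 : ∀ᶠ x in 𝓝 x₀, ∀ p ∈ ({q} : Set (Amb j M)), J x p ∈ interior B := by
    refine eventually_forall_of_continuousOn hJ isCompact_singleton
      (singleton_subset_iff.2 (openSolid_subset_solid j M hq)) isOpen_interior ?_
    rintro p rfl
    exact mem_interior_iff_mem_nhds.2 hBn
  filter_upwards [h1, h2] with x hx1 hx2
  refine (hBc.subset_left_of_subset_union (hopen x) (J x).isClosed_image.isOpen_compl ?_ ?_
    ⟨J x q, interior_subset (hx2 q rfl), q, ⟨hq, hi⟩, rfl⟩).trans (image_mono hAS)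
  · exact disjoint_compl_right.mono_left (image_mono hAS)
  · intro y hy
    by_cases hyS : y ∈ J x '' solid j M
    · obtain ⟨p, hp, rfl⟩ := hyS
      by_cases hpA : p ∈ A
      · exact Or.inl ⟨p, hpA, rfl⟩
      · exact absurd (hBB hy) (hx1 p ⟨hp, hpA⟩)
    · exact Or.inr hyS

/-- The set of `(x, p)` such that `f_x` maps `p` into `J_x((I^j)° × M)` is open. -/
lemma eventually_mem_image_openSolid {T : Set (Amb j M)} {f : X → Amb j M → Amb j M}
    {J : X → Puck j m M} (hf : ∀ x, Layer m T (f x)) (hfJ : ∀ x, Below T (f x) (J x))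
    (hfc : ContinuousOn (fun z : X × Amb j M => f z.1 z.2) (univ ×ˢ T))
    (hJc : ContinuousOn (fun z : X × Amb j M => J z.1 z.2) (univ ×ˢ solid j M))
    {x₀ : X} {p₀ : Amb j M} (hp₀ : p₀ ∈ T) (hU : f x₀ p₀ ∈ J x₀ '' openSolid j M) :
    ∀ᶠ z : X × Amb j M in 𝓝[univ ×ˢ T] (x₀, p₀), f z.1 z.2 ∈ J z.1 '' openSolid j M := by
  have hTc : IsClosed T := (hf x₀).isClosed_region
  have : LocallyCompactSpace (Amb j M) :=
    Manifold.locallyCompact_of_finiteDimensional (ambModel j m)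
  have hW := (hfJ x₀).preimage_mem_nhdsWithin ((hf x₀).continuousOn p₀ hp₀) hU
  obtain ⟨W₀, hW₀, hWT⟩ := mem_nhdsWithin_iff_exists_mem_nhds_inter.1 hW
  obtain ⟨K, hK, hKW, hKc⟩ := LocallyCompactSpace.local_compact_nhds p₀ W₀ hW₀
  obtain ⟨C, hCK, hCT, hCn, hCc⟩ := (hf x₀).convexInCharts.exists_isPreconnected hp₀
    (inter_mem (mem_nhdsWithin_of_mem_nhds hK) self_mem_nhdsWithin : K ∩ T ∈ 𝓝[T] p₀)
  obtain ⟨p₁, hp₁C, hTp₁, hp₁i⟩ := (hf x₀).exists_interior hp₀ hCn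
  obtain ⟨q₁, hq₁, hqp⟩ := hWT ⟨hKW (hCK hp₁C).1, hCT hp₁C⟩
  have hq₁i : q₁.2 ∈ (𝓡∂ m).interior M := (mem_interior_or_boundary q₁.2).resolve_right fun hb =>
    (hf x₀).notMem_image_side (hfJ x₀) hTp₁ hp₁i
      ⟨q₁, ⟨openSolid_subset_solid j M hq₁, hb⟩, hqp⟩
  obtain ⟨B, hB, hBJ⟩ := exists_nhds_subset_image hJc x₀ hq₁ hq₁i
  have h1 : ∀ᶠ x in 𝓝 x₀, ∀ p ∈ ({p₁} : Set (Amb j M)), f x p ∈ interior B := by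
    refine eventually_forall_of_continuousOn hfc isCompact_singleton
      (singleton_subset_iff.2 (hCT hp₁C)) isOpen_interior ?_
    rintro p rfl
    rw [← hqp]; exact mem_interior_iff_mem_nhds.2 hB
  -- near `x₀` no point of `K` is mapped to the image of the boundary of the cube
  have h2 : ∀ᶠ x in 𝓝 x₀, ∀ z ∈ (K ∩ T) ×ˢ (solid j M \ openSolid j M),
      (f x z.1, J x z.2) ∈ (diagonal (Amb j M))ᶜ := by
    refine eventually_forall_of_continuousOn (S := T ×ˢ solid j M)
      (g := fun x (z : Amb j M × Amb j M) => (f x z.1, J x z.2)) ?_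
      ((hKc.inter_right hTc).prod ((isCompact_solid j M).diff (isOpen_openSolid j M)))
      (prod_mono inter_subset_right sdiff_subset) isClosed_diagonal.isOpen_compl ?_
    · refine ContinuousOn.prodMk ?_ ?_
      · exact hfc.comp (f := fun z : X × (Amb j M × Amb j M) => (z.1, z.2.1)) (by fun_prop)
          (fun z hz => ⟨mem_univ _, hz.2.1⟩)
      · exact hJc.comp (f := fun z : X × (Amb j M × Amb j M) => (z.1, z.2.2)) (by fun_prop)
          (fun z hz => ⟨mem_univ _, hz.2.2⟩)
    · rintro ⟨p, q⟩ ⟨hp, hq⟩ hpq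
      have hpq : f x₀ p = J x₀ q := hpq
      have h3 := hWT ⟨hKW hp.1, hp.2⟩
      rw [mem_preimage, hpq, (J x₀).mem_image_openSolid_iff hq.1] at h3
      exact hq.2 h3
  have h3 : ∀ᶠ x in 𝓝 x₀, ∀ p ∈ C, f x p ∈ J x '' openSolid j M := by
    filter_upwards [h1, h2, hBJ] with x hx1 hx2 hxB
    have hiff : ∀ p ∈ C, f x p ∈ J x '' solid j M → f x p ∈ J x '' openSolid j M := by
      rintro p hp ⟨q, hq, hqp⟩
      refine ⟨q, ?_, hqp⟩
      by_contra hn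
      exact hx2 (p, q) ⟨hCK hp, hq, hn⟩ hqp.symm
    have hp₁ : f x p₁ ∈ J x '' openSolid j M :=
      hiff p₁ hp₁C (hxB (interior_subset (hx1 p₁ rfl)))
    classical
    have hcont : ContinuousOn (fun p => decide (f x p ∈ J x '' openSolid j M)) C := by
      intro p hp
      refine tendsto_nhds_of_eventually_eq ?_
      by_cases h : f x p ∈ J x '' openSolid j M
      · have h4 := nhdsWithin_mono p hCT ((hfJ x).preimage_mem_nhdsWithin
          ((hf x).continuousOn p (hCT hp)) h)
        filter_upwards [h4] with r hr
        exact (decide_eq_true hr).trans (decide_eq_true h).symm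
      · have h5 : f x p ∈ (J x '' solid j M)ᶜ := fun h6 => h (hiff p hp h6)
        have h4 := ((hf x).continuousOn.mono hCT) p hp
          ((J x).isClosed_image.isOpen_compl.mem_nhds h5)
        filter_upwards [h4] with r hr
        exact (decide_eq_false fun h6 => hr (image_mono (openSolid_subset_solid j M) h6)).trans
          (decide_eq_false h).symm
    intro p hp
    have h4 := hCc.constant hcont hp hp₁C
    simp only [hp₁, decide_true] at h4
    exact of_decide_eq_true h4
  rw [nhdsWithin_prod_eq, nhdsWithin_univ]
  filter_upwards [prod_mem_prod h3 hCn] with z hz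
  exact hz.1 z.2 hz.2

/-- Splicing long embeddings into layers is a splicing family: `J` is proper because the cube times
`M` is compact. -/
lemma spliceFamily_layer {T : Set (Amb j M)} {f : X → Amb j M → Amb j M}
    {J : X → Puck j m M} (s : X → LongEmb j m M) (hf : ∀ x, Layer m T (f x))
    (hfJ : ∀ x, Below T (f x) (J x))
    (hfc : ContinuousOn (fun z : X × Amb j M => f z.1 z.2) (univ ×ˢ T))
    (hJc : ContinuousOn (fun z : X × Amb j M => J z.1 z.2) (univ ×ˢ solid j M)) :
    SpliceFamily (ambModel j m) T (solid j M) (openSolid j M) (solid j M)ᶜ (fun x => J x)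
      (fun x => (J x).inv) (fun x => s x) f (fun x => graft (J x) (s x) ∘ f x) where
  data x :=
    { graftData (J x) (s x) with
      subset := openSolid_subset_solid j M
      closed := (J x).isClosed_image
      uniqueT := (hf x).uniqueMDiffOn
      smooth_f := (hf x).imm.smooth
      smooth_h := ((hf x).graft (hfJ x) (s x)).imm.smooth
      rel := fun p _ q hq h => by rw [Function.comp_apply, h, graft_apply _ _ hq]
      off := fun p _ h => graft_of_notMem_openSolid _ _ h
      openU := fun p hp h => (hfJ x).preimage_mem_nhdsWithin ((hf x).continuousOn p hp) h }
  proper G x y hGS _ _ := by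
    obtain ⟨q, hq, h⟩ := (isCompact_solid j M).ultrafilter_le_nhds (G.map Prod.snd)
      (le_principal_iff.2 hGS)
    exact ⟨q, hq, h⟩
  openU x p hp h := eventually_mem_image_openSolid hf hfJ hfc hJc hp h

/-- The spliced layer depends continuously on the layer, the puck and the long embedding. -/
lemma jointCInfty_graft {T : Set (Amb j M)} {f : X → Amb j M → Amb j M}
    {J : X → Puck j m M} {s : X → LongEmb j m M} (hf : ∀ x, Layer m T (f x))
    (hfJ : ∀ x, Below T (f x) (J x)) (hfc : JointCInfty (ambModel j m) T f)
    (hJc : JointCInfty (ambModel j m) (solid j M) (fun x => J x))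
    (hsc : JointCInfty (ambModel j m) univ (fun x => s x)) :
    JointCInfty (ambModel j m) T (fun x => graft (J x) (s x) ∘ f x) := fun k =>
  (spliceFamily_layer s hf hfJ (hfc 0) (hJc 0)).jointCk k hfc hJc hsc

/-- Families of tuples with constant permutation `α` can be composed. -/
lemma jointCInfty_composeFrom {k : ℕ} {n : Fin k → ℕ} {P : X → PreDiagram j m M k}
    {Q : X → ∀ a, PreDiagram j m M (n a)} {α : Equiv.Perm (Fin k)} (hα : ∀ x, (P x).perm = α)
    (hP : ∀ a, JointCInfty (ambModel j m) (solid j M) (fun x => (P x).puck a))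
    (hQ : ∀ a, JointCInfty (ambModel j m) univ (fun x => (Q x a).long))
    {T : Set (Amb j M)} {c : ℕ} (hc : c ≤ k) {f : X → Amb j M → Amb j M}
    (hf : ∀ x, LayerBelow (P x) T c (f x)) (hfc : JointCInfty (ambModel j m) T f) :
    JointCInfty (ambModel j m) T (fun x => composeFrom (graftAt (P x) (Q x)) c ∘ f x) := by
  obtain ⟨d, hd⟩ : ∃ d, c + d = k := ⟨k - c, by omega⟩
  induction d generalizing c f with
  | zero =>
    have : ∀ x, composeFrom (graftAt (P x) (Q x)) c = id :=
      fun x => composeFrom_of_le _ (by omega)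
    simpa only [this, Function.id_comp] using hfc
  | succ d ih =>
    have hck : c < k := by omega
    have e : ∀ x, composeFrom (graftAt (P x) (Q x)) c ∘ f x =
        composeFrom (graftAt (P x) (Q x)) (c + 1) ∘
          (graft ((P x).puck (α ⟨c, hck⟩)) (Q x (α ⟨c, hck⟩)).long ∘ f x) := by
      intro x
      rw [composeFrom_eq_comp (graftAt (P x) (Q x)) ⟨c, hck⟩, graftAt, hα x]; rfl
    simp only [e]
    have hstep : ∀ x, LayerBelow (P x) T (c + 1)
        (graft ((P x).puck (α ⟨c, hck⟩)) (Q x (α ⟨c, hck⟩)).long ∘ f x) := by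
      intro x
      have := LayerBelow.step (P x) (Q x) ⟨c, hck⟩ (f x) (hf x)
      rwa [graftAt, hα x] at this
    refine ih (by omega) hstep ?_ (by omega)
    refine jointCInfty_graft (fun x => (hf x).1) (fun x => ?_) hfc (hP _) (hQ _)
    have := (hf x).2 ⟨c, hck⟩ le_rfl
    rwa [hα x] at this

end LayerFamilies

/-! ### Pushing `M` off its boundary -/

section PushModel

variable {V W : Type} [NormedAddCommGroup V] [NormedSpace ℝ V] [NormedAddCommGroup W]
  [NormedSpace ℝ W] {ρ : W → ℝ} {K : NNReal} {e : W}

/-- The shear `a ↦ a + κ ρ(a) e` is injective if the Lipschitz constant of `κ ρ e` is less than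
`1`. -/
lemma eq_of_add_smul_eq (hρ : LipschitzWith K ρ) (he : ‖e‖ ≤ 1) {κ : ℝ} (hκ : 0 ≤ κ)
    (hκK : κ * K < 1) {a a' : W} (h : a + (κ * ρ a) • e = a' + (κ * ρ a') • e) : a = a' := by
  have h1 : a - a' = (κ * (ρ a' - ρ a)) • e := by
    rw [mul_sub, sub_smul, sub_eq_sub_iff_add_eq_add, h, add_comm]
  have h2 : ‖a - a'‖ ≤ κ * K * ‖a - a'‖ := by
    calc ‖a - a'‖ = κ * |ρ a' - ρ a| * ‖e‖ := by
          conv_lhs => rw [h1]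
          rw [norm_smul, norm_mul, Real.norm_eq_abs, Real.norm_eq_abs, abs_of_nonneg hκ]
      _ ≤ κ * (K * ‖a - a'‖) * 1 := by
          gcongr
          have := hρ.dist_le_mul a' a
          rwa [Real.dist_eq, dist_comm, dist_eq_norm] at this
      _ = κ * K * ‖a - a'‖ := by ring
  have h3 : ‖a - a'‖ = 0 := by nlinarith [norm_nonneg (a - a')]
  rwa [norm_eq_zero, sub_eq_zero] at h3

/-- The shear `a ↦ a + κ ρ(a) e` preserves the set of points where `ρ` does not vanish. -/
lemma ne_zero_of_add_smul (hρ : LipschitzWith K ρ) (he : ‖e‖ ≤ 1) {κ : ℝ} (hκ : 0 ≤ κ)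
    (hκK : κ * K < 1) {a : W} (ha : ρ a ≠ 0) : ρ (a + (κ * ρ a) • e) ≠ 0 := by
  intro h
  have h1 : |ρ a| ≤ κ * K * |ρ a| := by
    have h2 := hρ.dist_le_mul (a + (κ * ρ a) • e) a
    rw [Real.dist_eq, h, zero_sub, abs_neg, dist_eq_norm, add_sub_cancel_left, norm_smul, norm_mul,
      Real.norm_eq_abs, Real.norm_eq_abs, abs_of_nonneg hκ] at h2
    calc |ρ a| ≤ K * (κ * |ρ a| * ‖e‖) := h2
      _ ≤ K * (κ * |ρ a| * 1) := by gcongr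
      _ = _ := by ring
  have h2 : 0 < |ρ a| := abs_pos.2 ha
  nlinarith

/-- The derivatives of a shear are injective, also if the strength `c` of the shear varies with a
parameter that is preserved by the shear. -/
lemma injective_fderiv_shear (hρ : LipschitzWith K ρ) (hρ' : Differentiable ℝ ρ) (he : ‖e‖ ≤ 1)
    {c : V → ℝ} (hc : Differentiable ℝ c) {b : V × W} (hκ : 0 ≤ c b.1) (hκK : c b.1 * K < 1) :
    ∃ A : V × W →L[ℝ] V × W, Function.Injective A ∧
      HasFDerivAt (fun b : V × W => (b.1, b.2 + (c b.1 * ρ b.2) • e)) A b := by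
  have h1 : HasFDerivAt (fun b : V × W => c b.1) ((fderiv ℝ c b.1).comp (.fst ℝ V W)) b :=
    (hc b.1).hasFDerivAt.comp b hasFDerivAt_fst
  have h2 : HasFDerivAt (fun b : V × W => ρ b.2) ((fderiv ℝ ρ b.2).comp (.snd ℝ V W)) b :=
    (hρ' b.2).hasFDerivAt.comp b hasFDerivAt_snd
  refine ⟨_, ?_, hasFDerivAt_fst.prodMk (hasFDerivAt_snd.add ((h1.mul h2).smul_const e))⟩
  rw [injective_iff_map_eq_zero]
  rintro ⟨v, w⟩ hvw
  simp only [ContinuousLinearMap.prod_apply, Prod.mk_eq_zero, ContinuousLinearMap.coe_fst',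
    add_apply, ContinuousLinearMap.coe_snd',
    ContinuousLinearMap.smulRight_apply, smul_apply,
    ContinuousLinearMap.comp_apply, smul_eq_mul] at hvw
  obtain ⟨rfl, hw⟩ := hvw
  simp only [map_zero, mul_zero, add_zero] at hw
  have h3 : ‖w‖ ≤ c b.1 * K * ‖w‖ := by
    calc ‖w‖ = ‖(c b.1 * fderiv ℝ ρ b.2 w) • e‖ :=
          (congrArg norm (eq_neg_of_add_eq_zero_left hw)).trans (norm_neg _)
      _ = c b.1 * ‖fderiv ℝ ρ b.2 w‖ * ‖e‖ := by
        rw [norm_smul, norm_mul, Real.norm_of_nonneg hκ]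
      _ ≤ c b.1 * (K * ‖w‖) * 1 := by
        gcongr
        exact (ContinuousLinearMap.le_opNorm _ _).trans
          (by gcongr; exact norm_fderiv_le_of_lipschitz ℝ hρ)
      _ = _ := by ring
  have h4 : ‖w‖ = 0 := by nlinarith [norm_nonneg w]
  rw [norm_eq_zero] at h4
  rw [h4]; rfl

end PushModel

section Cutoff

/-- A smooth function on `ℝ^j` with values in `[0,1]` that is positive exactly on the open
cube. -/
def cubeBump (j : ℕ) (y : EuclideanSpace ℝ (Fin j)) : ℝ :=
  ∏ i, Real.smoothTransition (1 - y i ^ 2)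

variable {j : ℕ}

lemma contDiff_cubeBump : ContDiff ℝ ∞ (cubeBump j) := by
  unfold cubeBump
  refine contDiff_prod fun i _ => Real.smoothTransition.contDiff.comp ?_
  fun_prop

lemma cubeBump_nonneg (y : EuclideanSpace ℝ (Fin j)) : 0 ≤ cubeBump j y :=
  Finset.prod_nonneg fun _ _ => Real.smoothTransition.nonneg _

lemma cubeBump_le_one (y : EuclideanSpace ℝ (Fin j)) : cubeBump j y ≤ 1 :=
  Finset.prod_le_one (fun _ _ => Real.smoothTransition.nonneg _)
    fun _ _ => Real.smoothTransition.le_one _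

lemma cubeBump_pos {M : Type u} {p : Amb j M} (hp : p ∈ openSolid j M) : 0 < cubeBump j p.1 := by
  refine Finset.prod_pos fun i _ => Real.smoothTransition.pos_of_pos ?_
  have := hp i
  nlinarith [this.1, this.2]

lemma cubeBump_eq_zero {M : Type u} {p : Amb j M} (hp : p ∉ openSolid j M) :
    cubeBump j p.1 = 0 := by
  simp only [openSolid, mem_ofPred_eq, not_forall] at hp
  obtain ⟨i, hi⟩ := hp
  refine Finset.prod_eq_zero (Finset.mem_univ i) (Real.smoothTransition.zero_of_nonpos ?_)
  by_contra h
  refine hi ⟨?_, ?_⟩ <;> nlinarith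

end Cutoff

section Push

variable {j m : ℕ} [NeZero m] {M : Type u} [TopologicalSpace M]
  [ChartedSpace (EuclideanHalfSpace m) M]

/-- A smooth family of long embeddings that preserve the coordinate in `ℝ^j`, with parameter `t`,
that for positive `t` pushes the points of `(I^j)° × A` into the interior, and fixes the points
outside `ℝ^j × A`. -/
structure IsPush (j m : ℕ) [NeZero m] [ChartedSpace (EuclideanHalfSpace m) M]
    (F : ℝ × Amb j M → Amb j M) (A : Set M) : Prop where
  smooth : ContMDiff (𝓘(ℝ, ℝ).prod (ambModel j m)) (ambModel j m) ∞ F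
  immersion : ∀ t p, Function.Injective
    (mfderiv (ambModel j m) (ambModel j m) (fun p => F (t, p)) p)
  injective : ∀ t, Function.Injective fun p => F (t, p)
  fst : ∀ t p, (F (t, p)).1 = p.1
  off : ∀ t p, p ∉ openSolid j M → F (t, p) = p
  zero : ∀ p, F (0, p) = p
  fix : ∀ t p, p.2 ∉ A → F (t, p) = p
  push : ∀ t p, 0 < t → p ∈ openSolid j M → p.2 ∈ A → (F (t, p)).2 ∈ (𝓡∂ m).interior M

variable {F F₁ F₂ : ℝ × Amb j M → Amb j M} {A A₁ A₂ : Set M}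

lemma IsPush.smooth_at (h : IsPush j m F A) (t : ℝ) :
    ContMDiff (ambModel j m) (ambModel j m) ∞ (fun p => F (t, p)) :=
  h.smooth.comp (contMDiff_const.prodMk contMDiff_id)

lemma IsPush.mem_openSolid_iff (h : IsPush j m F A) (t : ℝ) (p : Amb j M) :
    F (t, p) ∈ openSolid j M ↔ p ∈ openSolid j M := by
  simp only [openSolid, mem_ofPred_eq, h.fst]

lemma isPush_id : IsPush j m (fun z : ℝ × Amb j M => z.2) (∅ : Set M) where
  smooth := contMDiff_snd
  immersion t p := by
    change Function.Injective (mfderiv (ambModel j m) (ambModel j m) id p)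
    rw [mfderiv_id]; exact fun _ _ h => h
  injective _ _ _ h := h
  fst _ _ := rfl
  off _ _ _ := rfl
  zero _ := rfl
  fix _ _ _ := rfl
  push _ _ _ _ h := h.elim

variable [IsManifold (𝓡∂ m) ∞ M]

lemma IsPush.interior (h : IsPush j m F A) (t : ℝ) {p : Amb j M}
    (hp : p.2 ∈ (𝓡∂ m).interior M) : (F (t, p)).2 ∈ (𝓡∂ m).interior M :=
  isInteriorPoint_iff.1 (map_nhds_eq_of_isInteriorPoint (h.smooth_at t).contMDiffAt
    (h.immersion t p) (isInteriorPoint_iff.2 hp)).1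

lemma IsPush.comp (h₁ : IsPush j m F₁ A₁) (h₂ : IsPush j m F₂ A₂) :
    IsPush j m (fun z => F₂ (z.1, F₁ z)) (A₁ ∪ A₂) where
  smooth := h₂.smooth.comp (contMDiff_fst.prodMk h₁.smooth)
  immersion t p := by
    have e : mfderiv (ambModel j m) (ambModel j m) (fun p => F₂ (t, F₁ (t, p))) p = _ :=
      mfderiv_comp (I' := ambModel j m) p (g := fun p => F₂ (t, p)) (f := fun p => F₁ (t, p))
        ((h₂.smooth_at t).mdifferentiable (by simp) _)
        ((h₁.smooth_at t).mdifferentiable (by simp) _)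
    change Function.Injective (mfderiv (ambModel j m) (ambModel j m) (fun p => F₂ (t, F₁ (t, p))) p)
    rw [e]
    exact (h₂.immersion t _).comp (h₁.immersion t p)
  injective t := (h₂.injective t).comp (h₁.injective t)
  fst t p := (h₂.fst t _).trans (h₁.fst t p)
  off t p hp := by
    simp only [h₁.off t p hp, h₂.off t p hp]
  zero p := by simp only [h₁.zero, h₂.zero]
  fix t p hp := by
    simp only [mem_union, not_or] at hp
    simp only [h₁.fix t p hp.1, h₂.fix t p hp.2]
  push t p ht hp hA := by
    by_cases h : p.2 ∈ A₁
    · exact h₂.interior t (h₁.push t p ht hp h)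
    · simp only [h₁.fix t p h]
      exact h₂.push t p ht hp (hA.resolve_left h)

end Push

section PushAt

variable {j m : ℕ} [NeZero m] {M : Type u} [TopologicalSpace M]
  [ChartedSpace (EuclideanHalfSpace m) M]

/-- The inward direction in the half-space. -/
def inward (m : ℕ) [NeZero m] : EuclideanSpace ℝ (Fin m) := EuclideanSpace.single 0 1

lemma norm_inward : ‖inward m‖ ≤ 1 := by simp [inward]

/-- The distance, in units of the bump function, by which points are pushed. -/
def pushFactor (ε : ℝ) (t : ℝ) (y : EuclideanSpace ℝ (Fin j)) : ℝ :=
  ε * Real.smoothTransition t * cubeBump j y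

open Classical in
/-- Pushing into the interior, in the preferred chart at `c`, along a bump function. -/
def pushAt {c : M} (b : SmoothBumpFunction (𝓡∂ m) c) (ε : ℝ) (z : ℝ × Amb j M) : Amb j M :=
  if z.2.2 ∈ (extChartAt (𝓡∂ m) c).source then
    (z.2.1, (extChartAt (𝓡∂ m) c).symm
      (extChartAt (𝓡∂ m) c z.2.2 + (pushFactor ε z.1 z.2.1 * b z.2.2) • inward m))
  else z.2

lemma pushFactor_nonneg {ε : ℝ} (hε : 0 ≤ ε) (t : ℝ) (y : EuclideanSpace ℝ (Fin j)) :
    0 ≤ pushFactor ε t y :=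
  mul_nonneg (mul_nonneg hε (Real.smoothTransition.nonneg t)) (cubeBump_nonneg y)

lemma pushFactor_le {ε : ℝ} (hε : 0 ≤ ε) (t : ℝ) (y : EuclideanSpace ℝ (Fin j)) :
    pushFactor ε t y ≤ ε := by
  have h1 := Real.smoothTransition.le_one t
  have h2 := Real.smoothTransition.nonneg t
  have h3 := cubeBump_le_one y
  have h4 := cubeBump_nonneg y
  calc ε * Real.smoothTransition t * cubeBump j y ≤ ε * 1 * 1 := by gcongr
    _ = ε := by ring

lemma contDiff_pushFactor (ε : ℝ) :
    ContDiff ℝ ∞ (fun z : ℝ × EuclideanSpace ℝ (Fin j) => pushFactor ε z.1 z.2) :=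
  (contDiff_const.mul (Real.smoothTransition.contDiff.comp contDiff_fst)).mul
    (contDiff_cubeBump.comp contDiff_snd)

variable {c : M} {b : SmoothBumpFunction (𝓡∂ m) c} {ε : ℝ} {K : NNReal}

lemma bump_eq {x : M} (hx : x ∈ (extChartAt (𝓡∂ m) c).source) :
    b x = b.toContDiffBump (extChartAt (𝓡∂ m) c x) :=
  b.eqOn_source (by rwa [extChartAt_source] at hx)

/-- The push stays in the chart: a point where the bump function vanishes is not moved, and the
other points stay in the support of the bump function, and in the half-space. -/
lemma pushAt_mem_target (hK : LipschitzWith K b.toContDiffBump) (hε : 0 ≤ ε) (hεK : ε * K < 1)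
    (t : ℝ) (y : EuclideanSpace ℝ (Fin j)) {x : M} (hx : x ∈ (extChartAt (𝓡∂ m) c).source) :
    extChartAt (𝓡∂ m) c x + (pushFactor ε t y * b x) • inward m ∈ (extChartAt (𝓡∂ m) c).target := by
  set φ := extChartAt (𝓡∂ m) c with hφ
  have hκ := pushFactor_nonneg hε t y
  have hκK : pushFactor ε t y * K < 1 :=
    (mul_le_mul_of_nonneg_right (pushFactor_le hε t y) K.2).trans_lt hεK
  rw [bump_eq hx]
  by_cases h0 : b.toContDiffBump (φ x) = 0
  · rw [h0, mul_zero, zero_smul, add_zero]; exact φ.map_source hx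
  · refine b.ball_subset ⟨?_, ?_⟩
    · rw [← ContDiffBump.support_eq]
      exact ne_zero_of_add_smul hK norm_inward hκ hκK h0
    · have h1 : φ x ∈ range (𝓡∂ m) := extChartAt_target_subset_range c (φ.map_source hx)
      rw [range_modelWithCornersEuclideanHalfSpace, mem_ofPred_eq] at h1 ⊢
      have h2 : 0 ≤ pushFactor ε t y * b.toContDiffBump (φ x) :=
        mul_nonneg hκ (b.toContDiffBump.nonneg' _)
      simp only [PiLp.add_apply, PiLp.smul_apply, inward, PiLp.single_apply, if_true,
        smul_eq_mul, mul_one]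
      positivity

/-- The extended chart of `ℝ^j × M` at `(0, c)`. -/
lemma extChartAt_amb_apply (c : M) (p : Amb j M) :
    extChartAt (ambModel j m) ((0, c) : Amb j M) p = (p.1, extChartAt (𝓡∂ m) c p.2) := by
  rw [extChartAt_prod]; rfl

lemma mem_extChartAt_amb_source {c : M} {p : Amb j M} (hp : p.2 ∈ (extChartAt (𝓡∂ m) c).source) :
    p ∈ (extChartAt (ambModel j m) ((0, c) : Amb j M)).source := by
  rw [extChartAt_prod]
  exact ⟨mem_extChartAt_source (I := 𝓡 j) p.1, hp⟩

lemma pushAt_snd_mem_source (hK : LipschitzWith K b.toContDiffBump) (hε : 0 ≤ ε)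
    (hεK : ε * K < 1) (t : ℝ) {p : Amb j M} (hx : p.2 ∈ (extChartAt (𝓡∂ m) c).source) :
    (pushAt b ε (t, p)).2 ∈ (extChartAt (𝓡∂ m) c).source ∧
    extChartAt (𝓡∂ m) c (pushAt b ε (t, p)).2 =
      extChartAt (𝓡∂ m) c p.2 +
        (pushFactor ε t p.1 * b.toContDiffBump (extChartAt (𝓡∂ m) c p.2)) • inward m := by
  have h := pushAt_mem_target hK hε hεK t p.1 hx
  rw [pushAt, if_pos hx]
  refine ⟨(extChartAt (𝓡∂ m) c).map_target h, ?_⟩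
  rw [← bump_eq hx]
  exact (extChartAt (𝓡∂ m) c).right_inv h

lemma pushAt_eq_self (z : ℝ × Amb j M) (h : pushFactor ε z.1 z.2.1 = 0 ∨ b z.2.2 = 0) :
    pushAt b ε z = z.2 := by
  rw [pushAt]
  split_ifs with hx
  · have : pushFactor ε z.1 z.2.1 * b z.2.2 = 0 := by rcases h with h | h <;> simp [h]
    rw [this, zero_smul, add_zero, (extChartAt (𝓡∂ m) c).left_inv hx]
  · rfl

lemma pushAt_fst (z : ℝ × Amb j M) : (pushAt b ε z).1 = z.2.1 := by
  rw [pushAt]; split_ifs <;> rfl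

variable [T2Space M] [IsManifold (𝓡∂ m) ∞ M]

lemma contMDiff_pushAt (hK : LipschitzWith K b.toContDiffBump) (hε : 0 ≤ ε) (hεK : ε * K < 1) :
    ContMDiff (𝓘(ℝ, ℝ).prod (ambModel j m)) (ambModel j m) ∞
      (pushAt b ε : ℝ × Amb j M → Amb j M) := by
  intro z
  by_cases hz : z.2.2 ∈ (extChartAt (𝓡∂ m) c).source
  · set U : Set (ℝ × Amb j M) := (fun z => z.2.2) ⁻¹' (extChartAt (𝓡∂ m) c).source
    have hU : IsOpen U := (isOpen_extChartAt_source c).preimage (by fun_prop)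
    have hsnd : ContMDiff (𝓘(ℝ, ℝ).prod (ambModel j m)) (𝓡∂ m) ∞
        (fun z : ℝ × Amb j M => z.2.2) := contMDiff_snd.comp contMDiff_snd
    have hfst : ContMDiff (𝓘(ℝ, ℝ).prod (ambModel j m)) (𝓡 j) ∞
        (fun z : ℝ × Amb j M => z.2.1) := contMDiff_fst.comp contMDiff_snd
    have hcoef : ContMDiff (𝓘(ℝ, ℝ).prod (ambModel j m)) 𝓘(ℝ, ℝ) ∞
        (fun z : ℝ × Amb j M => pushFactor ε z.1 z.2.1) :=
      (contDiff_pushFactor ε).contMDiff.comp (contMDiff_fst.prodMk_space hfst)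
    have hb : ContMDiff (𝓘(ℝ, ℝ).prod (ambModel j m)) 𝓘(ℝ, ℝ) ∞
        (fun z : ℝ × Amb j M => b z.2.2) := b.contMDiff.comp hsnd
    have h1 : ContMDiffOn (𝓘(ℝ, ℝ).prod (ambModel j m)) 𝓘(ℝ, EuclideanSpace ℝ (Fin m)) ∞
        (fun z : ℝ × Amb j M => extChartAt (𝓡∂ m) c z.2.2 +
          (pushFactor ε z.1 z.2.1 * b z.2.2) • inward m) U := by
      refine ContMDiffOn.add ?_ ?_
      · refine (contMDiffOn_extChartAt (I := 𝓡∂ m) (x := c)).comp hsnd.contMDiffOn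
          fun z hz => ?_
        have hz' : z.2.2 ∈ (extChartAt (𝓡∂ m) c).source := hz
        rwa [extChartAt_source] at hz'
      · exact ((hcoef.mul hb).smul contMDiff_const).contMDiffOn
    have h2 : ContMDiffOn (𝓘(ℝ, ℝ).prod (ambModel j m)) (𝓡∂ m) ∞
        (fun z : ℝ × Amb j M => (extChartAt (𝓡∂ m) c).symm (extChartAt (𝓡∂ m) c z.2.2 +
          (pushFactor ε z.1 z.2.1 * b z.2.2) • inward m)) U :=
      (contMDiffOn_extChartAt_symm c).comp h1 fun z hz => pushAt_mem_target hK hε hεK z.1 z.2.1 hz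
    have h3 := (hfst.contMDiffOn (s := U)).prodMk h2
    refine (h3.congr fun z hz => ?_).contMDiffAt (hU.mem_nhds hz)
    rw [pushAt]; exact if_pos hz
  · have hz' : z.2.2 ∉ tsupport b := fun h => hz (b.tsupport_subset_extChartAt_source h)
    have h1 : ∀ᶠ z' : ℝ × Amb j M in 𝓝 z, z'.2.2 ∈ (tsupport b)ᶜ :=
      (by fun_prop : Continuous fun z' : ℝ × Amb j M => z'.2.2).continuousAt
        ((isClosed_tsupport b).isOpen_compl.mem_nhds hz')
    have h2 : (pushAt b ε : ℝ × Amb j M → Amb j M) =ᶠ[𝓝 z] fun z => z.2 := by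
      filter_upwards [h1] with z' hz'
      exact pushAt_eq_self z' (Or.inr (image_eq_zero_of_notMem_tsupport hz'))
    exact (contMDiff_snd z).congr_of_eventuallyEq h2

lemma immersion_pushAt (hK : LipschitzWith K b.toContDiffBump) (hε : 0 ≤ ε) (hεK : ε * K < 1)
    (t : ℝ) (p : Amb j M) : Function.Injective
      (mfderiv (ambModel j m) (ambModel j m) (fun p => pushAt b ε (t, p)) p) := by
  have hsm : ContMDiff (ambModel j m) (ambModel j m) ∞ (fun p : Amb j M => pushAt b ε (t, p)) :=
    (contMDiff_pushAt hK hε hεK).comp (contMDiff_const.prodMk contMDiff_id)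
  by_cases hp : p.2 ∈ (extChartAt (𝓡∂ m) c).source
  · set ψ := extChartAt (ambModel j m) ((0, c) : Amb j M) with hψ
    set f : Amb j M → Amb j M := fun p => pushAt b ε (t, p) with hf
    have hfp := (pushAt_snd_mem_source hK hε hεK t hp).1
    have d1 : HasMFDerivAt (ambModel j m) 𝓘(ℝ, _) ψ (f p) _ :=
      (mdifferentiableAt_extChartAt (I := ambModel j m) (x := ((0, c) : Amb j M)) (by
        rw [← extChartAt_source (ambModel j m)]; exact mem_extChartAt_amb_source hfp)).hasMFDerivAt
    have d2 : HasMFDerivAt (ambModel j m) 𝓘(ℝ, _) ψ p _ :=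
      (mdifferentiableAt_extChartAt (I := ambModel j m) (x := ((0, c) : Amb j M)) (by
        rw [← extChartAt_source (ambModel j m)]; exact mem_extChartAt_amb_source hp)).hasMFDerivAt
    have hinv := isInvertible_mfderiv_extChartAt (I := ambModel j m)
      (x := ((0, c) : Amb j M)) (mem_extChartAt_amb_source hp)
    obtain ⟨A, hA, hG⟩ := injective_fderiv_shear (V := EuclideanSpace ℝ (Fin j)) (e := inward m)
      (c := pushFactor ε t) (b := ψ p) hK b.contDiff.differentiable_one norm_inward
      (((contDiff_pushFactor ε).comp (contDiff_const.prodMk contDiff_id)).differentiable (by simp))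
      (pushFactor_nonneg hε t _)
      ((mul_le_mul_of_nonneg_right (pushFactor_le hε t _) K.2).trans_lt hεK)
    have e1 := d1.comp p ((hsm.mdifferentiable (by simp) p).hasMFDerivAt)
    have e2 := hG.hasMFDerivAt.comp p d2
    have heq : (ψ ∘ f) =ᶠ[𝓝 p] ((fun b' : EuclideanSpace ℝ (Fin j) × EuclideanSpace ℝ (Fin m) =>
        (b'.1, b'.2 + (pushFactor ε t b'.1 * b.toContDiffBump b'.2) • inward m)) ∘ ψ) := by
      have hn : ∀ᶠ r : Amb j M in 𝓝 p, r.2 ∈ (extChartAt (𝓡∂ m) c).source :=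
        continuous_snd.continuousAt ((isOpen_extChartAt_source c).mem_nhds hp)
      filter_upwards [hn] with r hr
      rw [Function.comp_apply, Function.comp_apply, hψ, extChartAt_amb_apply, extChartAt_amb_apply,
        (pushAt_snd_mem_source hK hε hεK t hr).2, hf]
      simp only [pushAt_fst]
    have e3 := hasMFDerivAt_unique e1 (e2.congr_of_eventuallyEq heq)
    have hinj : Function.Injective (A ∘ (mfderiv (ambModel j m) 𝓘(ℝ, _) ψ p)) :=
      hA.comp hinv.injective
    intro v w hvw
    apply hinj
    have h1 := DFunLike.congr_fun e3 v
    have h2 := DFunLike.congr_fun e3 w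
    refine Eq.trans h1.symm (Eq.trans ?_ h2)
    exact congrArg (mfderiv (ambModel j m) 𝓘(ℝ, _) ψ (f p)) hvw
  · have hz' : p.2 ∉ tsupport b := fun h => hp (b.tsupport_subset_extChartAt_source h)
    have h1 : ∀ᶠ r : Amb j M in 𝓝 p, r.2 ∈ (tsupport b)ᶜ :=
      continuous_snd.continuousAt ((isClosed_tsupport b).isOpen_compl.mem_nhds hz')
    have h2 : (fun p : Amb j M => pushAt b ε (t, p)) =ᶠ[𝓝 p] id := by
      filter_upwards [h1] with r hr
      exact pushAt_eq_self (t, r) (Or.inr (image_eq_zero_of_notMem_tsupport hr))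
    rw [h2.mfderiv_eq, mfderiv_id]
    exact fun _ _ h => h

lemma isPush_pushAt (hK : LipschitzWith K b.toContDiffBump) (hε : 0 < ε) (hεK : ε * K < 1) :
    IsPush j m (pushAt b ε) (Function.support b) where
  smooth := contMDiff_pushAt hK hε.le hεK
  immersion := immersion_pushAt hK hε.le hεK
  injective t := by
    intro p q hpq
    simp only at hpq
    have h1 : p.1 = q.1 := by
      have := congrArg Prod.fst hpq
      rwa [pushAt_fst, pushAt_fst] at this
    by_cases hp : p.2 ∈ (extChartAt (𝓡∂ m) c).source
    · obtain ⟨h2, h3⟩ := pushAt_snd_mem_source hK hε.le hεK t hp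
      have hq : q.2 ∈ (extChartAt (𝓡∂ m) c).source := by
        by_contra hq
        rw [hpq, pushAt, if_neg hq] at h2
        exact hq h2
      have h4 := (pushAt_snd_mem_source hK hε.le hεK t hq).2
      rw [← hpq, h3, h1] at h4
      have h5 := eq_of_add_smul_eq hK norm_inward (pushFactor_nonneg hε.le t _)
        ((mul_le_mul_of_nonneg_right (pushFactor_le hε.le t _) K.2).trans_lt hεK) h4
      exact Prod.ext h1 ((extChartAt (𝓡∂ m) c).injOn hp hq h5)
    · have hq : q.2 ∉ (extChartAt (𝓡∂ m) c).source := by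
        intro hq
        have h2 := (pushAt_snd_mem_source hK hε.le hεK t hq).1
        rw [← hpq, pushAt, if_neg hp] at h2
        exact hp h2
      rwa [pushAt, pushAt, if_neg hp, if_neg hq] at hpq
  fst t p := pushAt_fst _
  off t p hp := pushAt_eq_self _ (Or.inl (by
    rw [pushFactor, cubeBump_eq_zero hp, mul_zero]))
  zero p := pushAt_eq_self _ (Or.inl (by
    rw [pushFactor, Real.smoothTransition.zero, mul_zero, zero_mul]))
  fix t p hp := pushAt_eq_self _ (Or.inr (by simpa using hp))
  push t p ht hp hA := by
    have hx : p.2 ∈ (extChartAt (𝓡∂ m) c).source :=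
      b.tsupport_subset_extChartAt_source (subset_tsupport b hA)
    obtain ⟨h2, h3⟩ := pushAt_snd_mem_source hK hε.le hεK t hx
    set φ := extChartAt (𝓡∂ m) c with hφ
    set a := φ (pushAt b ε (t, p)).2 with ha
    have hat : a ∈ φ.target := φ.map_source h2
    have hpos : 0 < a 0 := by
      have h4 : φ p.2 ∈ range (𝓡∂ m) := extChartAt_target_subset_range c (φ.map_source hx)
      rw [range_modelWithCornersEuclideanHalfSpace, mem_ofPred_eq] at h4
      have h5 : 0 < b.toContDiffBump (φ p.2) := by
        rw [← bump_eq hx]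
        exact lt_of_le_of_ne b.nonneg (Ne.symm hA)
      have h6 : 0 < pushFactor ε t p.1 :=
        mul_pos (mul_pos hε (Real.smoothTransition.pos_of_pos ht)) (cubeBump_pos hp)
      rw [h3]
      simp only [PiLp.add_apply, PiLp.smul_apply, inward, PiLp.single_apply, if_true,
        smul_eq_mul, mul_one]
      positivity
    have hs : (pushAt b ε (t, p)).2 ∈ (chartAt (EuclideanHalfSpace m) c).source := by
      rwa [← extChartAt_source (𝓡∂ m)]
    refine ((𝓡∂ m).isInteriorPoint_iff_of_mem_atlas (n := ∞) (by simp)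
      (chart_mem_atlas _ c) hs).2 ?_
    change a ∈ interior φ.target
    rw [mem_interior_iff_mem_nhds]
    have h7 : range (𝓡∂ m) ∈ 𝓝 a := by
      rw [range_modelWithCornersEuclideanHalfSpace]
      have hcont : Continuous fun x : EuclideanSpace ℝ (Fin m) => x 0 := by fun_prop
      filter_upwards [hcont.continuousAt (Ioi_mem_nhds hpos)] with x hx using le_of_lt hx
    have h8 := extChartAt_target_mem_nhdsWithin' (I := 𝓡∂ m) h2
    rwa [nhdsWithin_eq_nhds.2 h7] at h8

variable (j m M) in
/-- There is a smooth isotopy of long embeddings, starting at the identity, that pushes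
`(I^j)° × M` off the boundary: compose the pushes in finitely many charts. -/
lemma exists_isPush_univ [CompactSpace M] :
    ∃ F : ℝ × Amb j M → Amb j M, IsPush j m F (univ : Set M) := by
  have h1 : ∀ c : M, ∃ F : ℝ × Amb j M → Amb j M, ∃ A ∈ 𝓝 c, IsPush j m F A := by
    intro c
    obtain ⟨b⟩ : Nonempty (SmoothBumpFunction (𝓡∂ m) c) := inferInstance
    obtain ⟨K, hK⟩ := ContDiff.lipschitzWith_of_hasCompactSupport
      b.toContDiffBump.hasCompactSupport (b.toContDiffBump.contDiff (n := 1)) (by simp)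
    refine ⟨pushAt b (1 / (K + 1)), _, b.support_mem_nhds, isPush_pushAt hK (by positivity) ?_⟩
    have : (0 : ℝ) < K + 1 := by positivity
    rw [one_div, inv_mul_lt_iff₀ this]; linarith
  choose F A hA hF using h1
  obtain ⟨l, -, hl⟩ := isCompact_univ.elim_nhds_subcover A (fun c _ => hA c)
  have h2 : ∀ l : Finset M, ∃ F : ℝ × Amb j M → Amb j M, IsPush j m F (⋃ c ∈ l, A c) := by
    classical
    intro l
    induction l using Finset.induction_on with
    | empty => exact ⟨_, by simpa using isPush_id⟩
    | insert c l _ ih =>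
      obtain ⟨G, hG⟩ := ih
      exact ⟨_, by rw [Finset.set_biUnion_insert]; exact (hF c).comp hG⟩
  obtain ⟨G, hG⟩ := h2 l
  exact ⟨G, by rwa [univ_subset_iff.1 hl] at hG⟩

end PushAt

/-! ### A path of diagrams with one puck that starts at the identity -/

section PushDiagram

variable {j m : ℕ} [NeZero m] {M : Type u} [TopologicalSpace M]
  [ChartedSpace (EuclideanHalfSpace m) M]

/-- Scaling the cube, with factor `1` for `t = 0` and `1/2` for `t = 1`. -/
def scale (z : ℝ × Amb j M) : Amb j M := ((1 - z.1 / 2) • z.2.1, z.2.2)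

lemma contMDiff_scale : ContMDiff (𝓘(ℝ, ℝ).prod (ambModel j m)) (ambModel j m) ∞
    (scale : ℝ × Amb j M → Amb j M) := by
  have h1 : ContMDiff (𝓘(ℝ, ℝ).prod (ambModel j m)) (𝓡 j) ∞
      (fun z : ℝ × Amb j M => z.2.1) := contMDiff_fst.comp contMDiff_snd
  have h2 : ContMDiff (𝓘(ℝ, ℝ).prod (ambModel j m)) 𝓘(ℝ, ℝ) ∞
      (fun z : ℝ × Amb j M => 1 - z.1 / 2) :=
    (by fun_prop : ContDiff ℝ ∞ fun t : ℝ => 1 - t / 2).contMDiff.comp contMDiff_fst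
  exact (h2.smul h1).prodMk (contMDiff_snd.comp contMDiff_snd)

lemma contMDiff_scale_at (t : ℝ) : ContMDiff (ambModel j m) (ambModel j m) ∞
    (fun p : Amb j M => scale (t, p)) :=
  contMDiff_scale.comp (contMDiff_const.prodMk contMDiff_id)

lemma immersion_scale {t : ℝ} (ht : t ≤ 1) (p : Amb j M) : Function.Injective
    (mfderiv (ambModel j m) (ambModel j m) (fun p : Amb j M => scale (t, p)) p) := by
  have ht' : (1 - t / 2) ≠ 0 := by linarith
  have hsm : ContMDiff (ambModel j m) (ambModel j m) ∞
      (fun p : Amb j M => (((1 - t / 2)⁻¹ • p.1, p.2) : Amb j M)) :=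
    ContMDiff.prodMk (f := fun p : Amb j M => (1 - t / 2)⁻¹ • p.1)
      ((contMDiff_const (c := (1 - t / 2)⁻¹) (I' := 𝓘(ℝ, ℝ))).smul contMDiff_fst) contMDiff_snd
  have h1 := mfderiv_comp (I' := ambModel j m) p
    (g := fun p : Amb j M => (((1 - t / 2)⁻¹ • p.1, p.2) : Amb j M))
    (f := fun p : Amb j M => scale (t, p))
    (hsm.mdifferentiable (by simp) _) ((contMDiff_scale_at t).mdifferentiable (by simp) _)
  have h2 : (fun p : Amb j M => (((1 - t / 2)⁻¹ • p.1, p.2) : Amb j M)) ∘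
      (fun p : Amb j M => scale (t, p)) = id := by
    funext p
    simp [scale, smul_smul, inv_mul_cancel₀ ht']
  rw [h2, mfderiv_id] at h1
  intro v w hvw
  have h3 := DFunLike.congr_fun h1 v
  have h4 := DFunLike.congr_fun h1 w
  refine Eq.trans h3 (Eq.trans ?_ h4.symm)
  exact congrArg (mfderiv (ambModel j m) (ambModel j m)
    (fun p : Amb j M => (((1 - t / 2)⁻¹ • p.1, p.2) : Amb j M)) (scale (t, p))) hvw

lemma scale_mem_solid {t : unitInterval} {p : Amb j M} (hp : p ∈ solid j M) :
    scale ((t : ℝ), p) ∈ solid j M := by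
  intro i
  have h1 := hp i
  have h2 := t.2
  simp only [scale, PiLp.smul_apply, smul_eq_mul]
  constructor <;> nlinarith [h1.1, h1.2, h2.1, h2.2]

lemma scale_mem_openSolid {t : unitInterval} (ht : 0 < t) {p : Amb j M} (hp : p ∈ solid j M) :
    scale ((t : ℝ), p) ∈ openSolid j M := by
  intro i
  have h1 := hp i
  have h2 := t.2
  have h3 : (0 : ℝ) < t := ht
  simp only [scale, PiLp.smul_apply, smul_eq_mul]
  constructor <;> nlinarith [h1.1, h1.2, h2.1, h2.2]

variable [IsManifold (𝓡∂ m) ∞ M]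

open Classical in
lemma layer_scale (t : unitInterval) : Layer m (solid j M)
    (fun p : Amb j M => if p ∈ solid j M then scale ((t : ℝ), p) else p) where
  region := Or.inr rfl
  imm := by
    have heq : ∀ p ∈ solid j M, (if p ∈ solid j M then scale ((t : ℝ), p) else p) =
      scale ((t : ℝ), p) := fun p hp => if_pos hp
    refine ⟨(contMDiff_scale_at t).contMDiffOn.congr heq, fun p hp => ?_⟩
    rw [mfderivWithin_congr heq (heq p hp), mfderivWithin_eq_mfderiv
      (uniqueMDiffOn_solid j m M p hp) ((contMDiff_scale_at t).mdifferentiable (by simp) p)]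
    exact immersion_scale t.2.2 p
  inj p hp q hq hpq := by
    have ht : (1 - (t : ℝ) / 2) ≠ 0 := by have := t.2.2; linarith
    simp only [if_pos hp, if_pos hq, scale, Prod.mk.injEq] at hpq
    exact Prod.ext (smul_right_injective _ ht hpq.1) hpq.2
  off p hp := if_neg hp
  mapsTo p hp := by
    simp only [if_pos hp]; exact scale_mem_solid hp

lemma IsPush.layer {F : ℝ × Amb j M → Amb j M} (hF : IsPush j m F univ) (t : ℝ) :
    Layer m univ (fun p => F (t, p)) where
  region := Or.inl rfl
  imm := ⟨(hF.smooth_at t).contMDiffOn, fun p _ => by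
    rw [mfderivWithin_univ]; exact hF.immersion t p⟩
  inj := (hF.injective t).injOn
  off p hp := hF.off t p fun h => hp (openSolid_subset_solid j M h)
  mapsTo p hp := by intro i; simp only [hF.fst]; exact hp i

variable [T2Space M] [CompactSpace M]

/-- The puck that scales the cube by a factor in `[1/2, 1]`. -/
def scalePuck (j m : ℕ) [NeZero m] (M : Type u) [TopologicalSpace M]
    [ChartedSpace (EuclideanHalfSpace m) M] [IsManifold (𝓡∂ m) ∞ M] [T2Space M] [CompactSpace M]
    (t : unitInterval) : Puck j m M :=
  (layer_scale t).toPuck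

lemma scalePuck_apply (t : unitInterval) {p : Amb j M} (hp : p ∈ solid j M) :
    scalePuck j m M t p = scale ((t : ℝ), p) := if_pos hp

lemma scalePuck_zero : scalePuck j m M 0 = idPuck j m M := by
  refine Puck.ext (funext fun p => ?_)
  by_cases hp : p ∈ solid j M
  · rw [scalePuck_apply 0 hp]; simp [scale, idPuck]
  · exact (scalePuck j m M 0).off_domain p hp

variable {F : ℝ × Amb j M → Amb j M} (hF : IsPush j m F univ)

/-- The long embedding at time `t` of an isotopy off the boundary. -/
def IsPush.long (t : unitInterval) : LongEmb j m M := (hF.layer t).toLongEmb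

lemma IsPush.long_zero : hF.long 0 = idLong j m M :=
  LongEmb.ext (funext fun p => hF.zero p)

lemma IsPush.disjoint_range_image_side {t : unitInterval} (ht : 0 < t) :
    Disjoint (range (hF.long t)) (scalePuck j m M t '' side j m M) := by
  rw [Set.disjoint_left]
  rintro _ ⟨p, rfl⟩ ⟨q, hq, hqp⟩
  rw [scalePuck_apply t hq.1] at hqp
  have hqp : scale ((t : ℝ), q) = F ((t : ℝ), p) := hqp
  have h1 : p ∈ openSolid j M := by
    rw [← hF.mem_openSolid_iff t, ← hqp]; exact scale_mem_openSolid ht hq.1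
  have h2 := hF.push t p ht h1 (mem_univ _)
  rw [← hqp] at h2
  exact notMem_boundary_of_mem_interior h2 hq.2

/-- A path of splicing diagrams with one puck from the identity of the operad to a diagram in the
suboperads: the puck is shrunk, and the long embedding is pushed off the boundary. -/
def IsPush.diagram (t : unitInterval) : PreDiagram j m M 1 where
  long := hF.long t
  puck _ := scalePuck j m M t
  perm := 1
  constraint_long k := by
    rcases eq_or_lt_of_le t.2.1 with ht | ht
    · obtain rfl : t = 0 := Subtype.ext ht.symm
      rw [hF.long_zero, scalePuck_zero]
      exact (idPre j m M).constraint_long 0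
    · have h1 : IsClosed (range (hF.long t)) := by
        rw [← image_univ]; exact (hF.layer t).isClosed_image isClosed_univ subset_rfl
      rw [← disjoint_iff_inter_eq_empty]
      exact (hF.disjoint_range_image_side ht).mono (closure_minimal sdiff_subset h1)
        (image_mono (show openSide j m M ⊆ side j m M from
          fun p hp => ⟨openSolid_subset_solid j M hp.1, hp.2⟩))
  constraint_puck i k h := absurd h (by rw [Subsingleton.elim i k]; exact lt_irrefl _)

lemma IsPush.isDisjoint_diagram {t : unitInterval} (ht : 0 < t) :
    IsDisjoint univ (hF.diagram t) :=
  ⟨fun _ => (hF.disjoint_range_image_side ht).mono_left (image_subset_range _ _),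
    fun i k h => absurd (Subsingleton.elim i k) h⟩

end PushDiagram

/-! ### Shrinking diagrams -/

section Shrink

variable {j m : ℕ} [NeZero m] {M : Type u} [TopologicalSpace M] [T2Space M] [CompactSpace M]
  [ChartedSpace (EuclideanHalfSpace m) M] [IsManifold (𝓡∂ m) ∞ M] {k : ℕ}

/-- The composite `P.(Q,…,Q)`, for a diagram `Q` with one puck, indexed by the pucks of `P`. -/
def shrink (P : PreDiagram j m M k) (Q : PreDiagram j m M 1) : PreDiagram j m M k where
  long := (layer_compLong P (n := fun _ => 1) fun _ => Q).toLongEmb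
  puck a := (layer_compPuck P (n := fun _ => 1) (fun _ => Q) a 0).toPuck
  perm := P.perm
  constraint_long a := by
    have h := below_compPuck P (n := fun _ => 1) (fun _ => Q) (layerBelow_long P) a
      (Nat.zero_le _) 0
    rw [image_univ] at h
    exact h
  constraint_puck a a' h :=
    below_compPuck P (n := fun _ => 1) (fun _ => Q) (layerBelow_puck P (fun _ => Q) a 0) a' h 0

/-- Only the diagram `Q` has to be disjoint for `P.(Q,…,Q)` to be disjoint. -/
lemma isDisjoint_shrink (P : PreDiagram j m M k) {Q : PreDiagram j m M 1}
    (hQ : IsDisjoint univ Q) : IsDisjoint univ (shrink P Q) := by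
  have h := IsDisjoint.compose (P := P) (n := fun _ => 1) (Q := fun _ => Q) (Or.inr rfl)
    (Or.inl rfl) fun _ => hQ
  constructor
  · intro a
    have h1 := h.1 (finSigmaFinEquiv ⟨a, 0⟩)
    rw [compose_puck] at h1
    exact h1
  · intro a a' hne
    have h1 := h.2 (finSigmaFinEquiv ⟨a, 0⟩) (finSigmaFinEquiv ⟨a', 0⟩) fun h2 =>
      hne (congrArg Sigma.fst (finSigmaFinEquiv.injective h2))
    rw [compose_puck, compose_puck] at h1
    exact h1

/-- Shrinking is well defined on equivalence classes. -/
lemma shrink_congr {P P' : PreDiagram j m M k} (h : diagramSetoid j m M k P P')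
    (Q : PreDiagram j m M 1) : diagramSetoid j m M k (shrink P Q) (shrink P' Q) := by
  have hQ : ∀ _ : Fin k, diagramSetoid j m M 1 Q Q := fun _ => (diagramSetoid j m M 1).refl Q
  refine ⟨LongEmb.ext (compLong_congr (n := fun _ => 1) h hQ),
    funext fun a => Puck.ext (compPuck_congr (n := fun _ => 1) h hQ a 0), fun a a' hne => ?_⟩
  have e := fun a => compPuck_congr (n := fun _ => 1) h hQ a 0
  refine ⟨compose_lt_of_overlap (n := fun _ => 1) (Q := fun _ => Q) h 0 0 hne, ?_⟩
  refine compose_lt_of_overlap (n := fun _ => 1) (Q := fun _ => Q)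
    ((diagramSetoid j m M k).symm h) 0 0 ?_
  rw [← e, ← e]
  exact hne

lemma graft_id (J : Puck j m M) : graft J id = id := by
  funext p
  by_cases hp : p ∈ J '' solid j M
  · obtain ⟨q, hq, rfl⟩ := hp
    rw [graft_apply J _ hq]; rfl
  · exact graft_of_notMem J _ hp

/-- Shrinking by a representative of the identity of the operad changes nothing. -/
lemma shrink_eq_self (P : PreDiagram j m M k) {Q : PreDiagram j m M 1}
    (h1 : Q.long = idLong j m M) (h2 : Q.puck 0 = idPuck j m M) : shrink P Q = P := by
  have h3 : ∀ c, composeFrom (graftAt P (n := fun _ => 1) fun _ => Q) c = id := by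
    have hg : ∀ i, graftAt P (n := fun _ => 1) (fun _ => Q) i = id := fun i => by
      rw [graftAt, h1]; exact graft_id _
    intro c
    rcases le_total c k with hc | hc
    · exact composeFrom_induction _ (P := fun _ f => f = id)
        (fun i f hf => by rw [hf, hg]; rfl) hc rfl
    · exact composeFrom_of_le _ hc
  refine PreDiagram.ext (LongEmb.ext ?_) (funext fun a => Puck.ext ?_) rfl
  · change compLong P (n := fun _ => 1) (fun _ => Q) = P.long
    rw [compLong, h3]; rfl
  · change compPuck P (n := fun _ => 1) (fun _ => Q) a 0 = P.puck a
    rw [compPuck, h3, h2]; rfl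

end Shrink

/-! ### Continuity of the deformation -/

section ShrinkContinuity

variable {j m : ℕ} [NeZero m] {M : Type u} [TopologicalSpace M]
  [ChartedSpace (EuclideanHalfSpace m) M] [IsManifold (𝓡∂ m) ∞ M] {k : ℕ}

lemma continuous_rng_inf_induced {X Y A₁ A₂ A₃ : Type*} [TopologicalSpace X]
    {t₁ : TopologicalSpace A₁} {t₂ : TopologicalSpace A₂} {t₃ : TopologicalSpace A₃}
    {a₁ : Y → A₁} {a₂ : Y → A₂} {a₃ : Y → A₃} {g : X → Y} :
    @Continuous X Y _ (t₁.induced a₁ ⊓ t₂.induced a₂ ⊓ t₃.induced a₃) g ↔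
      Continuous (fun x => a₁ (g x)) ∧ Continuous (fun x => a₂ (g x)) ∧
        Continuous fun x => a₃ (g x) := by
  rw [continuous_inf_rng, continuous_inf_rng, continuous_induced_rng, continuous_induced_rng,
    continuous_induced_rng, and_assoc]
  rfl

lemma continuous_preDiagram_iff {X : Type u} [TopologicalSpace X] {g : X → PreDiagram j m M k} :
    Continuous g ↔ Continuous (fun x => (g x).long) ∧ (∀ a, Continuous fun x => (g x).puck a) ∧
      @Continuous _ _ _ ⊥ fun x => (g x).perm := by
  have h := continuous_rng_inf_induced (X := X) (t₁ := inferInstance) (t₂ := inferInstance)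
    (t₃ := ⊥) (a₁ := PreDiagram.long (j := j) (m := m) (M := M) (n := k))
    (a₂ := PreDiagram.puck) (a₃ := PreDiagram.perm) (g := g)
  rw [show (@Continuous _ _ _ Pi.topologicalSpace (fun x => (g x).puck)) ↔ _ from
    continuous_pi_iff] at h
  exact h

lemma PreDiagram.continuous_long : Continuous (PreDiagram.long : PreDiagram j m M k → _) :=
  (continuous_preDiagram_iff.1 continuous_id).1

lemma PreDiagram.continuous_puck (a : Fin k) :
    Continuous (fun P : PreDiagram j m M k => P.puck a) :=
  (continuous_preDiagram_iff.1 continuous_id).2.1 a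

lemma PreDiagram.continuous_perm :
    @Continuous _ _ _ ⊥ (PreDiagram.perm : PreDiagram j m M k → _) :=
  (continuous_preDiagram_iff.1 continuous_id).2.2

lemma PreDiagram.isOpen_perm_eq (α : Equiv.Perm (Fin k)) :
    IsOpen {P : PreDiagram j m M k | P.perm = α} :=
  let _ : TopologicalSpace (Equiv.Perm (Fin k)) := ⊥
  have : DiscreteTopology (Equiv.Perm (Fin k)) := ⟨rfl⟩
  (isOpen_discrete {α}).preimage PreDiagram.continuous_perm

/-- Continuity can be tested on the open sets of tuples with a given permutation. -/
lemma continuous_of_perm {X Y : Type u} [TopologicalSpace X] [TopologicalSpace Y]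
    {P : X → PreDiagram j m M k} (hP : Continuous P) {g : X → Y}
    (h : ∀ α, Continuous fun x : {x // (P x).perm = α} => g x) : Continuous g := by
  rw [continuous_iff_continuousAt]
  intro x
  have hU : IsOpen {y | (P y).perm = (P x).perm} :=
    (PreDiagram.isOpen_perm_eq (P x).perm).preimage hP
  exact (hU.isOpenEmbedding_subtypeVal.continuousAt_iff (x := ⟨x, rfl⟩)).1
    (h (P x).perm).continuousAt

variable [T2Space M] [CompactSpace M] {X : Type u} [TopologicalSpace X]

lemma jointCInfty_long {s : X → LongEmb j m M} (hs : Continuous s) :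
    JointCInfty (ambModel j m) univ (fun x => s x) :=
  jointCInfty_of_continuous isClosed_univ uniqueMDiffOn_univ (fun x => (s x).smooth.contMDiffOn)
    (continuous_induced_rng.1 hs)

lemma jointCInfty_puck {J : X → Puck j m M} (hJ : Continuous J) :
    JointCInfty (ambModel j m) (solid j M) (fun x => J x) :=
  jointCInfty_of_continuous (isClosed_solid j M) (uniqueMDiffOn_solid j m M)
    (fun x => (J x).smooth) (continuous_induced_rng.1 hJ)

variable {F : ℝ × Amb j M → Amb j M} (hF : IsPush j m F univ)

/-- The deformation is continuous on tuples: on the open set of tuples with a given permutation, it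
is a composite of graftings, which are continuous in families. -/
lemma continuous_shrink :
    Continuous fun z : PreDiagram j m M k × unitInterval => shrink z.1 (hF.diagram z.2) := by
  have hlong : ∀ α, JointCInfty (ambModel j m) univ
      (fun z : {z : PreDiagram j m M k × unitInterval // z.1.perm = α} =>
        hF.long z.1.2) := fun α l =>
    jointCk_of_contMDiff (by fun_prop : Continuous fun z : {z : PreDiagram j m M k × unitInterval //
      z.1.perm = α} => (z.1.2 : ℝ)) l hF.smooth uniqueMDiffOn_univ fun x p _ => rfl
  have hscale : ∀ α, JointCInfty (ambModel j m) (solid j M)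
      (fun z : {z : PreDiagram j m M k × unitInterval // z.1.perm = α} =>
        scalePuck j m M z.1.2) := fun α l =>
    jointCk_of_contMDiff (by fun_prop : Continuous fun z : {z : PreDiagram j m M k × unitInterval //
      z.1.perm = α} => (z.1.2 : ℝ)) l contMDiff_scale (uniqueMDiffOn_solid j m M)
      fun x p hp => scalePuck_apply _ hp
  have hpuck : ∀ α a, JointCInfty (ambModel j m) (solid j M)
      (fun z : {z : PreDiagram j m M k × unitInterval // z.1.perm = α} => z.1.1.puck a) :=
    fun α a => jointCInfty_puck ((PreDiagram.continuous_puck a).comp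
      (continuous_fst.comp continuous_subtype_val))
  refine continuous_preDiagram_iff.2 ⟨?_, fun a => ?_, ?_⟩
  · refine continuous_of_perm (P := Prod.fst) continuous_fst fun α => continuous_induced_rng.2 ?_
    exact (jointCInfty_composeFrom (n := fun _ => 1) (T := univ)
      (P := fun z : {z : PreDiagram j m M k × unitInterval // z.1.perm = α} => z.1.1)
      (f := fun z => z.1.1.long) (Q := fun z _ => hF.diagram z.1.2) (α := α) (fun z => z.2)
      (hpuck α) (fun _ => hlong α) (Nat.zero_le _) (fun z => layerBelow_long z.1.1)
      (jointCInfty_long (PreDiagram.continuous_long.comp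
        (continuous_fst.comp continuous_subtype_val)))).continuous
  · refine continuous_of_perm (P := Prod.fst) continuous_fst fun α => continuous_induced_rng.2 ?_
    have h1 := jointCInfty_composeFrom (n := fun _ => 1) (T := solid j M)
      (P := fun z : {z : PreDiagram j m M k × unitInterval // z.1.perm = α} => z.1.1)
      (Q := fun z _ => hF.diagram z.1.2) (α := α) (fun z => z.2) (hpuck α) (fun _ => hlong α)
      (c := α⁻¹ a + 1) (α⁻¹ a).2 (f := fun z => z.1.1.puck a ∘ scalePuck j m M z.1.2)
      (fun z => by
        have := layerBelow_puck z.1.1 (n := fun _ => 1) (fun _ => hF.diagram z.1.2) a 0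
        rwa [z.2] at this)
      (fun l => JointCk.comp l (hpuck α a l) (hscale α l) (uniqueMDiffOn_solid j m M)
        (uniqueMDiffOn_solid j m M) (fun z => (z.1.1.puck a).smooth)
        (fun z => (scalePuck j m M z.1.2).smooth) (fun z => (scalePuck j m M z.1.2).mapsTo))
    convert h1.continuous using 2 with z
    change composeFrom _ (z.1.1.perm⁻¹ a + 1) ∘ _ = _
    rw [z.2]; rfl
  · let _ : TopologicalSpace (Equiv.Perm (Fin k)) := ⊥
    exact (PreDiagram.continuous_perm.comp continuous_fst :
      Continuous fun z : PreDiagram j m M k × unitInterval => z.1.perm)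

/-- The deformation of the space of splicing diagrams. -/
def SC.shrink (z : SC j m M k × unitInterval) : SC j m M k :=
  Quotient.map' (s₁ := diagramSetoid j m M k) (s₂ := diagramSetoid j m M k)
    (fun P => Splicing.shrink P (hF.diagram z.2)) (fun _ _ h => shrink_congr h _) z.1

lemma SC.continuous_shrink : Continuous (SC.shrink hF : SC j m M k × unitInterval → SC j m M k) :=
  (isQuotientMap_quotient_mk' (s := diagramSetoid j m M k)).continuous_lift_prod_left
    (continuous_quotient_mk'.comp (Splicing.continuous_shrink hF))

lemma SC.shrink_zero (x : SC j m M k) : SC.shrink hF (x, 0) = x := by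
  obtain ⟨P, rfl⟩ : ∃ P, SC.mk P = x := Quotient.exists_rep x
  exact congrArg SC.mk (shrink_eq_self P hF.long_zero scalePuck_zero)

lemma SC.shrink_mem_SCstrict {t : unitInterval} (ht : 0 < t) (x : SC j m M k) :
    SC.shrink hF (x, t) ∈ SCstrict j m M k := by
  obtain ⟨P, rfl⟩ : ∃ P, SC.mk P = x := Quotient.exists_rep x
  exact isDisjoint_shrink P (hF.isDisjoint_diagram ht)

end ShrinkContinuity

/-! ### The homotopy equivalences -/

section HomotopyEquivalence

/-- The inclusion of a subspace `A` is a homotopy equivalence if a deformation of the whole space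
is in `A` at all positive times: it restricts to a deformation of `A`. -/
lemma inclusionIsHomotopyEquiv_of_deformation {X : Type u} [TopologicalSpace X] {A : Set X}
    {H : X × unitInterval → X} (hH : Continuous H) (h0 : ∀ x, H (x, 0) = x)
    (hA : ∀ x t, 0 < t → H (x, t) ∈ A) : InclusionIsHomotopyEquiv A := by
  have hA' : ∀ (a : A) t, H (a, t) ∈ A := by
    intro a t
    rcases eq_or_lt_of_le (show (0 : unitInterval) ≤ t from t.2.1) with rfl | ht
    · rw [h0]; exact a.2
    · exact hA a t ht
  let r : C(X, A) := ⟨fun x => ⟨H (x, 1), hA x 1 zero_lt_one⟩, by fun_prop⟩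
  let i : C(A, X) := ⟨Subtype.val, continuous_subtype_val⟩
  refine ⟨⟨i, r, ⟨ContinuousMap.Homotopy.symm ⟨⟨fun z => ⟨H (z.2, z.1), hA' z.2 z.1⟩, by fun_prop⟩,
    fun a => Subtype.ext (h0 a), fun a => rfl⟩⟩, ⟨ContinuousMap.Homotopy.symm
    ⟨⟨fun z => H (z.2, z.1), by fun_prop⟩, h0, fun a => rfl⟩⟩⟩, fun a => rfl⟩

end HomotopyEquivalence

section Conclusion

variable (j m : ℕ) [NeZero m] (M : Type u) [TopologicalSpace M] [T2Space M] [CompactSpace M]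
  [ChartedSpace (EuclideanHalfSpace m) M] [IsManifold (𝓡∂ m) ∞ M]

/-- Any subspace that contains the diagrams with disjoint components is homotopy equivalent to the
whole space: shrinking by `hF.diagram t` makes every diagram disjoint as soon as `t > 0`. -/
lemma inclusionIsHomotopyEquiv_of_SCstrict_subset (k : ℕ) {A : Set (SC j m M k)}
    (hA : SCstrict j m M k ⊆ A) : InclusionIsHomotopyEquiv A := by
  obtain ⟨F, hF⟩ := exists_isPush_univ j m M
  exact inclusionIsHomotopyEquiv_of_deformation (SC.continuous_shrink hF) (SC.shrink_zero hF)
    fun x t ht => hA (SC.shrink_mem_SCstrict hF ht x)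

lemma SCstrict_subset_SCcirc (k : ℕ) : SCstrict j m M k ⊆ SCcirc j m M k :=
  fun _ hx => ⟨fun i => (hx.1 i).mono_left (image_mono fun _ _ => mem_univ _), hx.2⟩

end Conclusion

end Splicing

end

theorem mainTheorem7 (j m : ℕ) [NeZero m] (M : Type*) [TopologicalSpace M] [T2Space M]
    [CompactSpace M] [ConnectedSpace M] [ChartedSpace (EuclideanHalfSpace m) M]
    [IsManifold (𝓡∂ m) ∞ M] (hM : ((𝓡∂ m).boundary M).Nonempty) :
    -- the structure maps of the operad of splicing diagrams are well defined
    (∀ (k : ℕ) (n : Fin k → ℕ) (J : Splicing.SC j m M k) (L : ∀ a, Splicing.SC j m M (n a)),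
      ∃! K, Splicing.IsComposite J L K) ∧
    -- the subspace of diagrams with disjoint components
    (Splicing.IsSuboperadWithoutIdentity (Splicing.SCcirc j m M) ∧
      ∀ k, Splicing.InclusionIsHomotopyEquiv (Splicing.SCcirc j m M k)) ∧
    -- the variant in which the long embedding is not restricted to the interior of `M`
    (Splicing.IsSuboperadWithoutIdentity (Splicing.SCstrict j m M) ∧
      Splicing.SC.one j m M ∉ Splicing.SCstrict j m M 1 ∧
      ∀ k, Splicing.InclusionIsHomotopyEquiv (Splicing.SCstrict j m M k)) := by
  refine ⟨fun k n J L => Splicing.existsUnique_isComposite J L,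
    ⟨Splicing.isSuboperad_disjointDiagrams (Or.inl rfl), fun k =>
      Splicing.inclusionIsHomotopyEquiv_of_SCstrict_subset j m M k
        (Splicing.SCstrict_subset_SCcirc j m M k)⟩,
    Splicing.isSuboperad_disjointDiagrams (Or.inr rfl), Splicing.one_notMem_SCstrict hM,
    fun k => Splicing.inclusionIsHomotopyEquiv_of_SCstrict_subset j m M k subset_rfl⟩
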